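/- Let $n$ be a dimension. There is a constant $C$ depending only on $n$ such that the following holds. Let $X$ be a complex Banach space with the UMD property and let $1<p<\infty$. For $j\in\mathbb{Z}$ let $f_j\in L^p(\mathbb{R}^n;X)$ be such that the (distributional) Fourier transform $\hat f_j$, with $\hat f(\xi)=\int f(x)e^{-2\pi i x\cdot\xi}\,dx$, is supported in the closed ball $\{|\xi|\le 2^{-j}\}$, let $y_j\in\mathbb{R}^n$, and let $(\varepsilon_j)_{j\in\mathbb{Z}}$ be independent random signs on a probability space $\Omega$ with $\mathbb{P}(\varepsilon_j=1)=\mathbb{P}(\varepsilon_j=-1)=\tfrac12$. Then $$\Big\|\sum_j\varepsilon_j f_j(\cdot-2^jy_j)\Big\|_{L^p(\Omega\times\mathbb{R}^n;X)}\le C\,\alpha_{p,X}^n\,\beta_{p,X}^2\,\Big(1+\sup_j\log^+|y_j|\Big)\Big\|\sum_j\varepsilon_j f_j\Big\|_{L^p(\Omega\times\mathbb{R}^n;X)},$$ where the sums and the supremum run over an arbitrary finite set of indices $j$. The same holds for the full sums over $j\in\mathbb{Z}$: if $\sum_j\varepsilon_jf_j$ converges unconditionally in $L^p(\Omega\times\mathbb{R}^n;X)$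 and the constant $C\alpha_{p,X}^n\beta_{p,X}^2(1+\sup_{j\in\mathbb{Z}}\log^+|y_j|)$ is finite, then $\sum_j\varepsilon_jf_j(\cdot-2^jy_j)$ converges unconditionally in $L^p(\Omega\times\mathbb{R}^n;X)$ and the estimate holds. Here $\log^+t=\max(0,\log t)$ (and $\log^+0=0$). The number $\beta_{p,X}\in[0,\infty]$ is the UMD constant, i.e. the least $\beta$ such that $\|\sum_{k<N}\epsilon_kd_k\|_p\le\beta\|\sum_{k<N}d_k\|_p$ for every $N$, all signs $\epsilon_k\in\{-1,1\}$, and every $X$-valued $L^p$ martingale difference sequence $(d_k)_{k\ge0}$ with respect to a $\sigma$-finite filtration on a $\sigma$-finite measure space; $X$ is UMD if $\beta_{q,X}<\infty$ for all $1<q<\infty$. The number $\alpha_{p,X}\in[0,\infty]$ is the norm on $L^p(\mathbb{R};X)$ of the Hilbert transform, the Fourier multiplier operator with symbol $-i\,\mathrm{sgn}\,\xi$ (initially defined on $X$-valued Schwartz functions). -/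

import Mathlib

open MeasureTheory ProbabilityTheory Filter Topology
open scoped ENNReal NNReal SchwartzMap FourierTransform

universe u v

noncomputable section

/-- `d` is an `L^p` martingale difference sequence for the `σ`-finite filtration `ℱ`:
each `d k` is `ℱ k`-measurable and in `L^p(μ; X)`, and the conditional expectation of `d (k + 1)`
given `ℱ k` vanishes.  The last condition is tested on the `ℱ k`-measurable sets of finite measure,
which is what conditional expectation means for `L^p` functions on a `σ`-finite measure space
(such functions need not be integrable on the whole space). -/
structure IsMartingaleDifference {X : Type u} [NormedAddCommGroup X] [NormedSpace ℂ X]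
    {S : Type v} {m : MeasurableSpace S} (p : ℝ≥0∞) (μ : Measure S) (ℱ : Filtration ℕ m)
    (d : ℕ → S → X) : Prop where
  stronglyMeasurable : ∀ k, StronglyMeasurable[ℱ k] (d k)
  memLp : ∀ k, MemLp (d k) p μ
  setIntegral_eq_zero : ∀ k (A : Set S), MeasurableSet[ℱ k] A → μ A ≠ ⊤ →
    ∫ s in A, d (k + 1) s ∂μ = 0

/-- The UMD constant `β_{p,X}`: the unconditionality constant of `X`-valued martingale differences
in `L^p`, that is, the least `β` such that
`‖∑_{k<N} ε_k d_k‖_p ≤ β ‖∑_{k<N} d_k‖_p` for all martingale difference sequences on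
`σ`-finite measure spaces, all `N` and all signs `ε_k ∈ {-1, 1}`.
It is `⊤` if there is no finite such `β`. -/
def umdConst (p : ℝ≥0∞) (X : Type u) [NormedAddCommGroup X] [NormedSpace ℂ X] : ℝ≥0∞ :=
  sInf {β : ℝ≥0∞ |
    ∀ (S : Type) (m : MeasurableSpace S) (μ : Measure S) (ℱ : Filtration ℕ m) (d : ℕ → S → X),
      SigmaFinite μ → SigmaFiniteFiltration μ ℱ → IsMartingaleDifference p μ ℱ d →
      ∀ (ε : ℕ → ℝ), (∀ k, ε k = 1 ∨ ε k = -1) → ∀ N : ℕ,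
        eLpNorm (fun s => ∑ k ∈ Finset.range N, ε k • d k s) p μ
          ≤ β * eLpNorm (fun s => ∑ k ∈ Finset.range N, d k s) p μ}

/-- UMD spaces: martingale differences are unconditional in `L^p` for all `1 < p < ∞`. -/
def IsUMD (X : Type u) [NormedAddCommGroup X] [NormedSpace ℂ X] : Prop :=
  ∀ p : ℝ≥0∞, 1 < p → p ≠ ⊤ → umdConst p X < ⊤

/-- The Hilbert transform of an `X`-valued Schwartz function: the Fourier multiplier operator with
symbol `-i sgn ξ`. -/
def hilbertTransform {X : Type u} [NormedAddCommGroup X] [NormedSpace ℂ X]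
    (f : 𝓢(ℝ, X)) : ℝ → X :=
  𝓕⁻ (fun ξ : ℝ => (-Complex.I * ((Real.sign ξ : ℝ) : ℂ)) • 𝓕 (f : ℝ → X) ξ)

/-- The norm `α_{p,X}` of the Hilbert transform on `L^p(ℝ; X)`, computed on the dense subspace of
Schwartz functions.  It is `⊤` if the Hilbert transform is unbounded. -/
def hilbertConst (p : ℝ≥0∞) (X : Type u) [NormedAddCommGroup X] [NormedSpace ℂ X] : ℝ≥0∞ :=
  sInf {A : ℝ≥0∞ | ∀ f : 𝓢(ℝ, X),
    eLpNorm (hilbertTransform f) p volume ≤ A * eLpNorm (f : ℝ → X) p volume}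

/-- Independent symmetric random signs. -/
structure IsRademacher {Ω : Type v} [MeasurableSpace Ω] (P : Measure Ω) (r : ℤ → Ω → ℝ) :
    Prop where
  measurable : ∀ j, Measurable (r j)
  indep : iIndepFun r P
  prob_one : ∀ j, P {ω | r j ω = 1} = 1 / 2
  prob_neg_one : ∀ j, P {ω | r j ω = -1} = 1 / 2

/-- The series `∑_j g_j` of functions converges (unconditionally) in `L^p(μ; X)`, with sum `G`. -/
def HasLpSum {X : Type u} [NormedAddCommGroup X] {S : Type v} [MeasurableSpace S] (p : ℝ≥0∞)
    (μ : Measure S) (g : ℤ → S → X) (G : S → X) : Prop :=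
  (∀ j, MemLp (g j) p μ) ∧ MemLp G p μ ∧
    Tendsto (fun J : Finset ℤ => eLpNorm (fun s => (∑ j ∈ J, g j s) - G s) p μ) atTop (𝓝 0)

/-- The support of the distributional Fourier transform of `f ∈ L^p(ℝⁿ; X)`. -/
def fourierSupport {n : ℕ} {X : Type u} [NormedAddCommGroup X] [NormedSpace ℂ X] [CompleteSpace X]
    {p : ℝ≥0∞} [Fact (1 ≤ p)] (f : Lp X p (volume : Measure (EuclideanSpace ℝ (Fin n)))) :
    Set (EuclideanSpace ℝ (Fin n)) :=
  Distribution.dsupport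
    (𝓕 (Lp.toTemperedDistribution f) : 𝓢'(EuclideanSpace ℝ (Fin n), X))

/-- The function `(ω, x) ↦ r_j(ω) f_j(x - 2^j y_j)` on `Ω × ℝⁿ`. -/
def randomTranslate {n : ℕ} {X : Type u} [NormedAddCommGroup X] [NormedSpace ℂ X]
    {Ω : Type v} (r : ℤ → Ω → ℝ)
    (f : ℤ → EuclideanSpace ℝ (Fin n) → X) (y : ℤ → EuclideanSpace ℝ (Fin n)) (j : ℤ)
    (z : Ω × EuclideanSpace ℝ (Fin n)) : X :=
  r j z.1 • f j (z.2 - (2 : ℝ) ^ j • y j)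

end

/-!
The theorem follows from a bound in which `β` occurs only to the first power and `α` not at all: the
translated random sum is at most `C (1 + β) (1 + Λ)` times the original one, where
`Λ = sup_j log⁺ |y_j|`. When `X ≠ 0` both constants are at least `1`
(`one_le_hilbertConst`, `one_le_umdConst`), and `1 + β ≤ 2 α^n β²`.

*Dyadic model.* Consider a grid of cubes of side `δ = 2^j`. The operator `pairShift` copies averages
over a small window of a cube to a window of the cube displaced by the lattice vector `m ≈ y_j`, for
a periodic family of cubes. Cubes `k` and `k + m` are arranged in disjoint pairs inside the larger
cubes of side `4 w δ`, where `w = pairWidth m` is a power of two comparable with `|m|`. The operator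
is therefore a pointwise bounded multiple of an averaging operator over the unions of paired cubes.
The partitions into such unions are nested for scales whose indices differ by at least
`M ≈ log₂ (4 w)`, so that Stein's inequality `radNorm_fiberAvg_le`, which follows from the UMD
property by a decoupling into martingale differences on signs times `ℝⁿ`, applies to each residue
class of `j` modulo `M`. Adding up the `M` classes costs the logarithmic factor
(`radNorm_pairShift_le`).

*Averaging.* The average of `pairShift` over the position of the grid is the translate by `δ y_j` of
the convolution with a product of tent functions, up to the factor `4^{-n}`
(`integral_cornerMeasure_pairShift`). As one random grid serves all scales, Minkowski's inequality
gives the bound for `tentShift`.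

*Reproducing formula.* The Fourier transform of a narrow tent has no zeros in a ball of radius `3`.
Division by it produces a Schwartz function `κ` such that every `f` with Fourier support in the
ball of radius `δ⁻¹` satisfies
`f (x - δ y) = ∫ κ(u) (tentShift of f by δ (y + u)) (x) du`
(`exists_translate_eq_integral_tentShift`). The logarithmic bound for the translations `y_j + u`
grows at most linearly in `|u|`, so that it can be integrated against `κ`, which gives the estimate
for finite sums (`exists_finite_estimate`). For series, the estimate transfers the Cauchy criterion
for unconditional convergence in `L^p` (`HasLpSum.exists_of_forall_le`).
-/

/-! ### Random sums over the discrete cube -/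

/-- The `l`-th Rademacher function on the discrete cube `{±1}^N`, encoded as `Fin N → Bool`;
it is `0` for indices `l ≥ N`. -/
noncomputable def cubeSign (N l : ℕ) (s : Fin N → Bool) : ℝ :=
  if h : l < N then (if s ⟨l, h⟩ then 1 else -1) else 0

/-- The `L^p` norm of the random sum `∑_{l<N} ε_l g_l` over the discrete cube. The cube carries the
counting measure, so that this differs by the factor `2^{N/p}` from the norm over a probability
space. -/
noncomputable def radNorm {X : Type*} [NormedAddCommGroup X] [NormedSpace ℝ X]
    {S : Type*} [MeasurableSpace S] (N : ℕ) (p : ℝ≥0∞) (μ : Measure S) (g : ℕ → S → X) : ℝ≥0∞ :=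
  eLpNorm (fun z : (Fin N → Bool) × S => ∑ l ∈ Finset.range N, cubeSign N l z.1 • g l z.2) p
    (Measure.count.prod μ)

section RandomSums

variable {X : Type*} [NormedAddCommGroup X] [NormedSpace ℝ X]
  {S : Type*} [MeasurableSpace S] {N : ℕ} {p : ℝ≥0∞} {μ : Measure S}

/-- The involution of the discrete cube that changes the sign of the coordinate `i`. -/
def cubeFlip {N : ℕ} (i : Fin N) : Equiv.Perm (Fin N → Bool) :=
  Function.Involutive.toPerm (fun s => Function.update s i (!s i)) fun s => by simp

theorem cubeFlip_apply (i : Fin N) (s : Fin N → Bool) :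
    cubeFlip i s = Function.update s i (!s i) := rfl

theorem cubeSign_flip_self (i : Fin N) (s : Fin N → Bool) :
    cubeSign N i (cubeFlip i s) = -cubeSign N i s := by
  simp only [cubeSign, cubeFlip_apply, i.2, dite_true, Fin.eta, Function.update_self]
  cases s i <;> simp

theorem cubeSign_flip_of_ne (i : Fin N) (s : Fin N → Bool) {l : ℕ} (h : l ≠ i) :
    cubeSign N l (cubeFlip i s) = cubeSign N l s := by
  unfold cubeSign
  split_ifs with h1 <;>
    simp_all [cubeFlip_apply, Fin.ext_iff]

theorem norm_add_smul_rpow_le {q : ℝ} (hq : 1 ≤ q) (x y : X) {c : ℝ} (hc : |c| ≤ 1) :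
    ‖x + c • y‖ ^ q ≤ (1 + c) / 2 * ‖x + y‖ ^ q + (1 - c) / 2 * ‖x - y‖ ^ q := by
  have hc' := abs_le.1 hc
  have h1 : ‖x + c • y‖ ≤ (1 + c) / 2 * ‖x + y‖ + (1 - c) / 2 * ‖x - y‖ := by
    have : x + c • y = ((1 + c) / 2) • (x + y) + ((1 - c) / 2) • (x - y) := by module
    rw [this]
    refine (norm_add_le _ _).trans (le_of_eq ?_)
    rw [norm_smul, norm_smul, Real.norm_of_nonneg (by linarith), Real.norm_of_nonneg (by linarith)]
  refine (Real.rpow_le_rpow (norm_nonneg _) h1 (by linarith)).trans ?_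
  have h2 : 0 ≤ (1 + c) / 2 := by linarith
  have h3 : 0 ≤ (1 - c) / 2 := by linarith
  exact (convexOn_rpow hq).2 (norm_nonneg (x + y)) (norm_nonneg (x - y)) h2 h3 (by ring)

theorem sum_cube_update_le {q : ℝ} (hq : 1 ≤ q) (a : ℕ → ℝ) (v : ℕ → X) {i : ℕ}
    (hi : i < N) (ha : |a i| ≤ 1) :
    ∑ s : Fin N → Bool, ‖∑ l ∈ Finset.range N, cubeSign N l s • a l • v l‖ ^ q
      ≤ ∑ s : Fin N → Bool,
        ‖∑ l ∈ Finset.range N, cubeSign N l s • Function.update a i 1 l • v l‖ ^ q := by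
  set U : (Fin N → Bool) → X := fun s =>
    ∑ l ∈ (Finset.range N).erase i, cubeSign N l s • a l • v l with hU
  set V : (Fin N → Bool) → X := fun s => cubeSign N i s • v i with hV
  have hmem : i ∈ Finset.range N := Finset.mem_range.2 hi
  have e1 : ∀ s, ∑ l ∈ Finset.range N, cubeSign N l s • a l • v l = U s + a i • V s := by
    intro s
    rw [← Finset.add_sum_erase _ _ hmem, add_comm, smul_comm]
  have e2 : ∀ s, ∑ l ∈ Finset.range N, cubeSign N l s • Function.update a i 1 l • v l
      = U s + V s := by
    intro s
    rw [← Finset.add_sum_erase _ _ hmem, add_comm]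
    congr 1
    · refine Finset.sum_congr rfl fun l hl => ?_
      rw [Function.update_of_ne (Finset.ne_of_mem_erase hl)]
    · simp [hV]
  -- flipping the `i`-th sign exchanges `U + V` and `U - V`
  have e3 : ∑ s, ‖U s - V s‖ ^ q = ∑ s, ‖U s + V s‖ ^ q := by
    rw [← Equiv.sum_comp (cubeFlip ⟨i, hi⟩)]
    refine Finset.sum_congr rfl fun s _ => ?_
    have h1 : U (cubeFlip ⟨i, hi⟩ s) = U s := by
      refine Finset.sum_congr rfl fun l hl => ?_
      rw [cubeSign_flip_of_ne _ _ (Finset.ne_of_mem_erase hl)]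
    have h2 : V (cubeFlip ⟨i, hi⟩ s) = -V s := by
      have := cubeSign_flip_self ⟨i, hi⟩ s
      simp only [hV] at this ⊢
      rw [this, neg_smul]
    rw [h1, h2, sub_neg_eq_add]
  simp_rw [e1, e2]
  calc ∑ s, ‖U s + a i • V s‖ ^ q
      ≤ ∑ s, ((1 + a i) / 2 * ‖U s + V s‖ ^ q + (1 - a i) / 2 * ‖U s - V s‖ ^ q) :=
        Finset.sum_le_sum fun s _ => norm_add_smul_rpow_le hq _ _ ha
    _ = ∑ s, ‖U s + V s‖ ^ q := by
        rw [Finset.sum_add_distrib, ← Finset.mul_sum, ← Finset.mul_sum, e3]; ring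

/-- Kahane's contraction principle on the discrete cube, for the `q`-th moment. -/
theorem sum_cube_contraction {q : ℝ} (hq : 1 ≤ q) (a : ℕ → ℝ) (v : ℕ → X)
    (ha : ∀ i, |a i| ≤ 1) :
    ∑ s : Fin N → Bool, ‖∑ l ∈ Finset.range N, cubeSign N l s • a l • v l‖ ^ q
      ≤ ∑ s : Fin N → Bool, ‖∑ l ∈ Finset.range N, cubeSign N l s • v l‖ ^ q := by
  have key : ∀ T : Finset ℕ, T ⊆ Finset.range N →
      ∑ s : Fin N → Bool, ‖∑ l ∈ Finset.range N, cubeSign N l s • a l • v l‖ ^ q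
      ≤ ∑ s : Fin N → Bool, ‖∑ l ∈ Finset.range N,
          cubeSign N l s • (if l ∈ T then 1 else a l) • v l‖ ^ q := by
    intro T
    induction T using Finset.induction_on with
    | empty => intro _; simp
    | insert i T hi ih =>
      intro hT
      refine (ih fun l hl => hT (Finset.mem_insert_of_mem hl)).trans ?_
      have := sum_cube_update_le (N := N) hq (fun l => if l ∈ T then 1 else a l) v
        (Finset.mem_range.1 (hT (Finset.mem_insert_self i T))) (by simpa [hi] using ha i)
      refine this.trans (le_of_eq ?_)
      refine Finset.sum_congr rfl fun s _ => ?_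
      congr 2
      refine Finset.sum_congr rfl fun l _ => ?_
      by_cases h : l = i
      · subst h; simp
      · simp [h]
  refine (key _ subset_rfl).trans (le_of_eq ?_)
  refine Finset.sum_congr rfl fun s _ => ?_
  congr 2
  refine Finset.sum_congr rfl fun l hl => ?_
  simp [Finset.mem_range.1 hl]

theorem aestronglyMeasurable_cubeSum {g : ℕ → S → X} (hg : ∀ l, AEStronglyMeasurable (g l) μ)
    [SFinite μ] :
    AEStronglyMeasurable
      (fun z : (Fin N → Bool) × S => ∑ l ∈ Finset.range N, cubeSign N l z.1 • g l z.2)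
      (Measure.count.prod μ) := by
  refine Finset.aestronglyMeasurable_fun_sum _ fun l _ => ?_
  refine AEStronglyMeasurable.smul ?_ ((hg l).comp_snd)
  exact ((measurable_of_finite (cubeSign N l)).comp measurable_fst).aestronglyMeasurable

theorem radNorm_rpow [SFinite μ] {g : ℕ → S → X} (hg : ∀ l, AEStronglyMeasurable (g l) μ)
    (hp : p ≠ 0) (hp' : p ≠ ⊤) :
    radNorm N p μ g ^ p.toReal = ∫⁻ x, ∑ s : Fin N → Bool,
      ‖∑ l ∈ Finset.range N, cubeSign N l s • g l x‖ₑ ^ p.toReal ∂μ := by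
  have hpos := ENNReal.toReal_pos hp hp'
  rw [radNorm, eLpNorm_eq_lintegral_rpow_enorm_toReal hp hp', ← ENNReal.rpow_mul,
    one_div_mul_cancel hpos.ne', ENNReal.rpow_one,
    lintegral_prod_symm _ ((aestronglyMeasurable_cubeSum hg).enorm.pow_const _)]
  refine lintegral_congr fun x => ?_
  rw [lintegral_count, tsum_fintype]

/-- Kahane's contraction principle, with coefficients depending on the point. -/
theorem radNorm_smul_le [SFinite μ] {g : ℕ → S → X} (hg : ∀ l, AEStronglyMeasurable (g l) μ)
    {a : ℕ → S → ℝ} (hma : ∀ l, AEStronglyMeasurable (a l) μ) (ha : ∀ l x, |a l x| ≤ 1)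
    (hp : 1 ≤ p) (hp' : p ≠ ⊤) :
    radNorm N p μ (fun l x => a l x • g l x) ≤ radNorm N p μ g := by
  have hp0 : p ≠ 0 := (zero_lt_one.trans_le hp).ne'
  have hpos := ENNReal.toReal_pos hp0 hp'
  have hq : 1 ≤ p.toReal := by
    simpa using ENNReal.toReal_mono hp' hp
  rw [← ENNReal.rpow_le_rpow_iff hpos, radNorm_rpow hg hp0 hp',
    radNorm_rpow (g := fun l x => a l x • g l x) (fun l => (hma l).smul (hg l)) hp0 hp']
  refine lintegral_mono fun x => ?_
  have := sum_cube_contraction (N := N) hq (fun l => a l x) (fun l => g l x) fun l => ha l x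
  have h2 := ENNReal.ofReal_le_ofReal this
  rw [ENNReal.ofReal_sum_of_nonneg (fun _ _ => by positivity),
    ENNReal.ofReal_sum_of_nonneg (fun _ _ => by positivity)] at h2
  simpa only [← ofReal_norm, ENNReal.ofReal_rpow_of_nonneg (norm_nonneg _) hpos.le] using h2

theorem radNorm_const_smul_le (c : ℝ) (g : ℕ → S → X) :
    radNorm N p μ (fun l x => c • g l x) ≤ ENNReal.ofReal |c| * radNorm N p μ g := by
  unfold radNorm
  have : (fun z : (Fin N → Bool) × S => ∑ l ∈ Finset.range N, cubeSign N l z.1 • c • g l z.2)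
      = c • (fun z : (Fin N → Bool) × S => ∑ l ∈ Finset.range N, cubeSign N l z.1 • g l z.2) := by
    ext z
    simp only [Pi.smul_apply, Finset.smul_sum]
    exact Finset.sum_congr rfl fun l _ => smul_comm _ _ _
  rw [this]
  refine (eLpNorm_const_smul_le).trans (le_of_eq ?_)
  rw [← Real.enorm_eq_ofReal_abs]

theorem radNorm_sum_le [SFinite μ] {κ : Type*} (T : Finset κ) {g : κ → ℕ → S → X}
    (hg : ∀ k l, AEStronglyMeasurable (g k l) μ) (hp : 1 ≤ p) :
    radNorm N p μ (fun l x => ∑ k ∈ T, g k l x) ≤ ∑ k ∈ T, radNorm N p μ (g k) := by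
  unfold radNorm
  have : (fun z : (Fin N → Bool) × S =>
      ∑ l ∈ Finset.range N, cubeSign N l z.1 • ∑ k ∈ T, g k l z.2)
      = ∑ k ∈ T, fun z : (Fin N → Bool) × S =>
        ∑ l ∈ Finset.range N, cubeSign N l z.1 • g k l z.2 := by
    ext z
    simp only [Finset.sum_apply, Finset.smul_sum]
    exact Finset.sum_comm
  rw [this]
  exact eLpNorm_sum_le (fun k _ => aestronglyMeasurable_cubeSum (hg k)) hp

theorem memLp_cubeSign_smul [SFinite μ] (l : ℕ) {h : S → X} (hh : MemLp h p μ) :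
    MemLp (fun z : (Fin N → Bool) × S => cubeSign N l z.1 • h z.2) p (Measure.count.prod μ) := by
  have h1 : MemLp (fun z : (Fin N → Bool) × S => h z.2) p (Measure.count.prod μ) := hh.comp_snd _
  refine h1.of_le (AEStronglyMeasurable.smul ?_ h1.1) (Eventually.of_forall fun z => ?_)
  · exact ((measurable_of_finite (cubeSign N l)).comp measurable_fst).aestronglyMeasurable
  · rw [norm_smul]
    refine mul_le_of_le_one_left (norm_nonneg _) ?_
    unfold cubeSign
    split_ifs <;> simp

theorem memLp_cubeSum [SFinite μ] {g : ℕ → S → X} (hg : ∀ l, MemLp (g l) p μ) :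
    MemLp (fun z : (Fin N → Bool) × S => ∑ l ∈ Finset.range N, cubeSign N l z.1 • g l z.2) p
      (Measure.count.prod μ) :=
  memLp_finsetSum _ fun l _ => memLp_cubeSign_smul l (hg l)

theorem radNorm_lt_top [SFinite μ] {g : ℕ → S → X} (hg : ∀ l, MemLp (g l) p μ) :
    radNorm N p μ g < ⊤ :=
  (memLp_cubeSum hg).2

/-- The joint law of independent random signs is the normalized counting measure on the cube. -/
theorem map_rademacher_eq {Ω : Type*} [MeasurableSpace Ω] {P : Measure Ω} [IsProbabilityMeasure P]
    {r : ℤ → Ω → ℝ} (hr : IsRademacher P r) {e : ℕ → ℤ} (he : Function.Injective e) (N : ℕ) :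
    P.map (fun ω (l : Fin N) => decide (r (e l) ω = 1))
      = ((2 : ℝ≥0∞)⁻¹ ^ N) • (Measure.count : Measure (Fin N → Bool)) := by
  have hmeas1 : ∀ l : Fin N, Measurable fun ω => decide (r (e l) ω = 1) := by
    intro l
    refine measurable_to_bool ?_
    have : (fun ω => decide (r (e l) ω = 1)) ⁻¹' {true} = r (e l) ⁻¹' {1} := by
      ext ω; simp
    rw [this]
    exact hr.measurable _ (measurableSet_singleton _)
  refine Measure.ext_of_singleton fun s => ?_
  rw [Measure.map_apply (measurable_pi_lambda _ hmeas1) (measurableSet_singleton _)]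
  have hset : (fun ω (l : Fin N) => decide (r (e l) ω = 1)) ⁻¹' {s}
      = ⋂ l ∈ (Finset.univ : Finset (Fin N)),
        r (e l) ⁻¹' (if s l then {1} else {1}ᶜ) := by
    ext ω
    simp only [Set.mem_preimage, Set.mem_singleton_iff, Set.mem_iInter, Finset.mem_univ,
      forall_const, funext_iff]
    refine forall_congr' fun l => ?_
    cases h : s l <;> simp
  have hind : iIndepFun (fun l : Fin N => r (e l)) P :=
    hr.indep.precomp (g := fun l : Fin N => e l) (fun a b h => Fin.ext (he h))
  rw [hset, hind.measure_inter_preimage_eq_mul Finset.univ]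
  · have : ∀ l : Fin N, P (r (e l) ⁻¹' (if s l then {1} else {1}ᶜ)) = 2⁻¹ := by
      intro l
      have h1 : P (r (e l) ⁻¹' {1}) = 2⁻¹ := by
        have := hr.prob_one (e l)
        rwa [one_div] at this
      split_ifs
      · exact h1
      · rw [Set.preimage_compl, prob_compl_eq_one_sub
          (hr.measurable _ (measurableSet_singleton _)), h1]
        exact ENNReal.one_sub_inv_two
    simp [this]
  · intro l _
    split_ifs
    · exact measurableSet_singleton _
    · exact (measurableSet_singleton _).compl

theorem IsRademacher.ae_eq {Ω : Type*} [MeasurableSpace Ω] {P : Measure Ω} [IsProbabilityMeasure P]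
    {r : ℤ → Ω → ℝ} (hr : IsRademacher P r) (j : ℤ) : ∀ᵐ ω ∂P, r j ω = 1 ∨ r j ω = -1 := by
  have h1 : MeasurableSet {ω | r j ω = 1} := hr.measurable j (measurableSet_singleton 1)
  have h2 : MeasurableSet {ω | r j ω = -1} := hr.measurable j (measurableSet_singleton (-1))
  have hd : Disjoint {ω | r j ω = 1} {ω | r j ω = -1} := by
    rw [Set.disjoint_left]
    intro ω h h'
    simp only [Set.mem_ofPred_eq] at h h'
    linarith
  have := measure_union hd h2 (μ := P)
  rw [hr.prob_one, hr.prob_neg_one, ENNReal.add_halves] at this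
  have h3 := (prob_compl_eq_zero_iff (h1.union h2)).2 this
  rw [ae_iff]
  exact h3

/-- Random sums over an arbitrary probability space are random sums over the discrete cube. -/
theorem eLpNorm_rademacher_sum {Ω : Type*} [MeasurableSpace Ω] {P : Measure Ω}
    [IsProbabilityMeasure P] {r : ℤ → Ω → ℝ} (hr : IsRademacher P r) {e : ℕ → ℤ}
    (he : Function.Injective e) (N : ℕ) [SFinite μ] {g : ℕ → S → X}
    (hg : ∀ l, AEStronglyMeasurable (g l) μ) (hp' : p ≠ ⊤) :
    eLpNorm (fun z : Ω × S => ∑ l ∈ Finset.range N, r (e l) z.1 • g l z.2) p (P.prod μ)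
      = ((2 : ℝ≥0∞)⁻¹ ^ N) ^ (1 / p).toReal * radNorm N p μ g := by
  have hb : Measurable (fun ω (l : Fin N) => decide (r (e l) ω = 1)) := by
    refine measurable_pi_lambda _ fun l => measurable_to_bool ?_
    have : (fun ω => decide (r (e l) ω = 1)) ⁻¹' {true} = r (e l) ⁻¹' {1} := by
      ext ω; simp
    rw [this]
    exact hr.measurable _ (measurableSet_singleton _)
  set b : Ω → (Fin N → Bool) := fun ω (l : Fin N) => decide (r (e l) ω = 1) with hbdef
  have hmap : (P.prod μ).map (Prod.map b id)
      = ((2 : ℝ≥0∞)⁻¹ ^ N) • ((Measure.count : Measure (Fin N → Bool)).prod μ) := by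
    rw [← Measure.map_prod_map P μ hb measurable_id, Measure.map_id, map_rademacher_eq hr he N,
      Measure.prod_smul_left]
  have hae : ∀ᵐ z ∂(P.prod μ), ∀ l : ℕ, r (e l) z.1 = 1 ∨ r (e l) z.1 = -1 := by
    rw [ae_all_iff]
    intro l
    exact Measure.quasiMeasurePreserving_fst.ae (hr.ae_eq (e l))
  have h1 : (fun z : Ω × S => ∑ l ∈ Finset.range N, r (e l) z.1 • g l z.2) =ᵐ[P.prod μ]
      (fun z : (Fin N → Bool) × S => ∑ l ∈ Finset.range N, cubeSign N l z.1 • g l z.2)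
        ∘ Prod.map b id := by
    filter_upwards [hae] with z hz
    refine Finset.sum_congr rfl fun l hl => ?_
    have hl' := Finset.mem_range.1 hl
    simp only [cubeSign, hbdef, Prod.map_fst, Prod.map_snd, hl', dite_true, id]
    rcases hz l with h | h
    · simp [h]
    · have : (-1 : ℝ) ≠ 1 := by norm_num
      simp [h, this]
  rw [eLpNorm_congr_ae h1, ← eLpNorm_map_measure _ (hb.prodMap measurable_id).aemeasurable, hmap,
    eLpNorm_smul_measure_of_ne_top hp', smul_eq_mul]
  · rfl
  · rw [hmap]
    exact (aestronglyMeasurable_cubeSum hg).smul_measure _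

end RandomSums

/-! ### Averages over the fibres of a countable labelling -/

section FiberAverage

variable {X : Type*} [NormedAddCommGroup X] [NormedSpace ℝ X]
  {S : Type*} [MeasurableSpace S] {p : ℝ≥0∞} {μ : Measure S} {ι : Type*}

/-- The conditional expectation of `g` given the label `c`: the average of `g` over the fibre of `c`
through the given point. Unlike `condExp`, it makes sense for all locally integrable `g`. -/
noncomputable def fiberAvg (c : S → ι) (μ : Measure S) (g : S → X) (x : S) : X :=
  ⨍ y in c ⁻¹' {c x}, g y ∂μ

/-- A labelling with measurable fibres of finite measure. -/
structure IsFiniteLabelling (c : S → ι) (μ : Measure S) : Prop where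
  measurableSet : ∀ a, MeasurableSet (c ⁻¹' {a})
  measure_ne_top : ∀ a, μ (c ⁻¹' {a}) ≠ ⊤

variable {c : S → ι}

theorem preimage_eq_biUnion (c : S → ι) (T : Set ι) : c ⁻¹' T = ⋃ a ∈ T, c ⁻¹' {a} := by
  ext x; simp

theorem IsFiniteLabelling.measurableSet_preimage [Countable ι] (hc : IsFiniteLabelling c μ)
    (T : Set ι) : MeasurableSet (c ⁻¹' T) := by
  rw [preimage_eq_biUnion]
  exact MeasurableSet.biUnion T.to_countable fun a _ => hc.measurableSet a

theorem IsFiniteLabelling.comap_le [Countable ι] (hc : IsFiniteLabelling c μ) :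
    MeasurableSpace.comap c ⊤ ≤ ‹MeasurableSpace S› := by
  rintro _ ⟨T, -, rfl⟩
  exact hc.measurableSet_preimage T

theorem stronglyMeasurable_comap_label {Y : Type*} [TopologicalSpace Y] [Countable ι] (h : ι → Y) :
    StronglyMeasurable[MeasurableSpace.comap c ⊤] fun x => h (c x) := by
  let _ : MeasurableSpace ι := ⊤
  have h1 : StronglyMeasurable h := .of_discrete
  let _ : MeasurableSpace S := MeasurableSpace.comap c ⊤
  exact h1.comp_measurable (comap_measurable c)

theorem stronglyMeasurable_comap_fiberAvg [Countable ι] (g : S → X) :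
    StronglyMeasurable[MeasurableSpace.comap c ⊤] (fiberAvg c μ g) :=
  stronglyMeasurable_comap_label fun a => ⨍ y in c ⁻¹' {a}, g y ∂μ

theorem stronglyMeasurable_fiberAvg [Countable ι] (hc : IsFiniteLabelling c μ) (g : S → X) :
    StronglyMeasurable (fiberAvg c μ g) :=
  (stronglyMeasurable_comap_fiberAvg g).mono hc.comap_le

theorem enorm_average_rpow_le (hp : 1 ≤ p) (hp' : p ≠ ⊤) {F : Set S} (hF : μ F ≠ ⊤) {g : S → X}
    (hg : AEStronglyMeasurable g μ) :
    ‖⨍ y in F, g y ∂μ‖ₑ ^ p.toReal * μ F ≤ ∫⁻ y in F, ‖g y‖ₑ ^ p.toReal ∂μ := by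
  rcases eq_or_ne (μ F) 0 with h0 | h0
  · simp [h0]
  have hp0 : p ≠ 0 := (zero_lt_one.trans_le hp).ne'
  have hpos := ENNReal.toReal_pos hp0 hp'
  set ν : Measure S := (μ F)⁻¹ • μ.restrict F with hν
  have hprob : IsProbabilityMeasure ν := ⟨by
    simp [hν, ENNReal.inv_mul_cancel h0 hF]⟩
  have hgν : AEStronglyMeasurable g ν := hg.restrict.smul_measure _
  have h1 : ‖⨍ y in F, g y ∂μ‖ₑ ≤ eLpNorm g p ν := by
    have : ⨍ y in F, g y ∂μ = ∫ y, g y ∂ν := by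
      rw [average, hν, Measure.restrict_apply_univ]
    rw [this]
    refine (enorm_integral_le_lintegral_enorm _).trans ?_
    rw [← eLpNorm_one_eq_lintegral_enorm]
    exact eLpNorm_le_eLpNorm_of_exponent_le hp hgν
  calc ‖⨍ y in F, g y ∂μ‖ₑ ^ p.toReal * μ F ≤ eLpNorm g p ν ^ p.toReal * μ F := by gcongr
    _ = ∫⁻ y in F, ‖g y‖ₑ ^ p.toReal ∂μ := by
      rw [eLpNorm_eq_lintegral_rpow_enorm_toReal hp0 hp', ← ENNReal.rpow_mul,
        one_div_mul_cancel hpos.ne', ENNReal.rpow_one, hν, lintegral_smul_measure, smul_eq_mul,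
        mul_comm, ← mul_assoc, ENNReal.mul_inv_cancel h0 hF, one_mul]

theorem lintegral_eq_tsum_fiber [Countable ι] (hc : IsFiniteLabelling c μ) (f : S → ℝ≥0∞) :
    ∫⁻ x, f x ∂μ = ∑' a, ∫⁻ x in c ⁻¹' {a}, f x ∂μ := by
  have hd : Pairwise (Function.onFun Disjoint fun a => c ⁻¹' {a}) := fun a b hab =>
    Disjoint.preimage _ (Set.disjoint_singleton.2 hab)
  have hU : ⋃ a, c ⁻¹' {a} = Set.univ := by ext x; simp
  rw [← lintegral_iUnion hc.measurableSet hd, hU, setLIntegral_univ]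

theorem eLpNorm_fiberAvg_le [Countable ι] (hc : IsFiniteLabelling c μ) (hp : 1 ≤ p) (hp' : p ≠ ⊤)
    {g : S → X} (hg : AEStronglyMeasurable g μ) :
    eLpNorm (fiberAvg c μ g) p μ ≤ eLpNorm g p μ := by
  have hp0 : p ≠ 0 := (zero_lt_one.trans_le hp).ne'
  have hpos := ENNReal.toReal_pos hp0 hp'
  rw [eLpNorm_eq_lintegral_rpow_enorm_toReal hp0 hp', eLpNorm_eq_lintegral_rpow_enorm_toReal hp0 hp',
    lintegral_eq_tsum_fiber hc, lintegral_eq_tsum_fiber hc fun x => ‖g x‖ₑ ^ p.toReal]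
  refine ENNReal.rpow_le_rpow (ENNReal.tsum_le_tsum fun a => ?_) (by positivity)
  refine le_trans (le_of_eq ?_) (enorm_average_rpow_le hp hp' (hc.measure_ne_top a) hg)
  rw [← setLIntegral_const]
  refine setLIntegral_congr_fun (hc.measurableSet a) fun x hx => ?_
  have : c x = a := hx
  simp only [fiberAvg, this]

theorem MemLp.fiberAvg [Countable ι] (hc : IsFiniteLabelling c μ) (hp : 1 ≤ p) (hp' : p ≠ ⊤)
    {g : S → X} (hg : MemLp g p μ) : MemLp (fiberAvg c μ g) p μ :=
  ⟨(stronglyMeasurable_fiberAvg hc g).aestronglyMeasurable,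
    (eLpNorm_fiberAvg_le hc hp hp' hg.1).trans_lt hg.2⟩

theorem MemLp.integrableOn_of_measure_ne_top (hp : 1 ≤ p) {g : S → X} (hg : MemLp g p μ)
    {A : Set S} (hA : μ A ≠ ⊤) : IntegrableOn g A μ := by
  have : Fact (μ A < ⊤) := ⟨hA.lt_top⟩
  exact (hg.restrict A).integrable hp

theorem setIntegral_fiberAvg [Countable ι] [CompleteSpace X] (hc : IsFiniteLabelling c μ)
    (hp : 1 ≤ p) (hp' : p ≠ ⊤) {g : S → X} (hg : MemLp g p μ) {T : Set ι} (hT : μ (c ⁻¹' T) ≠ ⊤) :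
    ∫ x in c ⁻¹' T, fiberAvg c μ g x ∂μ = ∫ x in c ⁻¹' T, g x ∂μ := by
  have hU : c ⁻¹' T = ⋃ a : T, c ⁻¹' {a.1} := by ext x; simp
  have hd : Pairwise (Function.onFun Disjoint fun a : T => c ⁻¹' {a.1}) := fun a b hab =>
    Disjoint.preimage _ (Set.disjoint_singleton.2 fun h => hab (Subtype.ext h))
  have h1 := MemLp.integrableOn_of_measure_ne_top hp (MemLp.fiberAvg hc hp hp' hg) hT
  have h2 := MemLp.integrableOn_of_measure_ne_top hp hg hT
  rw [hU] at h1 h2 ⊢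
  rw [integral_iUnion (fun a : T => hc.measurableSet a.1) hd h1,
    integral_iUnion (fun a : T => hc.measurableSet a.1) hd h2]
  congr 1
  ext a
  have : ∫ x in c ⁻¹' {a.1}, fiberAvg c μ g x ∂μ
      = ∫ _ in c ⁻¹' {a.1}, (⨍ y in c ⁻¹' {a.1}, g y ∂μ) ∂μ := by
    refine setIntegral_congr_fun (hc.measurableSet a.1) fun x hx => ?_
    have : c x = a.1 := hx
    simp only [fiberAvg, this]
  rw [this, setIntegral_const, measure_smul_setAverage _ (hc.measure_ne_top a.1)]

theorem fiberAvg_sum_smul (hc : IsFiniteLabelling c μ) (hp : 1 ≤ p) {κ : Type*} (T : Finset κ)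
    (a : κ → ℝ) {g : κ → S → X} (hg : ∀ k, MemLp (g k) p μ) (x : S) :
    fiberAvg c μ (fun y => ∑ k ∈ T, a k • g k y) x = ∑ k ∈ T, a k • fiberAvg c μ (g k) x := by
  simp only [fiberAvg, setAverage_eq]
  rw [integral_finsetSum]
  · rw [Finset.smul_sum]
    refine Finset.sum_congr rfl fun k _ => ?_
    rw [integral_smul, smul_comm]
  · intro k _
    exact (MemLp.integrableOn_of_measure_ne_top hp (hg k) (hc.measure_ne_top _)).smul (a k)

theorem comap_label_mono {κ : Type*} {c' : S → κ} (h : ∀ x y, c' x = c' y → c x = c y) :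
    MeasurableSpace.comap c ⊤ ≤ MeasurableSpace.comap c' ⊤ := by
  rintro _ ⟨T, -, rfl⟩
  refine ⟨c' '' (c ⁻¹' T), trivial, ?_⟩
  ext x
  constructor
  · rintro ⟨y, hy, hxy⟩
    rw [Set.mem_preimage, ← h _ _ hxy]
    exact hy
  · exact fun hx => ⟨x, hx, rfl⟩

end FiberAverage

/-! ### Stein's inequality -/

section Stein

/-- The sign sequence `s`, cut off after its first `n` entries. -/
def truncSigns {N : ℕ} (n : ℕ) (s : Fin N → Bool) : Fin N → Bool :=
  fun j => if (j : ℕ) < n then s j else false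

theorem truncSigns_eq_of_le {N n n' : ℕ} (h : n ≤ n') {s s' : Fin N → Bool}
    (hs : truncSigns n' s = truncSigns n' s') : truncSigns n s = truncSigns n s' := by
  ext j
  have := congrFun hs j
  simp only [truncSigns] at this ⊢
  split_ifs with h1
  · simpa [h1.trans_le h] using this
  · rfl

theorem cubeSign_truncSigns {N n l : ℕ} (h : l < n) (s : Fin N → Bool) :
    cubeSign N l (truncSigns n s) = cubeSign N l s := by
  simp [cubeSign, truncSigns, h]

theorem truncSigns_cubeFlip {N : ℕ} (i : Fin N) (s : Fin N → Bool) :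
    truncSigns i (cubeFlip i s) = truncSigns i s := by
  ext j
  simp only [truncSigns, cubeFlip_apply]
  split_ifs with h
  · rw [Function.update_of_ne (Fin.ne_of_lt h)]
  · rfl

variable {X : Type u} [NormedAddCommGroup X] [NormedSpace ℂ X] {S : Type}
  [MeasurableSpace S] {p : ℝ≥0∞} {μ : Measure S} {ι : Type} {N : ℕ}

/-- The labels that generate the filtration in the proof of Stein's inequality: at time `2i` the
first `i` signs and the label `c i` are known, at time `2i+1` also the sign with index `i`. -/
def steinLabel (N : ℕ) (c : ℕ → S → ι) (k : ℕ) (z : (Fin N → Bool) × S) : (Fin N → Bool) × ι :=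
  (truncSigns ((k + 1) / 2) z.1, c (k / 2) z.2)

/-- The martingale differences in the proof of Stein's inequality. The differences with odd index
are the terms `ε_i E_i g_i` of the sum to be estimated. -/
noncomputable def steinDiff (N : ℕ) (c : ℕ → S → ι) (μ : Measure S) (g : ℕ → S → X) (k : ℕ)
    (z : (Fin N → Bool) × S) : X :=
  if k % 2 = 1 then cubeSign N (k / 2) z.1 • fiberAvg (c (k / 2)) μ (g (k / 2)) z.2
  else ∑ l ∈ Finset.range (k / 2), cubeSign N l z.1 •
    (fiberAvg (c (k / 2)) μ (g l) z.2 - fiberAvg (c (k / 2 - 1)) μ (g l) z.2)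

theorem steinDiff_even (c : ℕ → S → ι) (g : ℕ → S → X) (i : ℕ) (z : (Fin N → Bool) × S) :
    steinDiff N c μ g (2 * i) z = ∑ l ∈ Finset.range i, cubeSign N l z.1 •
      (fiberAvg (c i) μ (g l) z.2 - fiberAvg (c (i - 1)) μ (g l) z.2) := by
  have h1 : 2 * i % 2 = 0 := by omega
  have h2 : 2 * i / 2 = i := by omega
  simp [steinDiff, h1, h2]

theorem steinDiff_odd (c : ℕ → S → ι) (g : ℕ → S → X) (i : ℕ) (z : (Fin N → Bool) × S) :
    steinDiff N c μ g (2 * i + 1) z = cubeSign N i z.1 • fiberAvg (c i) μ (g i) z.2 := by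
  have h1 : (2 * i + 1) % 2 = 1 := by omega
  have h2 : (2 * i + 1) / 2 = i := by omega
  simp [steinDiff, h1, h2]

theorem sum_steinDiff (c : ℕ → S → ι) (g : ℕ → S → X) (n : ℕ) (z : (Fin N → Bool) × S) :
    ∑ k ∈ Finset.range (2 * n), steinDiff N c μ g k z
      = ∑ l ∈ Finset.range n, cubeSign N l z.1 • fiberAvg (c (n - 1)) μ (g l) z.2 := by
  induction n with
  | zero => simp
  | succ n ih =>
    rw [show 2 * (n + 1) = 2 * n + 1 + 1 by ring, Finset.sum_range_succ, Finset.sum_range_succ, ih,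
      steinDiff_even, steinDiff_odd, Finset.sum_range_succ, add_tsub_cancel_right,
      ← Finset.sum_add_distrib]
    congr 1
    refine Finset.sum_congr rfl fun l _ => ?_
    module

theorem two_smul_sum_odd_steinDiff (c : ℕ → S → ι) (g : ℕ → S → X) (n : ℕ)
    (z : (Fin N → Bool) × S) :
    (2 : ℝ) • ∑ l ∈ Finset.range n, cubeSign N l z.1 • fiberAvg (c l) μ (g l) z.2
      = ∑ k ∈ Finset.range (2 * n), steinDiff N c μ g k z
        + ∑ k ∈ Finset.range (2 * n), (if k % 2 = 1 then (1 : ℝ) else -1) •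
          steinDiff N c μ g k z := by
  induction n with
  | zero => simp
  | succ n ih =>
    have h1 : 2 * n % 2 = 0 := by omega
    have h2 : (2 * n + 1) % 2 = 1 := by omega
    rw [show 2 * (n + 1) = 2 * n + 1 + 1 by ring, Finset.sum_range_succ, smul_add, ih,
      Finset.sum_range_succ _ (2 * n + 1), Finset.sum_range_succ _ (2 * n),
      Finset.sum_range_succ _ (2 * n + 1), Finset.sum_range_succ _ (2 * n), steinDiff_odd]
    simp only [h1, h2]
    simp only [zero_ne_one, if_false, if_true]
    module

theorem steinLabel_isFiniteLabelling [SFinite μ] {c : ℕ → S → ι}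
    (hc : ∀ i, IsFiniteLabelling (c i) μ) (k : ℕ) :
    IsFiniteLabelling (steinLabel N c k) (Measure.count.prod μ) := by
  have hsub : ∀ a : (Fin N → Bool) × ι, steinLabel N c k ⁻¹' {a}
      = (truncSigns ((k + 1) / 2) ⁻¹' {a.1}) ×ˢ (c (k / 2) ⁻¹' {a.2}) := by
    intro a
    ext z
    simp [steinLabel, Prod.ext_iff]
  refine ⟨fun a => ?_, fun a => ?_⟩
  · rw [hsub]
    exact (Set.toFinite _).measurableSet.prod ((hc _).measurableSet _)
  · rw [hsub, Measure.prod_prod]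
    refine ENNReal.mul_ne_top ?_ ((hc _).measure_ne_top _)
    rw [Measure.count_apply_finite _ (Set.toFinite _)]
    exact ENNReal.natCast_ne_top _

theorem nested_label_of_le {T : Type*} {c : ℕ → T → ι}
    (hnest : ∀ i x y, c (i + 1) x = c (i + 1) y → c i x = c i y) {i j : ℕ} (hij : i ≤ j) :
    ∀ x y, c j x = c j y → c i x = c i y := by
  induction j, hij using Nat.le_induction with
  | base => exact fun x y h => h
  | succ j _ ih => exact fun x y h => ih x y (hnest j x y h)

theorem steinLabel_nested {T : Type} {c : ℕ → T → ι}
    (hnest : ∀ i x y, c (i + 1) x = c (i + 1) y → c i x = c i y) {k k' : ℕ} (h : k ≤ k')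
    (z z' : (Fin N → Bool) × T)
    (hz : steinLabel N c k' z = steinLabel N c k' z') :
    steinLabel N c k z = steinLabel N c k z' :=
  Prod.ext (truncSigns_eq_of_le (by omega) (Prod.ext_iff.1 hz).1)
    (nested_label_of_le hnest (by omega) _ _ (Prod.ext_iff.1 hz).2)

/-- The filtration in the proof of Stein's inequality. -/
def steinFiltration [SFinite μ] [Countable ι] (N : ℕ) {c : ℕ → S → ι}
    (hc : ∀ i, IsFiniteLabelling (c i) μ)
    (hnest : ∀ i x y, c (i + 1) x = c (i + 1) y → c i x = c i y) :
    Filtration ℕ (inferInstance : MeasurableSpace ((Fin N → Bool) × S)) where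
  seq k := MeasurableSpace.comap (steinLabel N c k) ⊤
  mono' _ _ h := comap_label_mono fun z z' hz => steinLabel_nested hnest h z z' hz
  le' k := (steinLabel_isFiniteLabelling hc k).comap_le

theorem IsFiniteLabelling.sigmaFinite_trim {T : Type*} [MeasurableSpace T] {ν : Measure T}
    {κ : Type*} [Countable κ] {b : T → κ} (hb : IsFiniteLabelling b ν) :
    SigmaFinite (ν.trim hb.comap_le) := by
  refine Measure.sigmaFinite_of_countable (S := Set.range fun a => b ⁻¹' {a})
    (Set.countable_range _) ?_ ?_
  · rintro _ ⟨a, rfl⟩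
    rw [trim_measurableSet_eq hb.comap_le ⟨{a}, trivial, rfl⟩]
    exact (hb.measure_ne_top a).lt_top
  · ext x
    simp

theorem setIntegral_cube_prod [CompleteSpace X] [SFinite μ] {A : Set ((Fin N → Bool) × S)} (hA : MeasurableSet A)
    {F : (Fin N → Bool) × S → X} (hF : IntegrableOn F A (Measure.count.prod μ)) :
    ∫ z in A, F z ∂(Measure.count.prod μ) = ∑ s, ∫ x in Prod.mk s ⁻¹' A, F (s, x) ∂μ := by
  rw [← integral_indicator hA, integral_prod _ ((integrable_indicator_iff hA).2 hF),
    integral_fintype Integrable.of_finite]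
  refine Finset.sum_congr rfl fun s _ => ?_
  rw [Measure.real, Measure.count_singleton, ENNReal.toReal_one, one_smul,
    ← integral_indicator (measurable_prodMk_left hA)]
  rfl

theorem measure_section_ne_top [SFinite μ] {A : Set ((Fin N → Bool) × S)}
    (hA' : (Measure.count.prod μ) A ≠ ⊤) (s : Fin N → Bool) :
    μ (Prod.mk s ⁻¹' A) ≠ ⊤ := by
  refine ne_top_of_le_ne_top hA' ?_
  calc μ (Prod.mk s ⁻¹' A) = (Measure.count.prod μ) ({s} ×ˢ (Prod.mk s ⁻¹' A)) := by
        rw [Measure.prod_prod, Measure.count_singleton, one_mul]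
    _ ≤ _ := by
        refine measure_mono ?_
        rintro ⟨s', x⟩ ⟨h1, h2⟩
        obtain rfl : s' = s := h1
        exact h2

theorem memLp_steinDiff [SFinite μ] [Countable ι] {c : ℕ → S → ι}
    (hc : ∀ i, IsFiniteLabelling (c i) μ) (hp : 1 ≤ p) (hp' : p ≠ ⊤) {g : ℕ → S → X}
    (hg : ∀ l, MemLp (g l) p μ) (k : ℕ) :
    MemLp (steinDiff N c μ g k) p (Measure.count.prod μ) := by
  rcases Nat.even_or_odd' k with ⟨i, rfl | rfl⟩
  · rw [funext (steinDiff_even c g i)]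
    exact memLp_finsetSum _ fun l _ => memLp_cubeSign_smul l
      ((MemLp.fiberAvg (hc i) hp hp' (hg l)).sub (MemLp.fiberAvg (hc (i - 1)) hp hp' (hg l)))
  · rw [funext (steinDiff_odd c g i)]
    exact memLp_cubeSign_smul i (MemLp.fiberAvg (hc i) hp hp' (hg i))

theorem stronglyMeasurable_steinDiff {c : ℕ → S → ι}
    (hnest : ∀ i x y, c (i + 1) x = c (i + 1) y → c i x = c i y) [Countable ι] (g : ℕ → S → X)
    (k : ℕ) :
    StronglyMeasurable[MeasurableSpace.comap (steinLabel N c k) ⊤] (steinDiff N c μ g k) := by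
  have hf : Function.FactorsThrough (steinDiff N c μ g k) (steinLabel N c k) := by
    intro z z' hz
    have h1 := (Prod.ext_iff.1 hz).1
    have h2 := (Prod.ext_iff.1 hz).2
    simp only [steinLabel] at h1 h2
    have hs : ∀ l < (k + 1) / 2, cubeSign N l z.1 = cubeSign N l z'.1 := by
      intro l hl
      rw [← cubeSign_truncSigns hl, h1, cubeSign_truncSigns hl]
    have hE : ∀ i ≤ k / 2, ∀ l, fiberAvg (c i) μ (g l) z.2 = fiberAvg (c i) μ (g l) z'.2 := by
      intro i hi l
      simp only [fiberAvg, nested_label_of_le hnest hi _ _ h2]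
    unfold steinDiff
    split_ifs with h
    · rw [hs _ (by omega), hE _ le_rfl]
    · refine Finset.sum_congr rfl fun l hl => ?_
      have := Finset.mem_range.1 hl
      rw [hs _ (by omega), hE _ le_rfl, hE _ (Nat.sub_le _ _)]
  rw [show steinDiff N c μ g k = fun z => Function.extend (steinLabel N c k) (steinDiff N c μ g k)
    (fun _ => 0) (steinLabel N c k z) from funext fun z => (hf.extend_apply _ z).symm]
  exact stronglyMeasurable_comap_label _

theorem isMartingaleDifference_steinDiff [CompleteSpace X] [SFinite μ] [Countable ι]
    {c : ℕ → S → ι} (hc : ∀ i, IsFiniteLabelling (c i) μ)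
    (hnest : ∀ i x y, c (i + 1) x = c (i + 1) y → c i x = c i y) (hp : 1 ≤ p) (hp' : p ≠ ⊤)
    {g : ℕ → S → X} (hg : ∀ l, MemLp (g l) p μ) :
    IsMartingaleDifference p (Measure.count.prod μ) (steinFiltration N hc hnest)
      (steinDiff N c μ g) := by
  refine ⟨stronglyMeasurable_steinDiff hnest g, memLp_steinDiff hc hp hp' hg, fun k A hA hAfin => ?_⟩
  have hAm : MeasurableSet A := (steinLabel_isFiniteLabelling hc k).comap_le A hA
  have hint := MemLp.integrableOn_of_measure_ne_top hp (memLp_steinDiff hc hp hp' hg (k + 1)) hAfin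
  rw [setIntegral_cube_prod hAm hint]
  have hsec := measure_section_ne_top hAfin
  obtain ⟨T, -, rfl⟩ := hA
  rcases Nat.even_or_odd' k with ⟨i, rfl | rfl⟩
  · -- the sign with index `i` is independent of the past
    simp only [steinDiff_odd, integral_smul]
    have hk : (2 * i + 1) / 2 = i := by omega
    by_cases hi : i < N
    · have key : ∀ s, Prod.mk (cubeFlip ⟨i, hi⟩ s) ⁻¹' (steinLabel N c (2 * i) ⁻¹' T)
          = Prod.mk s ⁻¹' (steinLabel N c (2 * i) ⁻¹' T) := by
        intro s
        ext x
        simp only [Set.mem_preimage, steinLabel, hk]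
        rw [truncSigns_cubeFlip ⟨i, hi⟩ s]
      have h2 := Equiv.sum_comp (cubeFlip ⟨i, hi⟩) fun s => cubeSign N i s •
        ∫ x in Prod.mk s ⁻¹' (steinLabel N c (2 * i) ⁻¹' T), fiberAvg (c i) μ (g i) x ∂μ
      simp only [key] at h2
      have h3 : ∀ s, cubeSign N i (cubeFlip ⟨i, hi⟩ s) = -cubeSign N i s :=
        cubeSign_flip_self ⟨i, hi⟩
      simp only [h3, neg_smul, Finset.sum_neg_distrib] at h2
      set x := ∑ s, cubeSign N i s •
        ∫ x in Prod.mk s ⁻¹' (steinLabel N c (2 * i) ⁻¹' T), fiberAvg (c i) μ (g i) x ∂μ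
      have h4 : (2 : ℝ) • x = 0 := by rw [two_smul]; nth_rewrite 1 [← h2]; simp
      exact (smul_eq_zero.1 h4).resolve_left two_ne_zero
    · simp [cubeSign, hi]
  · have hk : (2 * i + 1 + 1) / 2 = i + 1 := by omega
    have hk' : (2 * i + 1) / 2 = i := by omega
    refine Finset.sum_eq_zero fun s _ => ?_
    have hAs : Prod.mk s ⁻¹' (steinLabel N c (2 * i + 1) ⁻¹' T)
        = c i ⁻¹' {a | (truncSigns (i + 1) s, a) ∈ T} := by
      ext x
      simp [steinLabel, hk, hk']
    have hfin := hsec s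
    rw [hAs] at hfin ⊢
    set T' := {a | (truncSigns (i + 1) s, a) ∈ T} with hT'
    -- the same set as a preimage under the finer label
    have hfine : c i ⁻¹' T' = c (i + 1) ⁻¹' (c (i + 1) '' (c i ⁻¹' T')) := by
      ext x
      refine ⟨fun hx => ⟨x, hx, rfl⟩, ?_⟩
      rintro ⟨y, hy, hxy⟩
      rw [Set.mem_preimage, ← hnest i _ _ hxy]
      exact hy
    have hi1 : ∀ j l, IntegrableOn (fiberAvg (c j) μ (g l)) (c i ⁻¹' T') μ := fun j l =>
      MemLp.integrableOn_of_measure_ne_top hp (MemLp.fiberAvg (hc j) hp hp' (hg l)) hfin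
    have hev : ∀ x, steinDiff N c μ g (2 * i + 1 + 1) (s, x)
        = ∑ l ∈ Finset.range (i + 1), cubeSign N l s •
          (fiberAvg (c (i + 1)) μ (g l) x - fiberAvg (c i) μ (g l) x) :=
      fun x => steinDiff_even c g (i + 1) (s, x)
    simp only [hev]
    rw [integral_finsetSum (Finset.range (i + 1)) (f := fun l x => cubeSign N l s •
      (fiberAvg (c (i + 1)) μ (g l) x - fiberAvg (c i) μ (g l) x))
      fun l _ => ((hi1 (i + 1) l).sub (hi1 i l)).smul (cubeSign N l s)]
    refine Finset.sum_eq_zero fun l _ => ?_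
    rw [integral_smul, integral_sub (hi1 (i + 1) l) (hi1 i l),
      setIntegral_fiberAvg (hc i) hp hp' (hg l) hfin]
    have := setIntegral_fiberAvg (hc (i + 1)) hp hp' (hg l)
      (T := c (i + 1) '' (c i ⁻¹' T')) (by rwa [← hfine])
    rw [← hfine] at this
    rw [this, sub_self, smul_zero]

theorem eLpNorm_signed_sum_le_umdConst {T : Type} {m : MeasurableSpace T} {ν : Measure T}
    {ℱ : Filtration ℕ m} {d : ℕ → T → X} (h1 : SigmaFinite ν) (h2 : SigmaFiniteFiltration ν ℱ)
    (hd : IsMartingaleDifference p ν ℱ d) {ε : ℕ → ℝ} (hε : ∀ k, ε k = 1 ∨ ε k = -1) (n : ℕ)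
    (hβ : umdConst p X ≠ ⊤) :
    eLpNorm (fun s => ∑ k ∈ Finset.range n, ε k • d k s) p ν
      ≤ umdConst p X * eLpNorm (fun s => ∑ k ∈ Finset.range n, d k s) p ν := by
  have htop : eLpNorm (fun s => ∑ k ∈ Finset.range n, d k s) p ν ≠ ⊤ :=
    (memLp_finsetSum _ fun k _ => hd.memLp k).2.ne
  rcases eq_or_ne (eLpNorm (fun s => ∑ k ∈ Finset.range n, d k s) p ν) 0 with h0 | h0
  · obtain ⟨β, hβ, -⟩ := sInf_lt_iff.1 hβ.lt_top
    have := hβ T m ν ℱ d h1 h2 hd ε hε n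
    rwa [h0, mul_zero] at this ⊢
  · rw [← ENNReal.div_le_iff h0 htop]
    refine le_sInf fun β hβ => ?_
    rw [ENNReal.div_le_iff h0 htop]
    exact hβ T m ν ℱ d h1 h2 hd ε hε n

theorem radNorm_fiberAvg_single_le [SFinite μ] [Countable ι] {c : S → ι}
    (hc : IsFiniteLabelling c μ) (hp : 1 ≤ p) (hp' : p ≠ ⊤) {g : ℕ → S → X}
    (hg : ∀ l, MemLp (g l) p μ) :
    radNorm N p μ (fun l => fiberAvg c μ (g l)) ≤ radNorm N p μ g := by
  have hp0 : p ≠ 0 := (zero_lt_one.trans_le hp).ne'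
  have hpos := ENNReal.toReal_pos hp0 hp'
  have hsm : ∀ l, AEStronglyMeasurable (fiberAvg c μ (g l)) μ := fun l =>
    (MemLp.fiberAvg hc hp hp' (hg l)).1
  have hG : ∀ s : Fin N → Bool, AEStronglyMeasurable
      (fun y => ∑ l ∈ Finset.range N, cubeSign N l s • g l y) μ := fun s =>
    Finset.aestronglyMeasurable_fun_sum _ fun l _ => (hg l).1.const_smul _
  have hG' : ∀ s : Fin N → Bool, AEStronglyMeasurable
      (fun y => ∑ l ∈ Finset.range N, cubeSign N l s • fiberAvg c μ (g l) y) μ := fun s =>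
    Finset.aestronglyMeasurable_fun_sum _ fun l _ => (hsm l).const_smul _
  rw [← ENNReal.rpow_le_rpow_iff hpos, radNorm_rpow hsm hp0 hp',
    radNorm_rpow (fun l => (hg l).1) hp0 hp',
    lintegral_finsetSum' _ fun s _ => (hG' s).enorm.pow_const _,
    lintegral_finsetSum' _ fun s _ => (hG s).enorm.pow_const _]
  refine Finset.sum_le_sum fun s _ => ?_
  have := eLpNorm_fiberAvg_le hc hp hp' (hG s)
  rw [funext (fiberAvg_sum_smul hc hp (Finset.range N) (fun l => cubeSign N l s) hg)] at this
  rwa [eLpNorm_eq_lintegral_rpow_enorm_toReal hp0 hp',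
    eLpNorm_eq_lintegral_rpow_enorm_toReal hp0 hp', ENNReal.rpow_le_rpow_iff (by positivity)]
    at this

/-- **Stein's inequality**, in Bourgain's vector-valued form: conditional expectations along a
filtration are bounded on random sums. -/
theorem radNorm_fiberAvg_le [CompleteSpace X] [SigmaFinite μ] [Countable ι]
    {c : ℕ → S → ι} (hc : ∀ i, IsFiniteLabelling (c i) μ)
    (hnest : ∀ i x y, c (i + 1) x = c (i + 1) y → c i x = c i y) (hp : 1 ≤ p) (hp' : p ≠ ⊤)
    (hβ : umdConst p X ≠ ⊤) {g : ℕ → S → X} (hg : ∀ l, MemLp (g l) p μ) :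
    radNorm N p μ (fun l => fiberAvg (c l) μ (g l)) ≤ (1 + umdConst p X) * radNorm N p μ g := by
  have hmem := memLp_steinDiff (N := N) hc hp hp' hg
  have htot : MemLp (fun z => ∑ k ∈ Finset.range (2 * N), steinDiff N c μ g k z) p
    (Measure.count.prod μ) := memLp_finsetSum _ fun k _ => hmem k
  have halt : MemLp (fun z => ∑ k ∈ Finset.range (2 * N),
      (if k % 2 = 1 then (1 : ℝ) else -1) • steinDiff N c μ g k z) p
    (Measure.count.prod μ) := memLp_finsetSum _ fun k _ => (hmem k).const_smul _
  have h1 : eLpNorm (fun z => ∑ k ∈ Finset.range (2 * N), steinDiff N c μ g k z) p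
      (Measure.count.prod μ) ≤ radNorm N p μ g := by
    rw [funext (sum_steinDiff c g N)]
    exact radNorm_fiberAvg_single_le (hc (N - 1)) hp hp' hg
  have hσ : SigmaFiniteFiltration (Measure.count.prod μ) (steinFiltration N hc hnest) :=
    ⟨fun k => (steinLabel_isFiniteLabelling hc k).sigmaFinite_trim⟩
  have hε : ∀ k : ℕ, (fun k => if k % 2 = 1 then (1 : ℝ) else -1) k = 1 ∨
      (fun k => if k % 2 = 1 then (1 : ℝ) else -1) k = -1 := fun k => by
    dsimp only; split_ifs <;> simp
  have h2 := eLpNorm_signed_sum_le_umdConst inferInstance hσ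
    (isMartingaleDifference_steinDiff (N := N) hc hnest hp hp' hg) hε (2 * N) hβ
  have h3 : (fun z : (Fin N → Bool) × S =>
      ∑ l ∈ Finset.range N, cubeSign N l z.1 • fiberAvg (c l) μ (g l) z.2)
      = (2 : ℝ)⁻¹ • ((fun z => ∑ k ∈ Finset.range (2 * N), steinDiff N c μ g k z)
        + fun z => ∑ k ∈ Finset.range (2 * N),
          (if k % 2 = 1 then (1 : ℝ) else -1) • steinDiff N c μ g k z) := by
    ext z
    rw [Pi.smul_apply, Pi.add_apply, ← two_smul_sum_odd_steinDiff, inv_smul_smul₀ two_ne_zero]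
  have h4 : ‖(2 : ℝ)⁻¹‖ₑ ≤ 1 := by
    rw [Real.enorm_eq_ofReal (by norm_num)]
    exact ENNReal.ofReal_le_one.2 (by norm_num)
  rw [radNorm, h3]
  refine eLpNorm_const_smul_le.trans ((mul_le_mul' h4 (eLpNorm_add_le htot.1 halt.1 hp)).trans ?_)
  rw [one_mul, add_mul, one_mul]
  exact add_le_add h1 (h2.trans (mul_le_mul' le_rfl h1))

end Stein

/-! ### Pairs of lattice points -/

section Pairs

variable {n : ℕ}

/-- A power of two comparable with `max_i |m i|`; lattice translations by `m` are arranged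
periodically with period `4 * pairWidth m`. -/
def pairWidth (m : Fin n → ℤ) : ℕ :=
  2 ^ Nat.log 2 (Finset.univ.sup fun i => (m i).natAbs)

/-- The periodic set of those `k ∈ ℤⁿ` that are paired with `k + m`. The position of `k` in its box
of side `4 * pairWidth m` is such that `k + m` lies in the same box and is not itself an anchor,
unless `m = 0`. -/
def IsAnchor (m k : Fin n → ℤ) : Prop :=
  ∀ i, max 0 (-m i) ≤ k i % (4 * pairWidth m : ℕ) ∧
    k i % (4 * pairWidth m : ℕ) < max 0 (-m i) + pairWidth m

open Classical in
/-- The label of a lattice point that identifies `k` with `k + m` for each anchor `k`. -/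
noncomputable def pairIdx (m k : Fin n → ℤ) : Fin n → ℤ :=
  if IsAnchor m (k - m) then k - m else k

theorem pairWidth_pos (m : Fin n → ℤ) : 0 < pairWidth m := by
  unfold pairWidth; positivity

theorem abs_lt_two_mul_pairWidth (m : Fin n → ℤ) (i : Fin n) : |m i| < 2 * pairWidth m := by
  have h1 : (m i).natAbs ≤ Finset.univ.sup fun i => (m i).natAbs :=
    Finset.le_sup (f := fun i => (m i).natAbs) (Finset.mem_univ i)
  have h2 := Nat.lt_pow_succ_log_self one_lt_two (Finset.univ.sup fun i => (m i).natAbs)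
  rw [Nat.succ_eq_add_one, pow_succ] at h2
  have h3 : (m i).natAbs < 2 * pairWidth m := by unfold pairWidth; omega
  rw [Int.abs_eq_natAbs]
  exact_mod_cast h3

theorem exists_pairWidth_le {m : Fin n → ℤ} (hm : m ≠ 0) : ∃ i, (pairWidth m : ℤ) ≤ |m i| := by
  obtain ⟨i0, hi0⟩ := Function.ne_iff.1 hm
  obtain ⟨i, -, hi⟩ := Finset.exists_mem_eq_sup Finset.univ ⟨i0, Finset.mem_univ _⟩
    fun i => (m i).natAbs
  have h0 : (Finset.univ.sup fun i => (m i).natAbs) ≠ 0 := by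
    have : (m i0).natAbs ≤ Finset.univ.sup fun i => (m i).natAbs :=
      Finset.le_sup (f := fun i => (m i).natAbs) (Finset.mem_univ i0)
    have h1 : (m i0).natAbs ≠ 0 := Int.natAbs_ne_zero.2 hi0
    omega
  refine ⟨i, ?_⟩
  have := Nat.pow_log_le_self 2 h0
  rw [Int.abs_eq_natAbs, ← hi]
  exact_mod_cast this

theorem IsAnchor.add_ediv {m k : Fin n → ℤ} (hk : IsAnchor m k) (i : Fin n) :
    (k + m) i / (4 * pairWidth m : ℕ) = k i / (4 * pairWidth m : ℕ) := by
  have h1 := hk i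
  have h2 := abs_lt.1 (abs_lt_two_mul_pairWidth m i)
  have h3 := pairWidth_pos m
  have hw : (0 : ℤ) < (4 * pairWidth m : ℕ) := by positivity
  have h4 := Int.emod_add_mul_ediv (k i) (4 * pairWidth m : ℕ)
  rw [Pi.add_apply]
  refine (Int.ediv_eq_iff_of_pos hw).2 ⟨?_, ?_⟩
  · push_cast at *
    rcases max_cases 0 (-m i) with h | h <;> nlinarith
  · push_cast at *
    rcases max_cases 0 (-m i) with h | h <;> nlinarith

theorem IsAnchor.eq_zero {m k : Fin n → ℤ} (hk : IsAnchor m k) (hk' : IsAnchor m (k - m)) :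
    m = 0 := by
  by_contra hm
  obtain ⟨i, hi⟩ := exists_pairWidth_le hm
  have hd := hk'.add_ediv i
  rw [sub_add_cancel] at hd
  have h1 := hk i
  have h2 := hk' i
  have h4 := Int.emod_add_mul_ediv (k i) (4 * pairWidth m : ℕ)
  have h5 := Int.emod_add_mul_ediv ((k - m) i) (4 * pairWidth m : ℕ)
  rw [← hd] at h5
  have h6 : (k - m) i = k i - m i := rfl
  have h7 : m i = k i % (4 * pairWidth m : ℕ) - (k - m) i % (4 * pairWidth m : ℕ) := by
    linarith
  have : |m i| < pairWidth m := by
    rw [abs_lt]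
    constructor <;> linarith
  linarith

theorem pairIdx_ediv (m k : Fin n → ℤ) (i : Fin n) :
    pairIdx m k i / (4 * pairWidth m : ℕ) = k i / (4 * pairWidth m : ℕ) := by
  unfold pairIdx
  split_ifs with h
  · have := h.add_ediv i
    rw [sub_add_cancel] at this
    exact this.symm
  · rfl

theorem eq_or_eq_add_of_pairIdx_eq {m k a : Fin n → ℤ} (h : pairIdx m k = a) :
    k = a ∨ k = a + m := by
  unfold pairIdx at h
  split_ifs at h
  · right; rw [← h, sub_add_cancel]
  · left; exact h

theorem IsAnchor.pairIdx_eq {m k : Fin n → ℤ} (hk : IsAnchor m k) : pairIdx m k = k := by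
  unfold pairIdx
  split_ifs with h
  · rw [hk.eq_zero h, sub_zero]
  · rfl

theorem IsAnchor.pairIdx_add {m k : Fin n → ℤ} (hk : IsAnchor m k) : pairIdx m (k + m) = k := by
  have h : IsAnchor m (k + m - m) := by rwa [add_sub_cancel_right]
  rw [pairIdx, if_pos h, add_sub_cancel_right]

end Pairs

/-! ### Dyadic cubes and the labels of pairs of cubes -/

section Cubes

variable {n : ℕ}

/-- The index of the cube of side `δ` through `x`, for the grid with corner `t`. -/
noncomputable def cubeIdx (δ : ℝ) (t : Fin n → ℝ) (x : EuclideanSpace ℝ (Fin n)) : Fin n → ℤ :=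
  fun i => ⌊(x i - t i) / δ⌋

theorem measurable_cubeIdx (δ : ℝ) (t : Fin n → ℝ) : Measurable (cubeIdx δ t) := by
  unfold cubeIdx
  refine measurable_pi_lambda _ fun i => Measurable.floor ?_
  fun_prop

theorem cubeIdx_preimage_singleton {δ : ℝ} (hδ : 0 < δ) (t : Fin n → ℝ) (a : Fin n → ℤ) :
    cubeIdx δ t ⁻¹' {a} = (WithLp.ofLp : EuclideanSpace ℝ (Fin n) → Fin n → ℝ) ⁻¹'
      (Set.univ.pi fun i => Set.Ico (t i + δ * a i) (t i + δ * a i + δ)) := by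
  ext x
  simp only [Set.mem_preimage, Set.mem_singleton_iff, funext_iff, cubeIdx, Set.mem_pi,
    Set.mem_univ, forall_const, Set.mem_Ico, Int.floor_eq_iff, le_div_iff₀ hδ, div_lt_iff₀ hδ]
  refine forall_congr' fun i => ?_
  constructor <;> rintro ⟨h1, h2⟩ <;> constructor <;> nlinarith

theorem volume_cubeIdx_preimage {δ : ℝ} (hδ : 0 < δ) (t : Fin n → ℝ) (a : Fin n → ℤ) :
    volume (cubeIdx δ t ⁻¹' {a}) = ENNReal.ofReal (δ ^ n) := by
  rw [cubeIdx_preimage_singleton hδ, (PiLp.volume_preserving_ofLp (Fin n)).measure_preimage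
    (MeasurableSet.univ_pi fun i => measurableSet_Ico).nullMeasurableSet, Real.volume_pi_Ico]
  simp [ENNReal.ofReal_pow hδ.le]

/-- The label of the union of the cubes with indices `k` and `k + m`, for `k` an anchor, and of the
other cubes. -/
noncomputable def pairLabel (δ : ℝ) (t : Fin n → ℝ) (m : Fin n → ℤ)
    (x : EuclideanSpace ℝ (Fin n)) : Fin n → ℤ :=
  pairIdx m (cubeIdx δ t x)

theorem volume_pairLabel_preimage_le {δ : ℝ} (hδ : 0 < δ) (t : Fin n → ℝ) (m a : Fin n → ℤ) :
    volume (pairLabel δ t m ⁻¹' {a}) ≤ ENNReal.ofReal (2 * δ ^ n) := by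
  calc volume (pairLabel δ t m ⁻¹' {a})
      ≤ volume (cubeIdx δ t ⁻¹' {a} ∪ cubeIdx δ t ⁻¹' {a + m}) :=
        measure_mono fun x hx => eq_or_eq_add_of_pairIdx_eq hx
    _ ≤ _ := measure_union_le _ _
    _ = ENNReal.ofReal (2 * δ ^ n) := by
        rw [volume_cubeIdx_preimage hδ, volume_cubeIdx_preimage hδ, two_mul,
          ENNReal.ofReal_add (by positivity) (by positivity)]

theorem pairLabel_isFiniteLabelling {δ : ℝ} (hδ : 0 < δ) (t : Fin n → ℝ) (m : Fin n → ℤ) :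
    IsFiniteLabelling (pairLabel δ t m) volume where
  measurableSet a := measurable_cubeIdx δ t (MeasurableSet.of_discrete (s := pairIdx m ⁻¹' {a}))
  measure_ne_top a := ne_top_of_le_ne_top ENNReal.ofReal_ne_top
    (volume_pairLabel_preimage_le hδ t m a)

/-- The cube of side `2^M δ` through a point is determined by the pair label at side `δ`. -/
theorem cubeIdx_eq_of_pairLabel_eq {δ : ℝ} (t : Fin n → ℝ) (m : Fin n → ℤ) {M : ℕ}
    (hM : 4 * pairWidth m ∣ 2 ^ M) {x y : EuclideanSpace ℝ (Fin n)}
    (h : pairLabel δ t m x = pairLabel δ t m y) :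
    cubeIdx (δ * 2 ^ M) t x = cubeIdx (δ * 2 ^ M) t y := by
  obtain ⟨q, hq⟩ := hM
  have key : ∀ z i, cubeIdx (δ * 2 ^ M) t z i
      = pairLabel δ t m z i / (4 * pairWidth m : ℕ) / (q : ℤ) := by
    intro z i
    rw [pairLabel, pairIdx_ediv, Int.ediv_ediv_of_nonneg (by positivity), ← Nat.cast_mul, ← hq,
      cubeIdx, cubeIdx, ← Int.floor_div_natCast, div_div]
    norm_cast
  ext i
  rw [key, key, h]

end Cubes

/-! ### Translations of averages -/

section PairShift

variable {n : ℕ} {X : Type u} [NormedAddCommGroup X] [NormedSpace ℂ X] {p : ℝ≥0∞}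

/-- The corner of the window in the unit interval from which mass is moved by a fractional part `θ`
with `|θ| ≤ 1/2`. Both the window and its translate by `θ`, of length `h ≤ 1/2`, lie in `[0, 1)`. -/
noncomputable def windowCorner (h θ : ℝ) : ℝ := 1 / 2 - h / 2 - θ / 2

/-- The lattice vector nearest to `y`. -/
noncomputable def roundVec (y : Fin n → ℝ) : Fin n → ℤ := fun i => round (y i)

/-- The set of the points in the windows of the anchor cubes. -/
def sourceSet (h δ : ℝ) (t y : Fin n → ℝ) : Set (EuclideanSpace ℝ (Fin n)) :=
  {v | IsAnchor (roundVec y) (cubeIdx δ t v) ∧ ∀ i, Int.fract ((v i - t i) / δ) ∈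
    Set.Ico (windowCorner h (y i - round (y i))) (windowCorner h (y i - round (y i)) + h)}

/-- The set of the points in the translated windows. -/
def targetSet (h δ : ℝ) (t y : Fin n → ℝ) : Set (EuclideanSpace ℝ (Fin n)) :=
  {x | IsAnchor (roundVec y) (cubeIdx δ t x - roundVec y) ∧ ∀ i, Int.fract ((x i - t i) / δ) ∈
    Set.Ico (windowCorner h (y i - round (y i)) + (y i - round (y i)))
      (windowCorner h (y i - round (y i)) + (y i - round (y i)) + h)}

/-- The set of the pairs `(x, v)` where `x` is in the translate by `δ y` of the window that
contains `v`. -/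
def pairSet (h δ : ℝ) (t y : Fin n → ℝ) :
    Set (EuclideanSpace ℝ (Fin n) × EuclideanSpace ℝ (Fin n)) :=
  {z | z.2 ∈ sourceSet h δ t y ∧ z.1 ∈ targetSet h δ t y ∧
    cubeIdx δ t z.1 = cubeIdx δ t z.2 + roundVec y}

/-- The operator that moves the integrals over the windows of the anchor cubes to the windows
translated by `δ y`. -/
noncomputable def pairShift (h δ : ℝ) (t y : Fin n → ℝ) (g : EuclideanSpace ℝ (Fin n) → X)
    (x : EuclideanSpace ℝ (Fin n)) : X :=
  (δ ^ n)⁻¹ • ∫ v, (pairSet h δ t y).indicator (fun z => g z.2) (x, v)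

theorem measurableSet_sourceSet (h δ : ℝ) (t y : Fin n → ℝ) :
    MeasurableSet (sourceSet h δ t y) := by
  refine MeasurableSet.inter (measurable_cubeIdx δ t
    (MeasurableSet.of_discrete (s := {k | IsAnchor (roundVec y) k}))) ?_
  refine MeasurableSet.congr (s := ⋂ i, (fun v : EuclideanSpace ℝ (Fin n) =>
    Int.fract ((v i - t i) / δ)) ⁻¹' Set.Ico (windowCorner h (y i - round (y i)))
      (windowCorner h (y i - round (y i)) + h)) ?_
    (by ext; simp only [Set.mem_iInter]; rfl)
  refine MeasurableSet.iInter fun i => ?_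
  have : Measurable fun v : EuclideanSpace ℝ (Fin n) => (v i - t i) / δ := by fun_prop
  exact this.fract measurableSet_Ico

theorem measurableSet_targetSet (h δ : ℝ) (t y : Fin n → ℝ) :
    MeasurableSet (targetSet h δ t y) := by
  refine MeasurableSet.inter (measurable_cubeIdx δ t
    (MeasurableSet.of_discrete (s := {k | IsAnchor (roundVec y) (k - roundVec y)}))) ?_
  refine MeasurableSet.congr (s := ⋂ i, (fun v : EuclideanSpace ℝ (Fin n) =>
    Int.fract ((v i - t i) / δ)) ⁻¹' Set.Ico
      (windowCorner h (y i - round (y i)) + (y i - round (y i)))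
      (windowCorner h (y i - round (y i)) + (y i - round (y i)) + h)) ?_
    (by ext; simp only [Set.mem_iInter]; rfl)
  refine MeasurableSet.iInter fun i => ?_
  have : Measurable fun v : EuclideanSpace ℝ (Fin n) => (v i - t i) / δ := by fun_prop
  exact this.fract measurableSet_Ico

/-- The coefficient that turns the average over a pair of cubes into a normalized integral. -/
noncomputable def pairCoeff (h δ : ℝ) (t y : Fin n → ℝ) : EuclideanSpace ℝ (Fin n) → ℝ :=
  (targetSet h δ t y).indicator fun x =>
    (δ ^ n)⁻¹ * volume.real (pairLabel δ t (roundVec y) ⁻¹' {pairLabel δ t (roundVec y) x})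

theorem abs_pairCoeff_le (h : ℝ) {δ : ℝ} (hδ : 0 < δ) (t y : Fin n → ℝ)
    (x : EuclideanSpace ℝ (Fin n)) : |pairCoeff h δ t y x| ≤ 2 := by
  unfold pairCoeff
  by_cases hx : x ∈ targetSet h δ t y
  · rw [Set.indicator_of_mem hx, abs_of_nonneg (by positivity), inv_mul_le_iff₀ (by positivity),
      mul_comm]
    exact ENNReal.toReal_le_of_le_ofReal (by positivity)
      (volume_pairLabel_preimage_le hδ t (roundVec y) _)
  · simp [Set.indicator_of_notMem hx]

theorem measurable_pairCoeff (h δ : ℝ) (t y : Fin n → ℝ) : Measurable (pairCoeff h δ t y) := by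
  refine Measurable.indicator ?_ (measurableSet_targetSet h δ t y)
  refine Measurable.const_mul ?_ _
  have h1 : Measurable (pairLabel δ t (roundVec y)) :=
    (Measurable.of_discrete (f := pairIdx (roundVec y))).comp (measurable_cubeIdx δ t)
  exact (Measurable.of_discrete
    (f := fun a => volume.real (pairLabel δ t (roundVec y) ⁻¹' {a}))).comp h1

/-- Translated averages are conditional expectations with respect to pairs of cubes, multiplied by
bounded functions before and after. -/
theorem pairShift_eq_fiberAvg (h : ℝ) {δ : ℝ} (hδ : 0 < δ) (t y : Fin n → ℝ)
    (g : EuclideanSpace ℝ (Fin n) → X) (x : EuclideanSpace ℝ (Fin n)) :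
    pairShift h δ t y g x = pairCoeff h δ t y x •
      fiberAvg (pairLabel δ t (roundVec y)) volume ((sourceSet h δ t y).indicator g) x := by
  unfold pairShift pairCoeff
  by_cases hx : x ∈ targetSet h δ t y
  · rw [Set.indicator_of_mem hx, mul_smul, fiberAvg, measure_smul_setAverage _
      ((pairLabel_isFiniteLabelling hδ t (roundVec y)).measure_ne_top _),
      ← integral_indicator ((pairLabel_isFiniteLabelling hδ t (roundVec y)).measurableSet _)]
    congr 2
    ext v
    by_cases hv : v ∈ sourceSet h δ t y
    · have h1 : pairLabel δ t (roundVec y) v = cubeIdx δ t v := hv.1.pairIdx_eq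
      have h2 : pairLabel δ t (roundVec y) x = cubeIdx δ t x - roundVec y := by
        have := hx.1.pairIdx_add
        rwa [sub_add_cancel] at this
      by_cases he : cubeIdx δ t x = cubeIdx δ t v + roundVec y
      · have h3 : v ∈ pairLabel δ t (roundVec y) ⁻¹' {pairLabel δ t (roundVec y) x} := by
          rw [Set.mem_preimage, Set.mem_singleton_iff, h1, h2, he, add_sub_cancel_right]
        have h4 : (x, v) ∈ pairSet h δ t y := ⟨hv, hx, he⟩
        rw [Set.indicator_of_mem h3, Set.indicator_of_mem hv, Set.indicator_of_mem h4]
      · have h3 : v ∉ pairLabel δ t (roundVec y) ⁻¹' {pairLabel δ t (roundVec y) x} := by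
          rw [Set.mem_preimage, Set.mem_singleton_iff, h1, h2]
          exact fun h5 => he (by rw [h5, sub_add_cancel])
        have h4 : (x, v) ∉ pairSet h δ t y := fun h5 => he h5.2.2
        rw [Set.indicator_of_notMem h3, Set.indicator_of_notMem h4]
    · have h4 : (x, v) ∉ pairSet h δ t y := fun h5 => hv h5.1
      rw [Set.indicator_of_notMem h4, Set.indicator_apply_eq_zero.2
        fun _ => Set.indicator_of_notMem hv g]
  · rw [Set.indicator_of_notMem hx, zero_smul]
    have : ∀ v, (pairSet h δ t y).indicator (fun z => g z.2) (x, v) = 0 := fun v =>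
      Set.indicator_of_notMem (fun hz => hx hz.2.1) _
    simp [this]

/-- The smallest integer `≥ j` that is congruent to `a` modulo `M`. -/
def roundUpMod (a M j : ℤ) : ℤ := j + (a - j) % M

theorem roundUpMod_sub_one {M : ℤ} (hM : 0 < M) (a j : ℤ) :
    roundUpMod a M (j - 1) = roundUpMod a M j ∨ roundUpMod a M j = roundUpMod a M (j - 1) + M := by
  unfold roundUpMod
  have h1 := Int.emod_nonneg (a - j) hM.ne'
  have h2 := Int.emod_lt_of_pos (a - j) hM
  have h3 : (a - (j - 1)) % M = ((a - j) % M + 1) % M := by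
    rw [show a - (j - 1) = a - j + 1 by ring, Int.emod_add_emod]
  rcases lt_or_ge ((a - j) % M + 1) M with h4 | h4
  · left
    rw [h3, Int.emod_eq_of_lt (by omega) h4]; ring
  · right
    have : (a - j) % M + 1 = M := by omega
    rw [h3, this, Int.emod_self]; omega

/-- The translated averages of the scales in one residue class modulo `M` are bounded on random
sums: consecutive scales of the class are so far apart that the labels of pairs are nested. -/
theorem radNorm_pairShift_class_le [CompleteSpace X] (hp : 1 ≤ p) (hp' : p ≠ ⊤)
    (hβ : umdConst p X ≠ ⊤) (h : ℝ) (t : Fin n → ℝ) (y : ℤ → Fin n → ℝ) {M : ℕ} (hM : 0 < M)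
    (hyM : ∀ j, 4 * pairWidth (roundVec (y j)) ∣ 2 ^ M) (K a : ℤ) (N : ℕ)
    {g : ℕ → EuclideanSpace ℝ (Fin n) → X} (hg : ∀ l, MemLp (g l) p volume) :
    radNorm N p volume (fun (l : ℕ) x => if roundUpMod a M (K - (l : ℤ)) = K - (l : ℤ) then
        pairShift h (2 ^ (K - (l : ℤ))) t (y (K - (l : ℤ))) (g l) x else 0)
      ≤ 2 * (1 + umdConst p X) * radNorm N p volume g := by
  set J : ℕ → ℤ := fun l => roundUpMod a M (K - (l : ℤ)) with hJ
  set c : ℕ → EuclideanSpace ℝ (Fin n) → Fin n → ℤ := fun l =>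
    pairLabel (2 ^ J l) t (roundVec (y (J l))) with hc
  have hpos : ∀ j : ℤ, (0 : ℝ) < 2 ^ j := fun j => by positivity
  have hlab : ∀ l, IsFiniteLabelling (c l) volume := fun l =>
    pairLabel_isFiniteLabelling (hpos _) t _
  have hnest : ∀ i x x', c (i + 1) x = c (i + 1) x' → c i x = c i x' := by
    intro i x x' hx
    have h1 : J (i + 1) = roundUpMod a M (K - i - 1) := by
      simp only [hJ]; congr 1; push_cast; ring
    rcases roundUpMod_sub_one (M := M) (by exact_mod_cast hM) a (K - i) with h2 | h2
    · rw [← h1] at h2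
      have h3 : J (i + 1) = J i := h2
      simp only [hc] at hx ⊢
      rwa [h3] at hx
    · rw [← h1] at h2
      have h3 : J i = J (i + 1) + M := h2
      have h4 := cubeIdx_eq_of_pairLabel_eq t (roundVec (y (J (i + 1)))) (hyM _) hx
      have h5 : (2 : ℝ) ^ J i = 2 ^ J (i + 1) * 2 ^ M := by
        rw [h3, zpow_add₀ two_ne_zero, zpow_natCast]
      rw [← h5] at h4
      simp only [hc, pairLabel, h4]
  set g' : ℕ → EuclideanSpace ℝ (Fin n) → X := fun l =>
    (sourceSet h (2 ^ (K - (l : ℤ))) t (y (K - (l : ℤ)))).indicator (g l) with hg'def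
  have hg' : ∀ l, MemLp (g' l) p volume := fun l =>
    (hg l).indicator (measurableSet_sourceSet _ _ _ _)
  set b : ℕ → EuclideanSpace ℝ (Fin n) → ℝ := fun l x =>
    if J l = K - (l : ℤ) then 2⁻¹ * pairCoeff h (2 ^ (K - (l : ℤ))) t (y (K - (l : ℤ))) x else 0 with hb
  have hbm : ∀ l, AEStronglyMeasurable (b l) volume := by
    intro l
    by_cases hl : J l = K - l
    · simp only [hb, hl, if_true]
      exact ((measurable_pairCoeff _ _ _ _).const_mul _).aestronglyMeasurable
    · simp only [hb, hl, if_false]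
      exact aestronglyMeasurable_const
  have hb1 : ∀ l x, |b l x| ≤ 1 := by
    intro l x
    by_cases hl : J l = K - l
    · simp only [hb, hl, if_true]
      have := abs_pairCoeff_le h (hpos (K - (l : ℤ))) t (y (K - (l : ℤ))) x
      rw [abs_mul, abs_of_pos (by norm_num : (0 : ℝ) < 2⁻¹)]
      linarith
    · simp [hb, hl]
  have e1 : (fun (l : ℕ) x => if roundUpMod a M (K - (l : ℤ)) = K - (l : ℤ) then
        pairShift h (2 ^ (K - (l : ℤ))) t (y (K - (l : ℤ))) (g l) x else 0)
      = fun (l : ℕ) x => b l x • (2 : ℝ) • fiberAvg (c l) volume (g' l) x := by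
    ext l x
    by_cases hl : J l = K - l
    · have hl' : roundUpMod a M (K - (l : ℤ)) = K - l := hl
      simp only [hb, hc, hl, hl', if_true]
      rw [pairShift_eq_fiberAvg h (hpos _), smul_smul]
      congr 1
      ring
    · have hl' : ¬ roundUpMod a M (K - (l : ℤ)) = K - l := hl
      simp only [hb, hl, hl', if_false, zero_smul]
  have hsm : ∀ l, AEStronglyMeasurable (fiberAvg (c l) volume (g' l)) volume := fun l =>
    (stronglyMeasurable_fiberAvg (hlab l) _).aestronglyMeasurable
  have e2 : radNorm N p volume g' ≤ radNorm N p volume g := by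
    have : g' = fun (l : ℕ) x => (sourceSet h (2 ^ (K - (l : ℤ))) t (y (K - (l : ℤ)))).indicator (fun _ => (1 : ℝ)) x
        • g l x := by
      ext l x
      by_cases hx : x ∈ sourceSet h (2 ^ (K - (l : ℤ))) t (y (K - (l : ℤ))) <;> simp [hg'def, hx]
    rw [this]
    refine radNorm_smul_le (fun l => (hg l).1) (fun l => ?_) (fun l x => ?_) hp hp'
    · exact (measurable_const.indicator (measurableSet_sourceSet _ _ _ _)).aestronglyMeasurable
    · by_cases hx : x ∈ sourceSet h (2 ^ (K - (l : ℤ))) t (y (K - (l : ℤ))) <;> simp [hx]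
  rw [e1]
  refine (radNorm_smul_le (g := fun l x => (2 : ℝ) • fiberAvg (c l) volume (g' l) x)
    (fun l => (hsm l).const_smul _) hbm hb1 hp hp').trans ?_
  refine (radNorm_const_smul_le 2 _).trans ?_
  rw [abs_of_pos two_pos, ENNReal.ofReal_ofNat, mul_assoc]
  exact mul_le_mul' le_rfl
    ((radNorm_fiberAvg_le hlab hnest hp hp' hβ hg').trans (mul_le_mul' le_rfl e2))

theorem stronglyMeasurable_pairShift [CompleteSpace X] (h : ℝ) {δ : ℝ} (hδ : 0 < δ)
    (t y : Fin n → ℝ) (g : EuclideanSpace ℝ (Fin n) → X) :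
    StronglyMeasurable (pairShift h δ t y g) := by
  rw [funext (pairShift_eq_fiberAvg h hδ t y g)]
  exact (measurable_pairCoeff h δ t y).stronglyMeasurable.smul
    (stronglyMeasurable_fiberAvg (pairLabel_isFiniteLabelling hδ t _) _)

/-- Translated averages are bounded on random sums, with a constant proportional to the number `M`
of residue classes into which the scales are split. -/
theorem radNorm_pairShift_le [CompleteSpace X] (hp : 1 ≤ p) (hp' : p ≠ ⊤)
    (hβ : umdConst p X ≠ ⊤) (h : ℝ) (t : Fin n → ℝ) (y : ℤ → Fin n → ℝ) {M : ℕ} (hM : 0 < M)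
    (hyM : ∀ j, 4 * pairWidth (roundVec (y j)) ∣ 2 ^ M) (K : ℤ) (N : ℕ)
    {g : ℕ → EuclideanSpace ℝ (Fin n) → X} (hg : ∀ l, MemLp (g l) p volume) :
    radNorm N p volume (fun l : ℕ => pairShift h (2 ^ (K - (l : ℤ))) t (y (K - (l : ℤ))) (g l))
      ≤ M * (2 * (1 + umdConst p X) * radNorm N p volume g) := by
  have hM' : (0 : ℤ) < M := by exact_mod_cast hM
  have e1 : (fun l : ℕ => pairShift h (2 ^ (K - (l : ℤ))) t (y (K - (l : ℤ))) (g l))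
      = fun (l : ℕ) x => ∑ a ∈ Finset.range M, if roundUpMod a M (K - (l : ℤ)) = K - (l : ℤ) then
        pairShift h (2 ^ (K - (l : ℤ))) t (y (K - (l : ℤ))) (g l) x else 0 := by
    ext l x
    have hr : ∀ a ∈ Finset.range M, (roundUpMod a M (K - (l : ℤ)) = K - l ↔
        a = ((K - (l : ℤ)) % M).toNat) := by
      intro a ha
      have ha' := Finset.mem_range.1 ha
      unfold roundUpMod
      have h1 : K - l + (a - (K - (l : ℤ))) % M = K - l ↔ ((a : ℤ) - (K - (l : ℤ))) % M = 0 := by omega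
      rw [h1, ← Int.emod_eq_emod_iff_emod_sub_eq_zero]
      have h2 : (a : ℤ) % M = a := Int.emod_eq_of_lt (by omega) (by omega)
      have h3 := Int.emod_nonneg (K - (l : ℤ)) hM'.ne'
      rw [h2]
      omega
    have hmem : ((K - (l : ℤ)) % M).toNat ∈ Finset.range M := by
      have h3 := Int.emod_nonneg (K - (l : ℤ)) hM'.ne'
      have h4 := Int.emod_lt_of_pos (K - (l : ℤ)) hM'
      exact Finset.mem_range.2 (by omega)
    rw [Finset.sum_congr rfl fun a ha => if_congr (hr a ha) rfl rfl, Finset.sum_ite_eq' _ _ _,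
      if_pos hmem]
  rw [e1]
  refine (radNorm_sum_le (Finset.range M) (g := fun (a : ℕ) (l : ℕ) x =>
    if roundUpMod a M (K - (l : ℤ)) = K - (l : ℤ) then
      pairShift h (2 ^ (K - (l : ℤ))) t (y (K - (l : ℤ))) (g l) x else 0) (fun a l => ?_) hp).trans ?_
  · by_cases hl : roundUpMod a M (K - (l : ℤ)) = K - l
    · simp only [hl, if_true]
      exact (stronglyMeasurable_pairShift h (by positivity) t _ _).aestronglyMeasurable
    · simp only [hl, if_false]
      exact aestronglyMeasurable_const
  · refine (Finset.sum_le_sum fun (a : ℕ) _ =>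
      radNorm_pairShift_class_le hp hp' hβ h t y hM hyM K (a : ℤ) N hg).trans (le_of_eq ?_)
    rw [Finset.sum_const, Finset.card_range, nsmul_eq_mul]

end PairShift

/-! ### Averages over the corner of the grid -/

section OneDim

/-- The one-dimensional tent function of width `h`. -/
def tent (h r : ℝ) : ℝ := max 0 (h - |r|)

/-- The one-dimensional factor of the indicator function of `pairSet`, in units of the side of the
cubes. -/
def pairSetOne (h : ℝ) (w : ℕ) (y : ℝ) : Set (ℝ × ℝ) :=
  {z | (max 0 (-round y) ≤ ⌊z.2⌋ % (4 * w : ℕ) ∧ ⌊z.2⌋ % (4 * w : ℕ) < max 0 (-round y) + w) ∧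
    Int.fract z.2 ∈ Set.Ico (windowCorner h (y - round y)) (windowCorner h (y - round y) + h) ∧
    Int.fract z.1 ∈ Set.Ico (windowCorner h (y - round y) + (y - round y))
      (windowCorner h (y - round y) + (y - round y) + h) ∧
    ⌊z.1⌋ = ⌊z.2⌋ + round y}

theorem measurableSet_pairSetOne (h : ℝ) (w : ℕ) (y : ℝ) : MeasurableSet (pairSetOne h w y) := by
  have h1 : Measurable fun z : ℝ × ℝ => ⌊z.2⌋ := measurable_snd.floor
  have h2 : Measurable fun z : ℝ × ℝ => ⌊z.1⌋ := measurable_fst.floor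
  refine MeasurableSet.inter (h1 (MeasurableSet.of_discrete (s := {k : ℤ |
    max 0 (-round y) ≤ k % (4 * w : ℕ) ∧ k % (4 * w : ℕ) < max 0 (-round y) + w}))) ?_
  refine MeasurableSet.inter (measurable_snd.fract measurableSet_Ico) ?_
  refine MeasurableSet.inter (measurable_fst.fract measurableSet_Ico) ?_
  exact measurableSet_eq_fun h2 (h1.add_const _)

theorem window_bounds {h : ℝ} (hh : h ≤ 1 / 2) (y : ℝ) :
    0 ≤ windowCorner h (y - round y) ∧ windowCorner h (y - round y) + h ≤ 1 ∧
    0 ≤ windowCorner h (y - round y) + (y - round y) ∧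
    windowCorner h (y - round y) + (y - round y) + h ≤ 1 := by
  have := abs_le.1 (abs_sub_round y)
  unfold windowCorner
  refine ⟨?_, ?_, ?_, ?_⟩ <;> linarith

/-- On the cell `[k, k+1)` the indicator function of the shifted pairs is the indicator function of
the intersection of two windows, or zero. -/
theorem integral_cell_pairSetOne {h : ℝ} (hh : h ≤ 1 / 2) {w : ℕ} (y r : ℝ) {k : ℕ}
    (hk : k < 4 * w) :
    ∫ z in (k : ℝ)..(k + 1 : ℝ), (pairSetOne h w y).indicator (fun _ => (1 : ℝ)) (z + r, z)
      = if max 0 (-round y) ≤ (k : ℤ) ∧ (k : ℤ) < max 0 (-round y) + w then tent h (r - y) else 0 := by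
  obtain ⟨b1, b2, b3, b4⟩ := window_bounds hh y
  set s := windowCorner h (y - round y) with hs
  have hcell : ∀ z ∈ Set.Ico (k : ℝ) (k + 1), ((z + r, z) ∈ pairSetOne h w y ↔
      (max 0 (-round y) ≤ (k : ℤ) ∧ (k : ℤ) < max 0 (-round y) + w) ∧
        z ∈ Set.Ico (max (k + s) (k + s + y - r)) (min (k + s + h) (k + s + y - r + h))) := by
    intro z hz
    have hfl : ⌊z⌋ = (k : ℤ) := by
      rw [Int.floor_eq_iff]; exact_mod_cast hz
    have hmod : (k : ℤ) % (4 * w : ℕ) = k := Int.emod_eq_of_lt (by positivity) (by exact_mod_cast hk)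
    have hfr : Int.fract z = z - k := by rw [Int.fract, hfl]; simp
    simp only [pairSetOne, Set.mem_ofPred_eq, hfl, hmod, hfr, ← hs, Set.mem_Ico, max_le_iff,
      lt_min_iff]
    refine and_congr_right fun _ => ?_
    constructor
    · rintro ⟨⟨h1, h2⟩, ⟨h3, h4⟩, h5⟩
      rw [Int.fract, h5] at h3 h4
      push_cast at h3 h4
      refine ⟨⟨?_, ?_⟩, ?_, ?_⟩ <;> linarith
    · rintro ⟨⟨h1, h2⟩, h3, h4⟩
      have h5 : ⌊z + r⌋ = (k : ℤ) + round y := by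
        rw [Int.floor_eq_iff]
        push_cast
        constructor <;> linarith
      rw [Int.fract, h5]
      push_cast
      refine ⟨⟨?_, ?_⟩, ⟨?_, ?_⟩, rfl⟩ <;> linarith
  rw [intervalIntegral.integral_of_le (by linarith), ← integral_Ico_eq_integral_Ioc]
  split_ifs with hcond
  · set I := Set.Ico (max (k + s) (k + s + y - r)) (min (k + s + h) (k + s + y - r + h)) with hI
    have hIsub : I ⊆ Set.Ico (k : ℝ) (k + 1) := by
      intro z hz
      have h1 := (le_max_left _ _).trans hz.1
      have h2 := hz.2.trans_le (min_le_left _ _)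
      exact ⟨by linarith, by linarith⟩
    have e1 : ∫ z in Set.Ico (k : ℝ) (k + 1),
        (pairSetOne h w y).indicator (fun _ => (1 : ℝ)) (z + r, z)
        = ∫ z in Set.Ico (k : ℝ) (k + 1), I.indicator (fun _ => (1 : ℝ)) z := by
      refine setIntegral_congr_fun measurableSet_Ico fun z hz => ?_
      have := hcell z hz
      simp only [hcond, true_and] at this
      by_cases hzI : z ∈ I
      · simp only [Set.indicator_of_mem hzI, Set.indicator_of_mem (this.2 hzI)]
      · simp only [Set.indicator_of_notMem hzI, Set.indicator_of_notMem fun hc => hzI (this.1 hc)]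
    rw [e1, setIntegral_indicator measurableSet_Ico, Set.inter_eq_right.2 hIsub, setIntegral_const,
      smul_eq_mul, mul_one, hI, measureReal_def, Real.volume_Ico, ENNReal.toReal_ofReal', tent,
      max_comm]
    congr 1
    rcases le_total y r with hyr | hyr
    · rw [abs_of_nonneg (by linarith), min_eq_right (by linarith), max_eq_left (by linarith)]; ring
    · rw [abs_of_nonpos (by linarith), min_eq_left (by linarith), max_eq_right (by linarith)]; ring
  · rw [← integral_zero ℝ ℝ (μ := volume.restrict (Set.Ico (k : ℝ) (k + 1)))]
    refine setIntegral_congr_fun measurableSet_Ico fun z hz => ?_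
    exact Set.indicator_of_notMem (fun hc => hcond ((hcell z hz).1 hc).1) _

theorem card_filter_window (w : ℕ) {b : ℤ} (hb : 0 ≤ b) (hb' : b ≤ 3 * w) :
    ((Finset.range (4 * w)).filter fun k : ℕ => b ≤ (k : ℤ) ∧ (k : ℤ) < b + w).card = w := by
  obtain ⟨c, rfl⟩ := Int.eq_ofNat_of_zero_le hb
  have : (Finset.range (4 * w)).filter (fun k : ℕ => (c : ℤ) ≤ (k : ℤ) ∧ (k : ℤ) < c + w)
      = Finset.Ico c (c + w) := by
    ext k
    simp only [Finset.mem_filter, Finset.mem_range, Finset.mem_Ico]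
    omega
  rw [this, Nat.card_Ico]
  omega

theorem intervalIntegrable_pairSetOne (h : ℝ) (w : ℕ) (y r a b : ℝ) :
    IntervalIntegrable (fun z => (pairSetOne h w y).indicator (fun _ => (1 : ℝ)) (z + r, z))
      volume a b := by
  refine (intervalIntegrable_const (c := (1 : ℝ))).mono_fun ?_ (Eventually.of_forall fun z => ?_)
  · have : Measurable fun z : ℝ => (z + r, z) := by fun_prop
    exact ((measurable_const.indicator (measurableSet_pairSetOne h w y)).comp
      this).aestronglyMeasurable
  · by_cases hz : (z + r, z) ∈ pairSetOne h w y <;> simp [hz]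

theorem integral_period_pairSetOne {h : ℝ} (hh : h ≤ 1 / 2) {w : ℕ} {y : ℝ}
    (hw : |round y| < 2 * w) (r : ℝ) :
    ∫ z in (0 : ℝ)..(4 * w : ℕ), (pairSetOne h w y).indicator (fun _ => (1 : ℝ)) (z + r, z)
      = w * tent h (r - y) := by
  have h1 := intervalIntegral.sum_integral_adjacent_intervals (μ := volume)
    (f := fun z => (pairSetOne h w y).indicator (fun _ => (1 : ℝ)) (z + r, z))
    (a := fun k : ℕ => (k : ℝ)) (n := 4 * w)
    (fun k _ => intervalIntegrable_pairSetOne h w y r _ _)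
  have h2 := abs_lt.1 hw
  rw [Nat.cast_zero] at h1
  rw [← h1, Finset.sum_congr rfl fun k hk => by
    rw [Nat.cast_add_one, integral_cell_pairSetOne hh y r (Finset.mem_range.1 hk)]]
  rw [← Finset.sum_filter, Finset.sum_const, card_filter_window w (le_max_left _ _)
    (by rw [max_le_iff]; constructor <;> omega), nsmul_eq_mul]

theorem periodic_pairSetOne (h : ℝ) (w : ℕ) (y r : ℝ) :
    Function.Periodic (fun z => (pairSetOne h w y).indicator (fun _ => (1 : ℝ)) (z + r, z))
      ((4 * w : ℕ) : ℝ) := by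
  intro z
  have hz : ((z + (4 * w : ℕ) + r, z + (4 * w : ℕ)) ∈ pairSetOne h w y) ↔
      (z + r, z) ∈ pairSetOne h w y := by
    have e1 : z + (4 * w : ℕ) + r = z + r + (4 * w : ℕ) := by ring
    simp only [pairSetOne, Set.mem_ofPred_eq, e1, Int.floor_add_natCast, Int.fract_add_natCast,
      Int.add_emod_right]
    refine and_congr_right fun _ => and_congr_right fun _ => and_congr_right fun _ => ?_
    constructor <;> intro h <;> omega
  by_cases hm : (z + r, z) ∈ pairSetOne h w y
  · simp only [Set.indicator_of_mem hm, Set.indicator_of_mem (hz.2 hm)]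
  · simp only [Set.indicator_of_notMem hm, Set.indicator_of_notMem fun hc => hm (hz.1 hc)]

/-- Averaging over the corner of the grid turns the indicator function of the pairs into a translate
of the tent function. -/
theorem integral_corner_pairSetOne {h : ℝ} (hh : h ≤ 1 / 2) {w : ℕ} {y : ℝ}
    (hw : |round y| < 2 * w) {δ : ℝ} (hδ : 0 < δ) (q : ℕ) (a b : ℝ) :
    ∫ t in (0 : ℝ)..(δ * (4 * w : ℕ) * q),
        (pairSetOne h w y).indicator (fun _ => (1 : ℝ)) ((a - t) / δ, (b - t) / δ)
      = δ * (w * q) * tent h ((a - b) / δ - y) := by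
  set G : ℝ → ℝ := fun z =>
    (pairSetOne h w y).indicator (fun _ => (1 : ℝ)) (z + (a - b) / δ, z) with hG
  have e1 : ∀ t, (pairSetOne h w y).indicator (fun _ => (1 : ℝ)) ((a - t) / δ, (b - t) / δ)
      = G (b / δ - t / δ) := by
    intro t
    simp only [hG]
    congr 2 <;> ring
  simp only [e1]
  rw [intervalIntegral.integral_comp_sub_div (fun z => G z) hδ.ne' (b / δ), zero_div, sub_zero]
  have e2 : b / δ = b / δ - δ * (4 * w : ℕ) * q / δ + (q : ℤ) • ((4 * w : ℕ) : ℝ) := by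
    rw [zsmul_eq_mul]
    field_simp
    push_cast
    ring
  have hper := periodic_pairSetOne h w y ((a - b) / δ)
  nth_rewrite 2 [e2]
  rw [hper.intervalIntegral_add_zsmul_eq (q : ℤ) _
      (fun t₁ t₂ => intervalIntegrable_pairSetOne h w y _ _ _), hper.intervalIntegral_add_eq _ 0,
    zero_add, integral_period_pairSetOne hh hw, zsmul_eq_mul, smul_eq_mul]
  push_cast
  ring

end OneDim

section Corner

variable {n : ℕ} {X : Type u} [NormedAddCommGroup X] [NormedSpace ℂ X] {p : ℝ≥0∞}

theorem mem_pairSet_iff (h δ : ℝ) (t y : Fin n → ℝ) (x v : EuclideanSpace ℝ (Fin n)) :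
    (x, v) ∈ pairSet h δ t y ↔ ∀ i, ((x i - t i) / δ, (v i - t i) / δ) ∈
      pairSetOne h (pairWidth (roundVec y)) (y i) := by
  simp only [pairSet, sourceSet, targetSet, IsAnchor, pairSetOne, Set.mem_ofPred_eq, funext_iff,
    Pi.add_apply, Pi.sub_apply, cubeIdx, roundVec]
  constructor
  · rintro ⟨⟨h1, h2⟩, ⟨-, h3⟩, h4⟩ i
    exact ⟨h1 i, h2 i, h3 i, h4 i⟩
  · intro H
    refine ⟨⟨fun i => (H i).1, fun i => (H i).2.1⟩, ⟨fun i => ?_, fun i => (H i).2.2.1⟩,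
      fun i => (H i).2.2.2⟩
    rw [(H i).2.2.2, add_sub_cancel_right]
    exact (H i).1

theorem indicator_pairSet_eq (h δ : ℝ) (t y : Fin n → ℝ) (g : EuclideanSpace ℝ (Fin n) → X)
    (x v : EuclideanSpace ℝ (Fin n)) :
    (pairSet h δ t y).indicator (fun z => g z.2) (x, v)
      = (∏ i, (pairSetOne h (pairWidth (roundVec y)) (y i)).indicator (fun _ => (1 : ℝ))
          ((x i - t i) / δ, (v i - t i) / δ)) • g v := by
  by_cases hz : (x, v) ∈ pairSet h δ t y
  · have hz' := (mem_pairSet_iff h δ t y x v).1 hz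
    rw [Set.indicator_of_mem hz, Finset.prod_congr rfl fun i _ => Set.indicator_of_mem (hz' i) _]
    simp
  · have hz' := (mem_pairSet_iff h δ t y x v).not.1 hz
    push Not at hz'
    obtain ⟨i, hi⟩ := hz'
    rw [Set.indicator_of_notMem hz, Finset.prod_eq_zero (Finset.mem_univ i)
      (Set.indicator_of_notMem hi _), zero_smul]

/-- The uniform distribution on the cube `(0, R]ⁿ`, the law of the random corner of the grid. -/
noncomputable def cornerMeasure (n : ℕ) (R : ℝ) : Measure (Fin n → ℝ) :=
  Measure.pi fun _ => (ENNReal.ofReal R)⁻¹ • volume.restrict (Set.Ioc 0 R)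

theorem isProbabilityMeasure_uniform {R : ℝ} (hR : 0 < R) :
    IsProbabilityMeasure ((ENNReal.ofReal R)⁻¹ • volume.restrict (Set.Ioc 0 R)) := by
  constructor
  simp only [Measure.smul_apply, Measure.restrict_apply_univ, Real.volume_Ioc, sub_zero, smul_eq_mul]
  exact ENNReal.inv_mul_cancel (ENNReal.ofReal_pos.2 hR).ne' ENNReal.ofReal_ne_top

theorem isProbabilityMeasure_cornerMeasure (n : ℕ) {R : ℝ} (hR : 0 < R) :
    IsProbabilityMeasure (cornerMeasure n R) := by
  have := isProbabilityMeasure_uniform hR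
  unfold cornerMeasure
  infer_instance

/-- The product of the one-dimensional tent functions of the coordinates. -/
def tentProd (h : ℝ) (v : Fin n → ℝ) : ℝ := ∏ i, tent h (v i)

/-- The convolution with the tent function of width `δ h`, normalized by `δ^{-n}`, followed by the
translation by `δ y`. -/
noncomputable def tentShift (h δ : ℝ) (y : Fin n → ℝ) (g : EuclideanSpace ℝ (Fin n) → X)
    (x : EuclideanSpace ℝ (Fin n)) : X :=
  (δ ^ n)⁻¹ • ∫ v : EuclideanSpace ℝ (Fin n), tentProd h (fun i => (x i - v i) / δ - y i) • g v

theorem integral_cornerMeasure_prod {h : ℝ} (hh : h ≤ 1 / 2) {δ : ℝ} (hδ : 0 < δ) {q : ℕ}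
    (hq : 0 < q) (y : Fin n → ℝ) (x v : EuclideanSpace ℝ (Fin n)) :
    ∫ t, (∏ i, (pairSetOne h (pairWidth (roundVec y)) (y i)).indicator (fun _ => (1 : ℝ))
          ((x i - t i) / δ, (v i - t i) / δ))
        ∂(cornerMeasure n (δ * (4 * pairWidth (roundVec y) : ℕ) * q))
      = (4⁻¹ : ℝ) ^ n * tentProd h (fun i => (x i - v i) / δ - y i) := by
  have hw := pairWidth_pos (roundVec y)
  have hR : 0 < δ * (4 * pairWidth (roundVec y) : ℕ) * q := by positivity
  set R := δ * (4 * pairWidth (roundVec y) : ℕ) * q with hRdef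
  have := isProbabilityMeasure_uniform hR
  rw [cornerMeasure, integral_fintype_prod_eq_prod (𝕜 := ℝ) (fun i s =>
    (pairSetOne h (pairWidth (roundVec y)) (y i)).indicator (fun _ => (1 : ℝ))
      ((x i - s) / δ, (v i - s) / δ)), tentProd, ← Fin.prod_const n, ← Finset.prod_mul_distrib]
  refine Finset.prod_congr rfl fun i _ => ?_
  rw [integral_smul_measure, ← intervalIntegral.integral_of_le hR.le,
    integral_corner_pairSetOne hh (abs_lt_two_mul_pairWidth (roundVec y) i) hδ, ENNReal.toReal_inv,
    ENNReal.toReal_ofReal hR.le, smul_eq_mul, hRdef]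
  have h1 : (pairWidth (roundVec y) : ℝ) ≠ 0 := by exact_mod_cast hw.ne'
  have h2 : (q : ℝ) ≠ 0 := by exact_mod_cast hq.ne'
  push_cast
  field_simp

theorem measurable_prod_pairSetOne (h δ : ℝ) (w : ℕ) (y : Fin n → ℝ) :
    Measurable fun z : ((Fin n → ℝ) × EuclideanSpace ℝ (Fin n)) × EuclideanSpace ℝ (Fin n) =>
      ∏ i, (pairSetOne h w (y i)).indicator (fun _ => (1 : ℝ))
        ((z.1.2 i - z.1.1 i) / δ, (z.2 i - z.1.1 i) / δ) := by
  refine Finset.measurable_prod _ fun i _ => ?_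
  have h1 : Measurable fun z : ((Fin n → ℝ) × EuclideanSpace ℝ (Fin n)) ×
      EuclideanSpace ℝ (Fin n) => ((z.1.2 i - z.1.1 i) / δ, (z.2 i - z.1.1 i) / δ) := by
    have h2 : Measurable fun z : ((Fin n → ℝ) × EuclideanSpace ℝ (Fin n)) ×
      EuclideanSpace ℝ (Fin n) => z.1.1 i := by fun_prop
    have h3 : Measurable fun z : ((Fin n → ℝ) × EuclideanSpace ℝ (Fin n)) ×
      EuclideanSpace ℝ (Fin n) => z.1.2 i := by fun_prop
    have h4 : Measurable fun z : ((Fin n → ℝ) × EuclideanSpace ℝ (Fin n)) ×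
      EuclideanSpace ℝ (Fin n) => z.2 i := by fun_prop
    fun_prop
  exact (measurable_const.indicator (measurableSet_pairSetOne h w (y i))).comp h1

theorem stronglyMeasurable_pairShift_uncurry (h δ : ℝ) (y : Fin n → ℝ)
    {g : EuclideanSpace ℝ (Fin n) → X} (hg : StronglyMeasurable g) :
    StronglyMeasurable fun z : (Fin n → ℝ) × EuclideanSpace ℝ (Fin n) =>
      pairShift h δ z.1 y g z.2 := by
  unfold pairShift
  refine StronglyMeasurable.const_smul ?_ _
  simp only [indicator_pairSet_eq]
  refine StronglyMeasurable.integral_prod_right' (f := fun z : ((Fin n → ℝ) ×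
    EuclideanSpace ℝ (Fin n)) × EuclideanSpace ℝ (Fin n) =>
      (∏ i, (pairSetOne h (pairWidth (roundVec y)) (y i)).indicator (fun _ => (1 : ℝ))
        ((z.1.2 i - z.1.1 i) / δ, (z.2 i - z.1.1 i) / δ)) • g z.2) ?_
  exact (measurable_prod_pairSetOne h δ _ y).stronglyMeasurable.smul (hg.comp_measurable measurable_snd)

theorem integrable_pairSet_prod {h δ : ℝ} (hδ : 0 < δ) (y : Fin n → ℝ) (ν : Measure (Fin n → ℝ))
    [IsFiniteMeasure ν] {g : EuclideanSpace ℝ (Fin n) → X} (hg : LocallyIntegrable g volume)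
    (x : EuclideanSpace ℝ (Fin n)) :
    Integrable (fun z : (Fin n → ℝ) × EuclideanSpace ℝ (Fin n) =>
      (∏ i, (pairSetOne h (pairWidth (roundVec y)) (y i)).indicator (fun _ => (1 : ℝ))
        ((x i - z.1 i) / δ, (z.2 i - z.1 i) / δ)) • g z.2) (ν.prod volume) := by
  -- the cubes of `v` and `x` differ by `roundVec y`, so that `v` stays in a bounded set
  set B : Set (EuclideanSpace ℝ (Fin n)) := WithLp.ofLp ⁻¹' Set.Icc
    (fun i => x i - δ * (round (y i) + 1)) (fun i => x i - δ * (round (y i) - 1)) with hB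
  have hBc : IsCompact B := by
    have : B = WithLp.toLp 2 '' Set.Icc
        (fun i => x i - δ * (round (y i) + 1)) (fun i => x i - δ * (round (y i) - 1)) := by
      ext v
      simp only [hB, Set.mem_preimage, Set.mem_image]
      exact ⟨fun hv => ⟨_, hv, rfl⟩, by rintro ⟨u, hu, rfl⟩; exact hu⟩
    rw [this]
    exact isCompact_Icc.image (PiLp.continuous_toLp 2 _)
  have hBm : MeasurableSet B := hBc.measurableSet
  have h1 : Integrable (fun z : (Fin n → ℝ) × EuclideanSpace ℝ (Fin n) => B.indicator g z.2)
      (ν.prod volume) :=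
    Integrable.comp_snd ((hg.integrableOn_isCompact hBc).integrable_indicator hBm) ν
  have hle : ∀ z : (Fin n → ℝ) × EuclideanSpace ℝ (Fin n),
      (∏ i, (pairSetOne h (pairWidth (roundVec y)) (y i)).indicator (fun _ => (1 : ℝ))
        ((x i - z.1 i) / δ, (z.2 i - z.1 i) / δ)) • g z.2
      = (∏ i, (pairSetOne h (pairWidth (roundVec y)) (y i)).indicator (fun _ => (1 : ℝ))
        ((x i - z.1 i) / δ, (z.2 i - z.1 i) / δ)) • B.indicator g z.2 := by
    intro z
    by_cases hz : z.2 ∈ B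
    · rw [Set.indicator_of_mem hz]
    · have : ∃ i, ((x i - z.1 i) / δ, (z.2 i - z.1 i) / δ) ∉
          pairSetOne h (pairWidth (roundVec y)) (y i) := by
        by_contra! hc
        refine hz ⟨fun i => ?_, fun i => ?_⟩
        all_goals
          have h2 := (hc i).2.2.2
          simp only at h2
          have h3 := Int.floor_le ((x i - z.1 i) / δ)
          have h4 := Int.lt_floor_add_one ((x i - z.1 i) / δ)
          have h5 := Int.floor_le ((z.2 i - z.1 i) / δ)
          have h6 := Int.lt_floor_add_one ((z.2 i - z.1 i) / δ)
          rw [h2] at h3 h4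
          push_cast at h3 h4
          rw [le_div_iff₀ hδ] at h3 h5
          rw [div_lt_iff₀ hδ] at h4 h6
          nlinarith
      obtain ⟨i, hi⟩ := this
      rw [Finset.prod_eq_zero (Finset.mem_univ i) (Set.indicator_of_notMem hi _), zero_smul,
        zero_smul]
  simp only [hle]
  refine h1.bdd_smul (φ := fun z : (Fin n → ℝ) × EuclideanSpace ℝ (Fin n) =>
    ∏ i, (pairSetOne h (pairWidth (roundVec y)) (y i)).indicator (fun _ => (1 : ℝ))
        ((x i - z.1 i) / δ, (z.2 i - z.1 i) / δ)) 1 ?_ (Eventually.of_forall fun z => ?_)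
  · have h2 := (measurable_prod_pairSetOne h δ (pairWidth (roundVec y)) y).comp
      (f := fun z : (Fin n → ℝ) × EuclideanSpace ℝ (Fin n) => ((z.1, x), z.2)) (by fun_prop)
    exact h2.aestronglyMeasurable
  · rw [Real.norm_eq_abs, Finset.abs_prod]
    refine Finset.prod_le_one (fun _ _ => abs_nonneg _) fun i _ => ?_
    by_cases hz : ((x i - z.1 i) / δ, (z.2 i - z.1 i) / δ) ∈
      pairSetOne h (pairWidth (roundVec y)) (y i) <;> simp [hz]

/-- A translated tent convolution is the average of translated averages over the random grid. -/
theorem integral_cornerMeasure_pairShift [CompleteSpace X] {h : ℝ} (hh : h ≤ 1 / 2) {δ : ℝ}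
    (hδ : 0 < δ) {q : ℕ} (hq : 0 < q) (y : Fin n → ℝ) {g : EuclideanSpace ℝ (Fin n) → X}
    (hg : LocallyIntegrable g volume) (x : EuclideanSpace ℝ (Fin n)) :
    Integrable (fun t => pairShift h δ t y g x)
      (cornerMeasure n (δ * (4 * pairWidth (roundVec y) : ℕ) * q)) ∧
    ∫ t, pairShift h δ t y g x ∂(cornerMeasure n (δ * (4 * pairWidth (roundVec y) : ℕ) * q))
      = (4⁻¹ : ℝ) ^ n • tentShift h δ y g x := by
  have hw := pairWidth_pos (roundVec y)
  have hR : 0 < δ * (4 * pairWidth (roundVec y) : ℕ) * q := by positivity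
  have := isProbabilityMeasure_cornerMeasure n hR
  have hint := integrable_pairSet_prod (h := h) hδ y
    (cornerMeasure n (δ * (4 * pairWidth (roundVec y) : ℕ) * q)) hg x
  unfold pairShift
  simp only [indicator_pairSet_eq]
  refine ⟨hint.integral_prod_left.smul _, ?_⟩
  have e1 : ∫ v : EuclideanSpace ℝ (Fin n), ∫ t, (∏ i, (pairSetOne h (pairWidth (roundVec y))
        (y i)).indicator (fun _ => (1 : ℝ)) ((x i - t i) / δ, (v i - t i) / δ)) • g v
          ∂(cornerMeasure n (δ * (4 * pairWidth (roundVec y) : ℕ) * q))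
      = (4⁻¹ : ℝ) ^ n • ∫ v : EuclideanSpace ℝ (Fin n),
          tentProd h (fun i => (x i - v i) / δ - y i) • g v := by
    rw [← integral_smul]
    refine integral_congr_ae (Eventually.of_forall fun v => ?_)
    simp only
    rw [integral_smul_const, integral_cornerMeasure_prod hh hδ hq, mul_smul]
  rw [integral_smul, integral_integral_swap hint, e1, tentShift, smul_comm]

end Corner

/-! ### Minkowski's integral inequality -/

section Minkowski

variable {U T : Type*} [MeasurableSpace U] [MeasurableSpace T] {X : Type*} [NormedAddCommGroup X]
  [NormedSpace ℝ X] {p : ℝ≥0∞}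

theorem lintegral_rpow_le_weighted {q : ℝ} (hq : 1 < q) {ν : Measure U} {φ w : U → ℝ≥0∞}
    (hφ : AEMeasurable φ ν) (hw : AEMeasurable w ν) (hw0 : ∀ u, w u ≠ 0) (hwt : ∀ u, w u ≠ ⊤) :
    (∫⁻ u, φ u ∂ν) ^ q ≤ (∫⁻ u, w u ∂ν) ^ (q - 1) * ∫⁻ u, φ u ^ q * w u ^ (1 - q) ∂ν := by
  have hq0 : 0 < q := by linarith
  have hconj : q.HolderConjugate (q / (q - 1)) := Real.HolderConjugate.conjExponent hq
  have e1 : ∀ u, φ u = (φ u * w u ^ ((1 - q) / q)) * w u ^ ((q - 1) / q) := by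
    intro u
    rw [mul_assoc, ← ENNReal.rpow_add _ _ (hw0 u) (hwt u), ← add_div]
    simp
  have h1 := ENNReal.lintegral_mul_le_Lp_mul_Lq ν hconj
    (f := fun u => φ u * w u ^ ((1 - q) / q)) (g := fun u => w u ^ ((q - 1) / q))
    (hφ.mul (hw.pow_const _)) (hw.pow_const _)
  have e2 : ∀ u, (φ u * w u ^ ((1 - q) / q)) ^ q = φ u ^ q * w u ^ (1 - q) := by
    intro u
    rw [ENNReal.mul_rpow_of_nonneg _ _ hq0.le, ← ENNReal.rpow_mul, div_mul_cancel₀ _ hq0.ne']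
  have e3 : ∀ u, (w u ^ ((q - 1) / q)) ^ (q / (q - 1)) = w u := by
    intro u
    have : q - 1 ≠ 0 := by linarith
    rw [← ENNReal.rpow_mul, div_mul_div_cancel₀ hq0.ne', div_self this, ENNReal.rpow_one]
  have e4 : (∫⁻ u, φ u ∂ν) = ∫⁻ u, ((fun u => φ u * w u ^ ((1 - q) / q)) *
      fun u => w u ^ ((q - 1) / q)) u ∂ν := lintegral_congr e1
  rw [← e4] at h1
  simp only [e2, e3] at h1
  calc (∫⁻ u, φ u ∂ν) ^ q ≤ _ := ENNReal.rpow_le_rpow h1 hq0.le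
    _ = _ := by
      rw [ENNReal.mul_rpow_of_nonneg _ _ hq0.le, ← ENNReal.rpow_mul, ← ENNReal.rpow_mul,
        one_div_mul_cancel hq0.ne', ENNReal.rpow_one, mul_comm]
      congr 2
      field_simp

/-- Minkowski's integral inequality, with a majorant `w` of the norms. -/
theorem eLpNorm_integral_le (hp : 1 < p) (hp' : p ≠ ⊤) {ν : Measure U} [SigmaFinite ν]
    {ρ : Measure T} [SFinite ρ] {Φ : U → T → X}
    (hΦ : AEStronglyMeasurable (Function.uncurry Φ) (ν.prod ρ)) {w : U → ℝ≥0∞} (hw : Measurable w)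
    (hwt : ∀ u, w u ≠ ⊤) (hle : ∀ u, eLpNorm (Φ u) p ρ ≤ w u) :
    eLpNorm (fun x => ∫ u, Φ u x ∂ν) p ρ ≤ ∫⁻ u, w u ∂ν := by
  have hp0 : p ≠ 0 := (zero_lt_one.trans hp).ne'
  have hpos := ENNReal.toReal_pos hp0 hp'
  have hq : 1 < p.toReal := by simpa using (ENNReal.toReal_lt_toReal ENNReal.one_ne_top hp').2 hp
  -- the weight is made positive by adding a small positive function
  refine ENNReal.le_of_forall_pos_le_add fun ε hε _ => ?_
  obtain ⟨k, hk0, hkm, hkε⟩ := exists_pos_lintegral_lt_of_sigmaFinite ν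
    (ε := (ε : ℝ≥0∞)) (by exact_mod_cast hε.ne')
  set w' : U → ℝ≥0∞ := fun u => w u + k u with hw'
  have hw'm : Measurable w' := hw.add hkm.coe_nnreal_ennreal
  have hw'0 : ∀ u, w' u ≠ 0 := fun u => by
    simp only [hw', ne_eq, add_eq_zero, not_and, ENNReal.coe_eq_zero]
    exact fun _ => (hk0 u).ne'
  have hw't : ∀ u, w' u ≠ ⊤ := fun u => ENNReal.add_ne_top.2 ⟨hwt u, ENNReal.coe_ne_top⟩
  have hW : ∫⁻ u, w' u ∂ν ≤ ∫⁻ u, w u ∂ν + ε := by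
    rw [lintegral_add_left hw]
    gcongr
  refine le_trans ?_ hW
  have hφ : AEMeasurable (fun z : U × T => ‖Φ z.1 z.2‖ₑ) (ν.prod ρ) := hΦ.enorm
  have hsec : ∀ᵐ x ∂ρ, AEMeasurable (fun u => ‖Φ u x‖ₑ) ν := by
    have := hΦ.prod_swap.prodMk_left
    filter_upwards [this] with x hx
    exact hx.enorm
  rw [← ENNReal.rpow_le_rpow_iff hpos]
  calc eLpNorm (fun x => ∫ u, Φ u x ∂ν) p ρ ^ p.toReal
      = ∫⁻ x, ‖∫ u, Φ u x ∂ν‖ₑ ^ p.toReal ∂ρ := by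
        rw [eLpNorm_eq_lintegral_rpow_enorm_toReal hp0 hp', ← ENNReal.rpow_mul,
          one_div_mul_cancel hpos.ne', ENNReal.rpow_one]
    _ ≤ ∫⁻ x, (∫⁻ u, w' u ∂ν) ^ (p.toReal - 1) *
          ∫⁻ u, ‖Φ u x‖ₑ ^ p.toReal * w' u ^ (1 - p.toReal) ∂ν ∂ρ := by
        refine lintegral_mono_ae ?_
        filter_upwards [hsec] with x hx
        exact (ENNReal.rpow_le_rpow (enorm_integral_le_lintegral_enorm _) hpos.le).trans
          (lintegral_rpow_le_weighted hq hx hw'm.aemeasurable hw'0 hw't)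
    _ = (∫⁻ u, w' u ∂ν) ^ (p.toReal - 1) *
          ∫⁻ u, ∫⁻ x, ‖Φ u x‖ₑ ^ p.toReal * w' u ^ (1 - p.toReal) ∂ρ ∂ν := by
        have hm : AEMeasurable (fun z : U × T => ‖Φ z.1 z.2‖ₑ ^ p.toReal *
            w' z.1 ^ (1 - p.toReal)) (ν.prod ρ) :=
          (hφ.pow_const _).mul ((hw'm.comp measurable_fst).pow_const _).aemeasurable
        rw [lintegral_const_mul'' _ hm.lintegral_prod_left',
          ← lintegral_lintegral_swap (f := fun u x => ‖Φ u x‖ₑ ^ p.toReal * w' u ^ (1 - p.toReal)) hm]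
    _ ≤ (∫⁻ u, w' u ∂ν) ^ (p.toReal - 1) * ∫⁻ u, w' u ∂ν := by
        gcongr with u
        rw [lintegral_mul_const' _ _ (ENNReal.rpow_ne_top_of_ne_zero (hw'0 u) (hw't u))]
        have h1 : ∫⁻ x, ‖Φ u x‖ₑ ^ p.toReal ∂ρ ≤ w' u ^ p.toReal := by
          have h2 : eLpNorm (Φ u) p ρ ≤ w' u := (hle u).trans le_self_add
          rw [eLpNorm_eq_lintegral_rpow_enorm_toReal hp0 hp'] at h2
          have h3 := ENNReal.rpow_le_rpow h2 hpos.le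
          rwa [← ENNReal.rpow_mul, one_div_mul_cancel hpos.ne', ENNReal.rpow_one] at h3
        calc _ ≤ w' u ^ p.toReal * w' u ^ (1 - p.toReal) := by gcongr
          _ = w' u := by
            rw [← ENNReal.rpow_add _ _ (hw'0 u) (hw't u)]
            simp
    _ = (∫⁻ u, w' u ∂ν) ^ p.toReal := by
        rw [mul_comm, ← ENNReal.rpow_one (∫⁻ u, w' u ∂ν), ← ENNReal.rpow_mul,
          ← ENNReal.rpow_mul, ← ENNReal.rpow_add_of_nonneg _ _ (by norm_num) (by linarith)]
        congr 1
        ring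

end Minkowski

/-! ### Random translates of tent convolutions -/

section TentShift

variable {n : ℕ} {X : Type u} [NormedAddCommGroup X] [NormedSpace ℂ X] [CompleteSpace X] {p : ℝ≥0∞}

theorem radNorm_tentShift_le (hp : 1 < p) (hp' : p ≠ ⊤) (hβ : umdConst p X ≠ ⊤) {h : ℝ}
    (hh : h ≤ 1 / 2) (y : ℤ → Fin n → ℝ) {M : ℕ} (hM : 0 < M)
    (hyM : ∀ j, 4 * pairWidth (roundVec (y j)) ∣ 2 ^ M) (K : ℤ) (N : ℕ)
    {g : ℕ → EuclideanSpace ℝ (Fin n) → X} (hgm : ∀ l, StronglyMeasurable (g l))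
    (hg : ∀ l, MemLp (g l) p volume) :
    radNorm N p volume (fun l : ℕ => tentShift h (2 ^ (K - (l : ℤ))) (y (K - (l : ℤ))) (g l))
      ≤ 4 ^ n * (M * (2 * (1 + umdConst p X) * radNorm N p volume g)) := by
  set W : ℝ≥0∞ := M * (2 * (1 + umdConst p X) * radNorm N p volume g) with hW
  have hWt : W ≠ ⊤ := by
    have := (radNorm_lt_top (N := N) hg).ne
    finiteness
  have hR : (0 : ℝ) < 2 ^ (K + M) := by positivity
  have := isProbabilityMeasure_cornerMeasure n hR
  -- the same random corner serves all scales
  have key : ∀ (l : ℕ) x, Integrable (fun t => pairShift h (2 ^ (K - (l : ℤ))) t (y (K - (l : ℤ))) (g l) x)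
        (cornerMeasure n (2 ^ (K + M))) ∧
      ∫ t, pairShift h (2 ^ (K - (l : ℤ))) t (y (K - (l : ℤ))) (g l) x
        ∂(cornerMeasure n (2 ^ (K + M)))
        = (4⁻¹ : ℝ) ^ n • tentShift h (2 ^ (K - (l : ℤ))) (y (K - (l : ℤ))) (g l) x := by
    intro l x
    obtain ⟨q, hq⟩ := hyM (K - (l : ℤ))
    have hq0 : 0 < q := Nat.pos_of_ne_zero fun hq0 => by simp [hq0] at hq
    have e : (2 : ℝ) ^ (K - (l : ℤ)) * (4 * pairWidth (roundVec (y (K - (l : ℤ)))) : ℕ)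
        * (q * 2 ^ l : ℕ) = 2 ^ (K + M) := by
      have h1 : ((4 * pairWidth (roundVec (y (K - (l : ℤ)))) : ℕ) : ℝ) * (q : ℝ) = 2 ^ M := by
        exact_mod_cast hq.symm
      have h2 : (2 : ℝ) ^ (K - (l : ℤ)) * 2 ^ l = 2 ^ K := by
        rw [← zpow_natCast, ← zpow_add₀ two_ne_zero]; congr 1; ring
      rw [zpow_add₀ two_ne_zero, zpow_natCast, ← h1, ← h2]
      push_cast; ring
    rw [← e]
    exact integral_cornerMeasure_pairShift hh (by positivity) (by positivity) _
      ((hg l).locallyIntegrable hp.le) x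
  have hΦm : StronglyMeasurable (Function.uncurry fun (t : Fin n → ℝ)
      (z : (Fin N → Bool) × EuclideanSpace ℝ (Fin n)) => ∑ l ∈ Finset.range N,
        cubeSign N l z.1 • pairShift h (2 ^ (K - (l : ℤ))) t (y (K - (l : ℤ))) (g l) z.2) := by
    simp only [Function.uncurry_def]
    refine Finset.stronglyMeasurable_fun_sum _ fun l _ => ?_
    have h1 : StronglyMeasurable fun z : (Fin n → ℝ) × (Fin N → Bool) × EuclideanSpace ℝ (Fin n) =>
        cubeSign N l z.2.1 :=
      ((measurable_of_finite (cubeSign N l)).comp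
        (measurable_fst.comp measurable_snd)).stronglyMeasurable
    have h2 : Measurable fun z : (Fin n → ℝ) × (Fin N → Bool) × EuclideanSpace ℝ (Fin n) =>
        (z.1, z.2.2) := by fun_prop
    have h3 := (stronglyMeasurable_pairShift_uncurry h (2 ^ (K - (l : ℤ))) (y (K - (l : ℤ)))
      (hgm l)).comp_measurable h2
    exact h1.smul h3
  have h1 := eLpNorm_integral_le hp hp' (ν := cornerMeasure n (2 ^ (K + M)))
    (ρ := (Measure.count.prod volume : Measure ((Fin N → Bool) × EuclideanSpace ℝ (Fin n))))
    hΦm.aestronglyMeasurable (measurable_const (a := W)) (fun _ => hWt)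
    (fun t => radNorm_pairShift_le hp.le hp' hβ h t y hM hyM K N hg)
  have e1 : (fun z : (Fin N → Bool) × EuclideanSpace ℝ (Fin n) => ∑ l ∈ Finset.range N,
      cubeSign N l z.1 • tentShift h (2 ^ (K - (l : ℤ))) (y (K - (l : ℤ))) (g l) z.2)
      = (4 : ℝ) ^ n • fun z => ∫ t, ∑ l ∈ Finset.range N, cubeSign N l z.1 •
          pairShift h (2 ^ (K - (l : ℤ))) t (y (K - (l : ℤ))) (g l) z.2
            ∂(cornerMeasure n (2 ^ (K + M))) := by
    funext z
    have hint : ∀ l ∈ Finset.range N, Integrable (fun t => cubeSign N l z.1 •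
        pairShift h (2 ^ (K - (l : ℤ))) t (y (K - (l : ℤ))) (g l) z.2)
          (cornerMeasure n (2 ^ (K + M))) := fun l _ => (key l z.2).1.smul (cubeSign N l z.1)
    rw [Pi.smul_apply, integral_finsetSum _ hint, Finset.smul_sum]
    refine Finset.sum_congr rfl fun l _ => ?_
    rw [integral_smul, (key l z.2).2, smul_comm ((4 : ℝ) ^ n), smul_smul ((4 : ℝ) ^ n), ← mul_pow]
    norm_num
  rw [radNorm, e1, eLpNorm_const_smul]
  rw [lintegral_const, measure_univ, mul_one] at h1
  have e2 : ‖(4 : ℝ) ^ n‖ₑ = 4 ^ n := by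
    rw [enorm_pow]; congr 1
    rw [Real.enorm_eq_ofReal (by norm_num)]; norm_num
  rw [e2]
  gcongr

/-- The period of the pairing grows only logarithmically with the translation. -/
theorem pairWidth_roundVec_dvd {r : ℝ} {v : Fin n → ℝ} (hv : ∀ i, |v i| ≤ r) :
    4 * pairWidth (roundVec v) ∣ 2 ^ (2 + Nat.log 2 ⌊r + 1⌋₊) := by
  rw [pow_add, pairWidth]
  refine mul_dvd_mul (by norm_num) (pow_dvd_pow _ (Nat.log_mono_right (Finset.sup_le fun i _ => ?_)))
  refine Nat.le_floor ?_
  have h1 := abs_sub_round (v i)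
  have h2 : ((roundVec v i).natAbs : ℝ) = |(round (v i) : ℝ)| := by
    rw [Nat.cast_natAbs]; simp [roundVec]
  rw [h2]
  have h3 := abs_sub_abs_le_abs_sub (round (v i) : ℝ) (v i)
  rw [abs_sub_comm] at h3
  linarith [hv i]

theorem two_add_log_floor_le {Λ s : ℝ} (hΛ : 0 ≤ Λ) (hs : 0 ≤ s) :
    ((2 + Nat.log 2 ⌊Real.exp Λ + s + 1⌋₊ : ℕ) : ℝ) ≤ 4 * (1 + s) * (1 + Λ) := by
  have h0 : (0 : ℝ) < Real.exp Λ + s + 1 := by positivity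
  have h1 : (Nat.log 2 ⌊Real.exp Λ + s + 1⌋₊ : ℝ) * Real.log 2 ≤ Real.log (Real.exp Λ + s + 1) := by
    have hf : ⌊Real.exp Λ + s + 1⌋₊ ≠ 0 := by
      rw [← Nat.pos_iff_ne_zero, Nat.floor_pos]
      linarith [Real.exp_pos Λ]
    have h2 : ((2 ^ Nat.log 2 ⌊Real.exp Λ + s + 1⌋₊ : ℕ) : ℝ) ≤ Real.exp Λ + s + 1 :=
      (Nat.cast_le.2 (Nat.pow_log_le_self 2 hf)).trans (Nat.floor_le h0.le)
    rw [← Real.log_pow]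
    refine Real.log_le_log (by positivity) ?_
    exact_mod_cast h2
  have h3 : Real.log (Real.exp Λ + s + 1) ≤ Real.log 2 + Λ + s := by
    have h4 : Real.exp Λ + s + 1 ≤ 2 * Real.exp Λ * (1 + s) := by
      nlinarith [Real.one_le_exp hΛ, Real.exp_pos Λ]
    calc _ ≤ Real.log (2 * Real.exp Λ * (1 + s)) := Real.log_le_log h0 h4
      _ = Real.log 2 + Λ + Real.log (1 + s) := by
        rw [Real.log_mul (by positivity) (by positivity), Real.log_mul (by positivity)
          (by positivity), Real.log_exp]
      _ ≤ _ := by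
        have := Real.log_le_sub_one_of_pos (x := 1 + s) (by positivity)
        linarith
  have h5 := Real.log_two_gt_d9
  push_cast
  have h6 : (Nat.log 2 ⌊Real.exp Λ + s + 1⌋₊ : ℝ) ≤ 1 + 2 * Λ + 2 * s := by
    by_contra! hc
    nlinarith
  nlinarith [mul_nonneg hs hΛ]

/-- The random translate bound for the vectors `y j + u`, when the `y j` have size at most
`exp Λ`. -/
theorem radNorm_tentShift_add_le (hp : 1 < p) (hp' : p ≠ ⊤) (hβ : umdConst p X ≠ ⊤) {h : ℝ}
    (hh : h ≤ 1 / 2) {y : ℤ → EuclideanSpace ℝ (Fin n)} {Λ : ℝ} (hΛ : 0 ≤ Λ)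
    (hy : ∀ j, ‖y j‖ ≤ Real.exp Λ) (u : EuclideanSpace ℝ (Fin n)) (K : ℤ) (N : ℕ)
    {g : ℕ → EuclideanSpace ℝ (Fin n) → X} (hgm : ∀ l, StronglyMeasurable (g l))
    (hg : ∀ l, MemLp (g l) p volume) :
    radNorm N p volume
        (fun l : ℕ => tentShift h (2 ^ (K - (l : ℤ))) (fun i => y (K - (l : ℤ)) i + u i) (g l))
      ≤ ENNReal.ofReal (1 + ‖u‖) *
        (8 * 4 ^ n * ENNReal.ofReal (1 + Λ) * (1 + umdConst p X) * radNorm N p volume g) := by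
  have h1 : ∀ j, 4 * pairWidth (roundVec fun i => y j i + u i)
      ∣ 2 ^ (2 + Nat.log 2 ⌊Real.exp Λ + ‖u‖ + 1⌋₊) := fun j => by
    refine pairWidth_roundVec_dvd fun i => ?_
    refine (PiLp.norm_apply_le (y j + u) i).trans ((norm_add_le _ _).trans ?_)
    linarith [hy j]
  refine (radNorm_tentShift_le hp hp' hβ hh (fun j i => y j i + u i)
    (M := 2 + Nat.log 2 ⌊Real.exp Λ + ‖u‖ + 1⌋₊) (by positivity) h1 K N hgm hg).trans ?_
  have h2 : ((2 + Nat.log 2 ⌊Real.exp Λ + ‖u‖ + 1⌋₊ : ℕ) : ℝ≥0∞)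
      ≤ 4 * ENNReal.ofReal (1 + ‖u‖) * ENNReal.ofReal (1 + Λ) := by
    rw [← ENNReal.ofReal_natCast]
    refine (ENNReal.ofReal_le_ofReal (two_add_log_floor_le hΛ (norm_nonneg u))).trans ?_
    rw [ENNReal.ofReal_mul (by positivity), ENNReal.ofReal_mul (by norm_num)]
    norm_num
  calc _ ≤ 4 ^ n * (4 * ENNReal.ofReal (1 + ‖u‖) * ENNReal.ofReal (1 + Λ) *
        (2 * (1 + umdConst p X) * radNorm N p volume g)) := by gcongr
    _ = _ := by ring

end TentShift

/-! ### Test functions off the support of a distribution -/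

section Vanishing

variable {E : Type*} [NormedAddCommGroup E] [NormedSpace ℝ E] [FiniteDimensional ℝ E]
  {X : Type*} [NormedAddCommGroup X] [NormedSpace ℂ X]

open scoped Manifold ContDiff in
/-- Smooth functions that sum to `1` on a compact set, subordinate to a finite open cover. -/
theorem exists_smooth_partition {K : Set E} (hK : IsClosed K) {ι : Type*} [Fintype ι]
    (U : ι → Set E) (hUo : ∀ i, IsOpen (U i)) (hU : K ⊆ ⋃ i, U i) :
    ∃ φ : ι → E → ℝ, (∀ i, ContDiff ℝ ∞ (φ i)) ∧ (∀ i, tsupport (φ i) ⊆ U i) ∧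
      ∀ x ∈ K, ∑ i, φ i x = 1 := by
  obtain ⟨φ, hφ⟩ := SmoothPartitionOfUnity.exists_isSubordinate 𝓘(ℝ, E) hK U hUo hU
  refine ⟨fun i => φ i, fun i => (φ i).contMDiff.contDiff, hφ, fun x hx => ?_⟩
  have := φ.sum_eq_one hx
  rwa [finsum_eq_sum_of_fintype] at this

open scoped ContDiff in
/-- A tempered distribution annihilates the compactly supported test functions whose support does
not meet its own: a partition of unity reduces this to functions with small support. -/
theorem apply_eq_zero_of_disjoint_dsupport (T : 𝓢'(E, X)) (u : 𝓢(E, ℂ))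
    (hu : HasCompactSupport u) (hd : Disjoint (tsupport u) (Distribution.dsupport T)) :
    T u = 0 := by
  have h1 : ∀ x : tsupport u, ∃ s : Set E, Distribution.IsVanishingOn T s ∧ IsOpen s ∧ (x : E) ∈ s :=
    fun x => (Distribution.notMem_dsupport_iff _).1 (Set.disjoint_left.1 hd x.2)
  choose U hU hUo hxU using h1
  obtain ⟨t, ht⟩ := (show IsCompact (tsupport u) from hu).elim_finite_subcover U hUo
    fun x hx => Set.mem_iUnion.2 ⟨⟨x, hx⟩, hxU ⟨x, hx⟩⟩
  obtain ⟨φ, hφs, hφ, hφ1⟩ := exists_smooth_partition (isClosed_tsupport u)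
    (fun i : t => U i) (fun i => hUo i) fun x hx => by
      obtain ⟨i, hi, hxi⟩ := Set.mem_iUnion₂.1 (ht hx)
      exact Set.mem_iUnion.2 ⟨⟨i, hi⟩, hxi⟩
  have hc : ∀ i, HasCompactSupport (fun x => φ i x • u x) := fun i =>
    hu.mono fun x hx h => hx (by simp [h])
  have hd' : ∀ i, ContDiff ℝ ∞ (fun x => φ i x • u x) := fun i => (hφs i).smul (u.smooth _)
  have hsum : u = ∑ i, (hc i).toSchwartzMap (hd' i) := by
    ext x
    rw [sum_apply]
    simp only [HasCompactSupport.toSchwartzMap_toFun]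
    rw [← Finset.sum_smul]
    by_cases hx : x ∈ tsupport u
    · rw [hφ1 x hx, one_smul]
    · rw [image_eq_zero_of_notMem_tsupport hx, smul_zero]
  rw [hsum, map_sum]
  refine Finset.sum_eq_zero fun i _ => hU i _ ?_
  refine Set.Subset.trans ?_ (hφ i)
  exact closure_mono (Function.support_smul_subset_left (φ i) u)

end Vanishing

/-! ### Fourier transforms without zeros near the origin -/

section Positivity

variable {E : Type*} [NormedAddCommGroup E] [InnerProductSpace ℝ E] [FiniteDimensional ℝ E]
  [MeasurableSpace E] [BorelSpace E]

theorem fourier_ne_zero_of_nonneg {F : E → ℝ} (hF : Integrable F) (hF0 : ∀ v, 0 ≤ F v)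
    (hpos : 0 < ∫ v, F v) {ξ : E} (hξ : ∀ v, F v ≠ 0 → |inner ℝ v ξ| ≤ 1 / 8) :
    𝓕 (fun v => (F v : ℂ)) ξ ≠ 0 := by
  have h1 : Integrable (fun v => Real.fourierChar (-inner ℝ v ξ) • (F v : ℂ)) :=
    (Real.fourierIntegral_convergent_iff ξ).2 hF.ofReal
  have h2 : ∫ v, F v * 2⁻¹ ≤ (𝓕 (fun v => (F v : ℂ)) ξ).re := by
    rw [Real.fourier_eq, ← Complex.reCLM_apply, ← Complex.reCLM.integral_comp_comm h1]
    refine integral_mono (hF.mul_const _) (Complex.reCLM.integrable_comp h1) fun v => ?_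
    have e : Complex.reCLM (Real.fourierChar (-inner ℝ v ξ) • (F v : ℂ))
        = F v * Real.cos (2 * Real.pi * -inner ℝ v ξ) := by
      rw [Complex.reCLM_apply, Circle.smul_def, Real.fourierChar_apply, smul_eq_mul,
        Complex.re_mul_ofReal, Complex.exp_ofReal_mul_I_re, mul_comm]
    simp only [e]
    by_cases hv : F v = 0
    · simp [hv]
    · refine mul_le_mul_of_nonneg_left ?_ (hF0 v)
      have h3 := Real.one_sub_sq_div_two_le_cos (x := 2 * Real.pi * -inner ℝ v ξ)
      have h4 : |2 * Real.pi * -inner ℝ v ξ| ≤ 4 / 5 := by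
        rw [abs_mul, abs_mul, abs_of_pos Real.pi_pos, abs_neg]
        have := Real.pi_lt_d2
        have h5 := hξ v hv
        norm_num
        nlinarith [abs_nonneg (inner ℝ v ξ), Real.pi_pos]
      have h6 := sq_le_sq' (by linarith [(abs_le.1 h4).1]) (abs_le.1 h4).2
      linarith
  intro h3
  rw [h3, integral_mul_const] at h2
  simp only [Complex.zero_re] at h2
  linarith

end Positivity

/-! ### Uniqueness for the Fourier transform -/

section Uniqueness

variable {E : Type*} [NormedAddCommGroup E] [InnerProductSpace ℝ E] [FiniteDimensional ℝ E]
  [MeasurableSpace E] [BorelSpace E] {X : Type*} [NormedAddCommGroup X] [NormedSpace ℂ X]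
  [CompleteSpace X]

theorem integral_fourier_smul_eq_flip {f : E → ℂ} {g : E → X} (hf : Integrable f)
    (hg : Integrable g) : ∫ ξ, 𝓕 f ξ • g ξ = ∫ x, f x • 𝓕 g x := by
  simpa using! VectorFourier.integral_fourierIntegral_smul_eq_flip (L := innerₗ E)
    Real.continuous_fourierChar continuous_inner hf hg

theorem fourier_comp_add_right (f : E → X) (v₀ ξ : E) :
    𝓕 (fun v => f (v + v₀)) ξ = Real.fourierChar (inner ℝ v₀ ξ) • 𝓕 f ξ :=
  congrFun (VectorFourier.fourierIntegral_comp_add_right Real.fourierChar volume (innerₗ E) f v₀) ξ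

open scoped ContDiff in
/-- The smooth compactly supported complex functions, as Schwartz functions. -/
theorem exists_schwartz_eq {g : E → ℝ} (hg : ContDiff ℝ ∞ g) (hc : HasCompactSupport g) :
    ∃ φ : 𝓢(E, ℂ), (∀ x, φ x = (g x : ℂ)) ∧ HasCompactSupport φ := by
  have h1 : HasCompactSupport fun x => (g x : ℂ) := hc.mono fun x hx h => hx (by simp [h])
  have h2 : ContDiff ℝ ∞ fun x => (g x : ℂ) := Complex.ofRealCLM.contDiff.comp hg
  exact ⟨h1.toSchwartzMap h2, fun x => rfl, h1⟩

open scoped ContDiff in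
theorem ae_eq_zero_of_fourier_eq_zero {H : E → X} (hH : Integrable H) (h0 : ∀ ξ, 𝓕 H ξ = 0) :
    ∀ᵐ x, H x = 0 := by
  refine ae_eq_zero_of_integral_contDiff_smul_eq_zero hH.locallyIntegrable fun g hg hc => ?_
  obtain ⟨φ, hφ, -⟩ := exists_schwartz_eq hg hc
  have h1 := integral_fourier_smul_eq_flip (𝓕⁻ φ).integrable hH
  rw [← SchwartzMap.fourier_coe, FourierTransform.fourier_fourierInv_eq] at h1
  simp only [h0, smul_zero, integral_zero, hφ] at h1
  exact h1

/-- A function that is annihilated by the Fourier transforms of all compactly supported test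
functions vanishes. Multiplication by the Fourier transform of a bump function, which has no zeros
on a large ball, reduces this to integrable functions. -/
theorem ae_eq_zero_of_forall_integral_fourier_smul_eq_zero {F : E → X}
    (hi : ∀ η : 𝓢(E, ℂ), HasCompactSupport η → Integrable fun x => 𝓕 (η : E → ℂ) x • F x)
    (h0 : ∀ η : 𝓢(E, ℂ), HasCompactSupport η → ∫ x, 𝓕 (η : E → ℂ) x • F x = 0) :
    ∀ᵐ x, F x = 0 := by
  have key : ∀ k : ℕ, ∀ᵐ x : E, ‖x‖ ≤ k → F x = 0 := by
    intro k
    let b : ContDiffBump (0 : E) := ⟨1 / (16 * (k + 1)), 1 / (8 * (k + 1)), by positivity, by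
      rw [div_lt_div_iff₀ (by positivity) (by positivity)]
      have : (0 : ℝ) ≤ k := k.cast_nonneg
      linarith⟩
    obtain ⟨ρ, hρ, hρc⟩ := exists_schwartz_eq b.contDiff b.hasCompactSupport
    have h1 : ∀ᵐ x, 𝓕 (ρ : E → ℂ) x • F x = 0 := by
      refine ae_eq_zero_of_fourier_eq_zero (hi ρ hρc) fun ξ => ?_
      obtain ⟨η, hη, hηc⟩ := exists_schwartz_eq
        (g := fun v => b (v + -ξ)) (b.contDiff.comp (by fun_prop))
        (b.hasCompactSupport.comp_homeomorph (Homeomorph.addRight (-ξ)))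
      rw [← h0 η hηc, Real.fourier_eq]
      refine integral_congr_ae (Eventually.of_forall fun x => ?_)
      have e : (η : E → ℂ) = fun v => ρ (v + -ξ) := funext fun v => by rw [hη, hρ]
      simp only [e]
      rw [fourier_comp_add_right, inner_neg_left, real_inner_comm, smul_assoc]
    filter_upwards [h1] with x hx hxk
    refine (smul_eq_zero.1 hx).resolve_left ?_
    have e : (ρ : E → ℂ) = fun v => (b v : ℂ) := funext hρ
    rw [e]
    refine fourier_ne_zero_of_nonneg b.integrable (fun v => b.nonneg) b.integral_pos fun v hv => ?_
    have hv' : ‖v‖ < 1 / (8 * (k + 1)) := by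
      have : v ∈ Function.support b := hv
      rw [b.support_eq] at this
      exact mem_ball_zero_iff.1 this
    refine (abs_real_inner_le_norm v x).trans ?_
    calc ‖v‖ * ‖x‖ ≤ 1 / (8 * (k + 1)) * (k + 1) := by
          gcongr
          linarith
      _ = 1 / 8 := by field_simp
  filter_upwards [ae_all_iff.2 key] with x hx
  obtain ⟨k, hk⟩ := exists_nat_ge ‖x‖
  exact hx k hk

end Uniqueness

/-! ### Integrability against rapidly decaying kernels -/

section Decay

variable {E : Type*} [NormedAddCommGroup E] [InnerProductSpace ℝ E] [FiniteDimensional ℝ E]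
  [MeasurableSpace E] [BorelSpace E] {X : Type*} [NormedAddCommGroup X] [NormedSpace ℂ X]
  {p : ℝ≥0∞}

theorem SchwartzMap.exists_norm_le_inv_pow (φ : 𝓢(E, ℂ)) (N : ℕ) :
    ∃ C : ℝ, 0 ≤ C ∧ ∀ x, ‖φ x‖ ≤ C * ((1 + ‖x‖) ^ N)⁻¹ := by
  refine ⟨2 ^ N * (Finset.Iic (N, 0)).sup (fun m => SchwartzMap.seminorm ℝ m.1 m.2) φ,
    by positivity, fun x => ?_⟩
  have h := SchwartzMap.one_add_le_sup_seminorm_apply (𝕜 := ℝ) (m := (N, 0)) le_rfl le_rfl φ x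
  rw [norm_iteratedFDeriv_zero, mul_comm] at h
  rwa [← div_eq_mul_inv, le_div_iff₀ (by positivity)]

theorem integrable_inv_one_add_norm_pow {N : ℕ} (hN : Module.finrank ℝ E < N) :
    Integrable fun x : E => ((1 + ‖x‖) ^ N)⁻¹ := by
  refine (integrable_one_add_norm (E := E) (r := N) (by exact_mod_cast hN)).congr
    (Eventually.of_forall fun x => ?_)
  simp only
  rw [Real.rpow_neg (by positivity), Real.rpow_natCast]

theorem integrable_inv_pow_mul_norm (hp : 1 ≤ p) (hp' : p ≠ ⊤) {N : ℕ}
    (hN : Module.finrank ℝ E < N) {f : E → X} (hf : MemLp f p volume) :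
    Integrable fun x : E => ((1 + ‖x‖) ^ N)⁻¹ * ‖f x‖ := by
  have hp0 : p ≠ 0 := (zero_lt_one.trans_le hp).ne'
  have hq : 1 ≤ p.toReal := by simpa using ENNReal.toReal_mono hp' hp
  refine ((integrable_inv_one_add_norm_pow hN).add (hf.integrable_norm_rpow hp0 hp')).mono' ?_
    (Eventually.of_forall fun x => ?_)
  · exact (integrable_inv_one_add_norm_pow hN).aestronglyMeasurable.mul hf.1.norm
  · have h1 : ((1 + ‖x‖) ^ N)⁻¹ ≤ 1 :=
      inv_le_one_of_one_le₀ (one_le_pow₀ (by linarith [norm_nonneg x]))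
    have h2 : 0 ≤ ((1 + ‖x‖) ^ N)⁻¹ := by positivity
    have h3 : 0 ≤ ‖f x‖ ^ p.toReal := by positivity
    rw [norm_mul, norm_norm, Real.norm_of_nonneg h2, Pi.add_apply]
    rcases le_total ‖f x‖ 1 with h | h
    · nlinarith
    · have := Real.self_le_rpow_of_one_le h hq
      nlinarith [norm_nonneg (f x)]

/-- A product kernel with enough decay in both variables can be integrated against an `L^p`
function. -/
theorem integrable_prod_smul_of_decay (hp : 1 ≤ p) (hp' : p ≠ ⊤) {N : ℕ}
    (hN : Module.finrank ℝ E < N) {f : E → X} (hf : MemLp f p volume) {k : E × E → ℂ}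
    (hk : AEStronglyMeasurable k (volume.prod volume)) {C : ℝ}
    (hkC : ∀ u v, ‖k (u, v)‖ ≤ C * (((1 + ‖u‖) ^ N)⁻¹ * ((1 + ‖v‖) ^ N)⁻¹)) :
    Integrable (fun z : E × E => k z • f z.2) (volume.prod volume) := by
  refine (((integrable_inv_one_add_norm_pow hN).mul_prod
    (integrable_inv_pow_mul_norm hp hp' hN hf)).const_mul C).mono' ?_
    (Eventually.of_forall fun z => ?_)
  · exact hk.smul hf.1.comp_snd
  · rw [norm_smul]
    calc _ ≤ C * (((1 + ‖z.1‖) ^ N)⁻¹ * ((1 + ‖z.2‖) ^ N)⁻¹) * ‖f z.2‖ := by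
          gcongr; exact hkC z.1 z.2
      _ = _ := by ring

theorem one_add_norm_le_mul (z x : E) : 1 + ‖x‖ ≤ (1 + ‖z‖) * (1 + ‖z - x‖) := by
  have h : ‖x‖ ≤ ‖z‖ + ‖z - x‖ := by
    have := norm_sub_le z (z - x)
    rwa [sub_sub_cancel] at this
  nlinarith [norm_nonneg z, norm_nonneg (z - x), mul_nonneg (norm_nonneg z) (norm_nonneg (z - x))]

theorem integrable_schwartz_smul (hp : 1 ≤ p) (hp' : p ≠ ⊤) {f : E → X} (hf : MemLp f p volume)
    (φ : 𝓢(E, ℂ)) : Integrable fun x => φ x • f x := by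
  obtain ⟨C, hC, h⟩ := φ.exists_norm_le_inv_pow (Module.finrank ℝ E + 1)
  refine ((integrable_inv_pow_mul_norm hp hp' (Nat.lt_succ_self _) hf).const_mul C).mono'
    (φ.continuous.aestronglyMeasurable.smul hf.1) (Eventually.of_forall fun x => ?_)
  rw [norm_smul, ← mul_assoc]
  gcongr
  exact h x

/-- Fubini's theorem applies to the convolution of `f` with a Schwartz function, tested against a
Schwartz function. -/
theorem integrable_schwartz_convolution (hp : 1 ≤ p) (hp' : p ≠ ⊤) {f : E → X}
    (hf : MemLp f p volume) (φ ψ : 𝓢(E, ℂ)) :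
    Integrable (fun z : E × E => (φ z.1 * ψ (z.1 - z.2)) • f z.2) (volume.prod volume) := by
  set N := Module.finrank ℝ E + 1 with hN
  obtain ⟨C, hC, h⟩ := φ.exists_norm_le_inv_pow (N + N)
  obtain ⟨D, hD, h'⟩ := ψ.exists_norm_le_inv_pow N
  refine integrable_prod_smul_of_decay hp hp' (Nat.lt_succ_self _) hf (C := C * D)
    (Continuous.aestronglyMeasurable ?_) fun u v => ?_
  · exact (φ.continuous.comp continuous_fst).mul
      (ψ.continuous.comp (continuous_fst.sub continuous_snd))
  · rw [norm_mul]
    calc ‖φ u‖ * ‖ψ (u - v)‖ ≤ (C * ((1 + ‖u‖) ^ (N + N))⁻¹) * (D * ((1 + ‖u - v‖) ^ N)⁻¹) := by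
          gcongr
          · exact h u
          · exact h' _
      _ = C * D * (((1 + ‖u‖) ^ N)⁻¹ * (((1 + ‖u‖) * (1 + ‖u - v‖)) ^ N)⁻¹) := by
          rw [pow_add, mul_inv, mul_pow, mul_inv]; ring
      _ ≤ _ := by
          gcongr
          exact one_add_norm_le_mul u v

end Decay

/-! ### Reproducing formula for functions with compactly supported Fourier transform -/

section Reproducing

variable {n : ℕ} {X : Type u} [NormedAddCommGroup X] [NormedSpace ℂ X] [CompleteSpace X]
  {p : ℝ≥0∞}

/-- The Fourier transform of the convolution with `𝓕⁻ ψ` is the product with `ψ`, in the sense of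
distributions. -/
theorem integral_fourier_smul_convolution (hp : 1 ≤ p) (hp' : p ≠ ⊤)
    {f : EuclideanSpace ℝ (Fin n) → X} (hf : MemLp f p volume)
    (η ψ θ : 𝓢(EuclideanSpace ℝ (Fin n), ℂ)) (hθ : ∀ ξ, θ ξ = η ξ * ψ ξ) :
    ∫ z, 𝓕 (η : EuclideanSpace ℝ (Fin n) → ℂ) z • ∫ x, (𝓕⁻ ψ) (z - x) • f x
      = ∫ x, 𝓕 (θ : EuclideanSpace ℝ (Fin n) → ℂ) x • f x := by
  have hint := integrable_schwartz_convolution hp hp' hf (𝓕 η) (𝓕⁻ ψ)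
  have e1 : ∀ z, 𝓕 (η : EuclideanSpace ℝ (Fin n) → ℂ) z • ∫ x, (𝓕⁻ ψ) (z - x) • f x
      = ∫ x, (𝓕 η z * (𝓕⁻ ψ) (z - x)) • f x := fun z => by
    rw [← SchwartzMap.fourier_coe, ← integral_smul]
    simp only [mul_smul]
  simp only [e1]
  rw [integral_integral_swap hint]
  refine integral_congr_ae (Eventually.of_forall fun x => ?_)
  simp only
  rw [integral_smul_const]
  congr 1
  have e2 : Integrable fun z => (𝓕⁻ ψ) (z + -x) := (𝓕⁻ ψ).integrable.comp_add_right (-x)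
  have e3 := integral_fourier_smul_eq_flip η.integrable e2
  simp only [smul_eq_mul, ← sub_eq_add_neg] at e3
  rw [SchwartzMap.fourier_coe, e3, Real.fourier_eq]
  refine integral_congr_ae (Eventually.of_forall fun ξ => ?_)
  simp only
  have e4 := fourier_comp_add_right ((𝓕⁻ ψ : 𝓢(EuclideanSpace ℝ (Fin n), ℂ)) : _ → ℂ) (-x) ξ
  simp only [← sub_eq_add_neg] at e4
  rw [e4, ← SchwartzMap.fourier_coe, FourierTransform.fourier_fourierInv_eq, hθ, inner_neg_left,
    real_inner_comm, Circle.smul_def, Circle.smul_def, smul_eq_mul, smul_eq_mul]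
  ring

/-- A function in `L^p` whose Fourier transform is supported in the interior of the set where
`ψ = 1` is reproduced by the convolution with `𝓕⁻ ψ`. -/
theorem ae_eq_schwartz_convolution [Fact (1 ≤ p)] (hp' : p ≠ ⊤)
    (f : Lp X p (volume : Measure (EuclideanSpace ℝ (Fin n))))
    {ψ : 𝓢(EuclideanSpace ℝ (Fin n), ℂ)} {r s : ℝ} (hrs : r < s)
    (hf : fourierSupport f ⊆ Metric.closedBall 0 r) (hψ : ∀ ξ ∈ Metric.ball 0 s, ψ ξ = 1) :
    ∀ᵐ z, f z = ∫ x, (𝓕⁻ ψ) (z - x) • f x := by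
  have hp : 1 ≤ p := Fact.out
  have hfL := Lp.memLp f
  have h1 : ∀ η : 𝓢(EuclideanSpace ℝ (Fin n), ℂ),
      Integrable fun z => 𝓕 (η : EuclideanSpace ℝ (Fin n) → ℂ) z • f z :=
    fun η => integrable_schwartz_smul hp hp' hfL (𝓕 η)
  have h2 : ∀ η : 𝓢(EuclideanSpace ℝ (Fin n), ℂ),
      Integrable fun z => 𝓕 (η : EuclideanSpace ℝ (Fin n) → ℂ) z • ∫ x, (𝓕⁻ ψ) (z - x) • f x := by
    intro η
    refine (integrable_schwartz_convolution hp hp' hfL (𝓕 η) (𝓕⁻ ψ)).integral_prod_left.congr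
      (Eventually.of_forall fun z => ?_)
    simp only
    rw [← SchwartzMap.fourier_coe, ← integral_smul]
    simp only [mul_smul]
  have key : ∀ᵐ z, f z - ∫ x, (𝓕⁻ ψ) (z - x) • f x = 0 := by
    refine ae_eq_zero_of_forall_integral_fourier_smul_eq_zero (fun η _ => ?_) fun η hη => ?_
    · simp only [smul_sub]
      exact (h1 η).sub (h2 η)
    · have hψg : (ψ : EuclideanSpace ℝ (Fin n) → ℂ).HasTemperateGrowth := ψ.hasTemperateGrowth
      set θ : 𝓢(EuclideanSpace ℝ (Fin n), ℂ) := SchwartzMap.smulLeftCLM ℂ ψ η with hθ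
      have hθ' : ∀ ξ, θ ξ = η ξ * ψ ξ := fun ξ => by
        rw [hθ, SchwartzMap.smulLeftCLM_apply_apply hψg, smul_eq_mul, mul_comm]
      simp only [smul_sub]
      rw [integral_sub (h1 η) (h2 η), integral_fourier_smul_convolution hp hp' hfL η ψ θ hθ']
      have h3 : (𝓕 (Lp.toTemperedDistribution f) : 𝓢'(EuclideanSpace ℝ (Fin n), X)) (η - θ) = 0 := by
        have hs : Function.support ⇑(η - θ) ⊆ (Metric.ball 0 s)ᶜ := fun ξ hξ hξs => hξ (by
          rw [sub_apply, hθ', hψ ξ hξs, mul_one, sub_self])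
        refine apply_eq_zero_of_disjoint_dsupport _ _ (hη.mono fun ξ hξ h => hξ ?_) ?_
        · rw [sub_apply, hθ', h, zero_mul, sub_zero]
        · refine Set.disjoint_left.2 fun ξ hξ hξf => ?_
          have h4 := closure_minimal hs Metric.isOpen_ball.isClosed_compl hξ
          have h5 := hf hξf
          rw [mem_closedBall_zero_iff] at h5
          rw [Set.mem_compl_iff, mem_ball_zero_iff] at h4
          linarith
      rw [TemperedDistribution.fourier_apply, Lp.toTemperedDistribution_apply] at h3
      rw [← h3, ← integral_sub (h1 η) (h1 θ)]
      refine integral_congr_ae (Eventually.of_forall fun x => ?_)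
      simp only
      rw [← sub_smul]
      congr 1
      rw [show 𝓕 (η - θ) = 𝓕 η - 𝓕 θ from map_sub (FourierTransform.fourierCLM ℂ _) η θ, sub_apply,
        SchwartzMap.fourier_coe, SchwartzMap.fourier_coe]
  filter_upwards [key] with z hz
  exact sub_eq_zero.1 hz

end Reproducing

/-! ### The tent kernel as a Fourier multiplier -/

section TentKernel

variable {n : ℕ}

/-- The half-width of the tents: it is so small that the Fourier transform of the tent kernel has no
zeros in the ball of radius `3`. -/
noncomputable def tentWidth (n : ℕ) : ℝ := 1 / (24 * (n + 1))

theorem tentWidth_pos (n : ℕ) : 0 < tentWidth n := by unfold tentWidth; positivity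

theorem tentWidth_le (n : ℕ) : tentWidth n ≤ 1 / 2 := by
  unfold tentWidth
  exact one_div_le_one_div_of_le (by norm_num) (by linarith [(n.cast_nonneg : (0 : ℝ) ≤ n)])

theorem tentProd_nonneg (h : ℝ) (v : Fin n → ℝ) : 0 ≤ tentProd h v :=
  Finset.prod_nonneg fun _ _ => le_max_left _ _

theorem continuous_tentProd (h : ℝ) :
    Continuous fun v : EuclideanSpace ℝ (Fin n) => tentProd h (fun i => v i) := by
  unfold tentProd tent
  fun_prop

theorem tentProd_le_one (v : Fin n → ℝ) : tentProd (tentWidth n) v ≤ 1 := by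
  refine Finset.prod_le_one (fun _ _ => le_max_left _ _) fun i _ => max_le zero_le_one ?_
  linarith [tentWidth_le n, abs_nonneg (v i)]

theorem norm_le_of_tentProd_ne_zero {v : EuclideanSpace ℝ (Fin n)}
    (hv : tentProd (tentWidth n) (fun i => v i) ≠ 0) : ‖v‖ ≤ 1 / 24 := by
  have h1 : ∀ i, ‖v i‖ ≤ tentWidth n := fun i => by
    have h2 := Finset.prod_ne_zero_iff.1 hv i (Finset.mem_univ i)
    by_contra! hc
    exact h2 (max_eq_left (by rw [Real.norm_eq_abs] at hc; linarith))
  have h0 := tentWidth_pos n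
  have h3 : n * tentWidth n ≤ 1 / 24 := by
    unfold tentWidth
    rw [mul_one_div, div_le_div_iff₀ (by positivity) (by positivity)]
    linarith
  refine le_trans ?_ h3
  rw [EuclideanSpace.norm_eq, Real.sqrt_le_iff]
  refine ⟨by positivity, ?_⟩
  calc ∑ i, ‖v i‖ ^ 2 ≤ ∑ _i : Fin n, tentWidth n ^ 2 :=
        Finset.sum_le_sum fun i _ => pow_le_pow_left₀ (norm_nonneg _) (h1 i) 2
    _ = n * tentWidth n ^ 2 := by simp
    _ ≤ (n : ℝ) ^ 2 * tentWidth n ^ 2 := by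
        gcongr
        exact_mod_cast Nat.le_self_pow two_ne_zero n
    _ = _ := by ring

theorem hasCompactSupport_tentProd :
    HasCompactSupport fun v : EuclideanSpace ℝ (Fin n) => tentProd (tentWidth n) (fun i => v i) :=
  HasCompactSupport.intro (isCompact_closedBall 0 (1 / 24)) fun v hv => by
    by_contra hc
    exact hv (mem_closedBall_zero_iff.2 (norm_le_of_tentProd_ne_zero hc))

theorem integrable_tentProd :
    Integrable fun v : EuclideanSpace ℝ (Fin n) => tentProd (tentWidth n) (fun i => v i) :=
  (continuous_tentProd _).integrable_of_hasCompactSupport hasCompactSupport_tentProd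

theorem integral_tentProd_pos :
    0 < ∫ v : EuclideanSpace ℝ (Fin n), tentProd (tentWidth n) (fun i => v i) := by
  refine (continuous_tentProd _).integral_pos_of_hasCompactSupport_nonneg_nonzero
    hasCompactSupport_tentProd (fun v => tentProd_nonneg _ _) (x := 0) ?_
  refine Finset.prod_ne_zero_iff.2 fun i _ => ?_
  have := tentWidth_pos n
  simp [tent, this]

theorem fourier_tentProd_ne_zero {ξ : EuclideanSpace ℝ (Fin n)} (hξ : ‖ξ‖ ≤ 3) :
    𝓕 (fun v : EuclideanSpace ℝ (Fin n) => (tentProd (tentWidth n) (fun i => v i) : ℂ)) ξ ≠ 0 := by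
  refine fourier_ne_zero_of_nonneg integrable_tentProd (fun v => tentProd_nonneg _ _)
    integral_tentProd_pos fun v hv => (abs_real_inner_le_norm v ξ).trans ?_
  have := norm_le_of_tentProd_ne_zero hv
  nlinarith [norm_nonneg v]

open scoped ContDiff in
theorem contDiff_fourier_tentProd :
    ContDiff ℝ ∞ (𝓕 (fun v : EuclideanSpace ℝ (Fin n) =>
      (tentProd (tentWidth n) (fun i => v i) : ℂ))) := by
  refine Real.contDiff_fourier fun k _ => ?_
  have hc : HasCompactSupport fun v : EuclideanSpace ℝ (Fin n) =>
      ‖v‖ ^ k * ‖(tentProd (tentWidth n) (fun i => v i) : ℂ)‖ :=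
    hasCompactSupport_tentProd.mono fun v hv h => hv (by simp [h])
  refine Continuous.integrable_of_hasCompactSupport ?_ hc
  exact (continuous_norm.pow k).mul
    (Complex.continuous_ofReal.comp (continuous_tentProd _)).norm

open scoped ContDiff in
/-- A test function `ψ` that equals `1` near the unit ball is the product of the Fourier transform
of the tent kernel with a test function, so that `𝓕⁻ ψ` is a superposition of translated tents with
a rapidly decaying density `κ`. -/
theorem exists_tent_superposition (n : ℕ) : ∃ (κ : 𝓢(EuclideanSpace ℝ (Fin n), ℂ))
    (ψ : EuclideanSpace ℝ (Fin n) → ℝ), ContDiff ℝ ∞ ψ ∧ HasCompactSupport ψ ∧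
      (∀ ξ ∈ Metric.ball 0 2, ψ ξ = 1) ∧
      ∀ w : EuclideanSpace ℝ (Fin n), 𝓕⁻ (fun ξ => (ψ ξ : ℂ)) w
        = ∫ u, κ u * (tentProd (tentWidth n) (fun i => w i - u i) : ℂ) := by
  let b : ContDiffBump (0 : EuclideanSpace ℝ (Fin n)) := ⟨2, 3, by norm_num, by norm_num⟩
  set k : EuclideanSpace ℝ (Fin n) → ℂ := fun v => (tentProd (tentWidth n) (fun i => v i) : ℂ)
    with hk
  have hki : Integrable k := integrable_tentProd.ofReal
  have hq : ContDiff ℝ ∞ fun ξ => (b ξ : ℂ) * (𝓕 k ξ)⁻¹ := by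
    refine contDiff_iff_contDiffAt.2 fun ξ => ?_
    by_cases hξ : ‖ξ‖ ≤ 3
    · exact (Complex.ofRealCLM.contDiff.comp b.contDiff).contDiffAt.mul
        ((contDiff_fourier_tentProd.contDiffAt).inv (fourier_tentProd_ne_zero hξ))
    · have h1 : (fun ξ => (b ξ : ℂ) * (𝓕 k ξ)⁻¹) =ᶠ[𝓝 ξ] fun _ => 0 := by
        have h2 : (Metric.closedBall (0 : EuclideanSpace ℝ (Fin n)) 3)ᶜ ∈ 𝓝 ξ :=
          Metric.isClosed_closedBall.isOpen_compl.mem_nhds (by simpa using hξ)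
        filter_upwards [h2] with ζ hζ
        have h3 : b ζ = 0 := b.zero_of_le_dist (by
          rw [Set.mem_compl_iff, Metric.mem_closedBall, not_le] at hζ
          exact hζ.le)
        rw [h3]; simp
      exact contDiffAt_const.congr_of_eventuallyEq h1
  have hqc : HasCompactSupport fun ξ => (b ξ : ℂ) * (𝓕 k ξ)⁻¹ :=
    b.hasCompactSupport.mono fun ξ hξ h => hξ (by simp [h])
  set q : 𝓢(EuclideanSpace ℝ (Fin n), ℂ) := hqc.toSchwartzMap hq with hqdef
  have hqb : ∀ ξ, 𝓕 k ξ * q ξ = (b ξ : ℂ) := fun ξ => by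
    have e : q ξ = (b ξ : ℂ) * (𝓕 k ξ)⁻¹ := rfl
    rw [e]
    by_cases hξ : ‖ξ‖ ≤ 3
    · rw [mul_comm, mul_assoc, inv_mul_cancel₀ (fourier_tentProd_ne_zero hξ), mul_one]
    · have h3 : b ξ = 0 := b.zero_of_le_dist (by
        rw [dist_zero_right]; exact (not_le.1 hξ).le)
      rw [h3]; simp
  refine ⟨𝓕⁻ q, b, b.contDiff, b.hasCompactSupport,
    fun ξ hξ => b.one_of_mem_closedBall (Metric.ball_subset_closedBall hξ), fun w => ?_⟩
  have hqe : Integrable fun ξ => Real.fourierChar (inner ℝ ξ w) • q ξ := by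
    have := (Real.fourierIntegral_convergent_iff (f := q) (-w)).2 (q.integrable (μ := volume))
    simpa only [inner_neg_right, neg_neg] using this
  have e1 := integral_fourier_smul_eq_flip hki hqe
  have e2 : ∀ s, 𝓕 (fun ξ => Real.fourierChar (inner ℝ ξ w) • q ξ) s = (𝓕⁻ q) (w - s) := fun s => by
    rw [SchwartzMap.fourierInv_coe, Real.fourier_eq, Real.fourierInv_eq]
    refine integral_congr_ae (Eventually.of_forall fun ξ => ?_)
    simp only
    rw [smul_smul, ← AddChar.map_add_eq_mul, inner_sub_right]
    congr 2
    ring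
  rw [Real.fourierInv_eq]
  calc ∫ ξ, Real.fourierChar (inner ℝ ξ w) • (b ξ : ℂ)
      = ∫ ξ, 𝓕 k ξ • Real.fourierChar (inner ℝ ξ w) • q ξ := by
        refine integral_congr_ae (Eventually.of_forall fun ξ => ?_)
        simp only
        rw [← hqb, smul_comm, smul_eq_mul]
    _ = ∫ s, k s * (𝓕⁻ q) (w - s) := by rw [e1]; simp only [e2, smul_eq_mul]
    _ = ∫ u, k (w - u) * (𝓕⁻ q) (w - (w - u)) :=
        (integral_sub_left_eq_self (fun s => k s * (𝓕⁻ q) (w - s)) volume w).symm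
    _ = _ := by
        refine integral_congr_ae (Eventually.of_forall fun u => ?_)
        simp only [sub_sub_cancel]
        rw [mul_comm]
        rfl

open scoped ContDiff in
/-- The dilation of a test function, as a Schwartz function, and its inverse Fourier transform. -/
theorem exists_schwartz_dilation {ψ : EuclideanSpace ℝ (Fin n) → ℝ} (hψ : ContDiff ℝ ∞ ψ)
    (hc : HasCompactSupport ψ) {δ : ℝ} (hδ : 0 < δ) :
    ∃ ψδ : 𝓢(EuclideanSpace ℝ (Fin n), ℂ), (∀ ξ, ψδ ξ = (ψ (δ • ξ) : ℂ)) ∧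
      ∀ x, (𝓕⁻ ψδ) x = ((δ ^ n)⁻¹ : ℝ) • 𝓕⁻ (fun ξ => (ψ ξ : ℂ)) (δ⁻¹ • x) := by
  obtain ⟨ψδ, h1, -⟩ := exists_schwartz_eq (g := fun ξ => ψ (δ • ξ))
    (hψ.comp (contDiff_const_smul δ)) (hc.comp_homeomorph (Homeomorph.smulOfNeZero δ hδ.ne'))
  refine ⟨ψδ, h1, fun x => ?_⟩
  have e := Measure.integral_comp_smul (volume : Measure (EuclideanSpace ℝ (Fin n)))
    (fun ξ => Real.fourierChar (inner ℝ ξ (δ⁻¹ • x)) • (ψ ξ : ℂ)) δ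
  rw [finrank_euclideanSpace_fin, abs_of_pos (by positivity)] at e
  rw [SchwartzMap.fourierInv_coe, Real.fourierInv_eq, Real.fourierInv_eq, ← e]
  refine integral_congr_ae (Eventually.of_forall fun ξ => ?_)
  simp only
  rw [h1, inner_smul_left, inner_smul_right]
  congr 3
  simp [hδ.ne']

end TentKernel

/-! ### Band-limited functions as superpositions of translated tent convolutions -/

section Superposition

variable {n : ℕ} {X : Type u} [NormedAddCommGroup X] [NormedSpace ℂ X] {p : ℝ≥0∞}

theorem tentProd_le_decay (N : ℕ) (w : EuclideanSpace ℝ (Fin n)) :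
    tentProd (tentWidth n) (fun i => w i) ≤ 2 ^ N * ((1 + ‖w‖) ^ N)⁻¹ := by
  by_cases hw : tentProd (tentWidth n) (fun i => w i) = 0
  · rw [hw]; positivity
  · refine (tentProd_le_one _).trans ?_
    rw [← div_eq_mul_inv, le_div_iff₀ (by positivity), one_mul]
    have := norm_le_of_tentProd_ne_zero hw
    exact pow_le_pow_left₀ (by positivity) (by linarith) N

/-- Fubini's theorem applies to a superposition of translated tent convolutions. -/
theorem integrable_tent_superposition (hp : 1 ≤ p) (hp' : p ≠ ⊤)
    {f : EuclideanSpace ℝ (Fin n) → X} (hf : MemLp f p volume)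
    (κ : 𝓢(EuclideanSpace ℝ (Fin n), ℂ)) {δ : ℝ} (hδ : 0 < δ) (x y : EuclideanSpace ℝ (Fin n)) :
    Integrable (fun z : EuclideanSpace ℝ (Fin n) × EuclideanSpace ℝ (Fin n) =>
      (κ z.1 * (tentProd (tentWidth n) (fun i => (x i - z.2 i) / δ - (y i + z.1 i)) : ℂ)) • f z.2)
      (volume.prod volume) := by
  set N := Module.finrank ℝ (EuclideanSpace ℝ (Fin n)) + 1 with hN
  obtain ⟨C, hC, h⟩ := κ.exists_norm_le_inv_pow (N + N)
  -- in terms of `w = (x - v) / δ - y` the tent is evaluated at `w - u`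
  set w : EuclideanSpace ℝ (Fin n) → EuclideanSpace ℝ (Fin n) := fun v => δ⁻¹ • (x - v) - y with hw
  have hwe : ∀ u v : EuclideanSpace ℝ (Fin n), (fun i => (x i - v i) / δ - (y i + u i))
      = fun i => (w v - u) i := fun u v => by
    funext i
    simp only [hw, PiLp.sub_apply, PiLp.smul_apply, smul_eq_mul]
    rw [div_eq_inv_mul]; ring
  set A : ℝ := 1 + ‖x - δ • y‖ + δ with hA
  have hAv : ∀ v, 1 + ‖v‖ ≤ A * (1 + ‖w v‖) := fun v => by
    have e : v = (x - δ • y) - δ • w v := by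
      simp only [hw, smul_sub, smul_smul, mul_inv_cancel₀ hδ.ne', one_smul]
      abel
    have h1 : ‖v‖ ≤ ‖x - δ • y‖ + δ * ‖w v‖ := by
      conv_lhs => rw [e]
      refine (norm_sub_le _ _).trans (le_of_eq ?_)
      rw [norm_smul, Real.norm_of_nonneg hδ.le]
    nlinarith [norm_nonneg (w v), norm_nonneg (x - δ • y)]
  have hA0 : 0 < A := by positivity
  refine integrable_prod_smul_of_decay hp hp' (N := N) (Nat.lt_succ_self _) hf (C := C * (2 ^ N * A ^ N))
    (k := fun z => κ z.1 * (tentProd (tentWidth n)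
      (fun i => (x i - z.2 i) / δ - (y i + z.1 i)) : ℂ)) (Continuous.aestronglyMeasurable ?_)
    fun u v => ?_
  · refine (κ.continuous.comp continuous_fst).mul (Complex.continuous_ofReal.comp ?_)
    simp only [hwe]
    refine (continuous_tentProd (tentWidth n)).comp (g := fun v => tentProd (tentWidth n) fun i => v i)
      (f := fun z : EuclideanSpace ℝ (Fin n) × EuclideanSpace ℝ (Fin n) => w z.2 - z.1) ?_
    simp only [hw]
    fun_prop
  · simp only [hwe]
    rw [norm_mul, Complex.norm_real, Real.norm_of_nonneg (tentProd_nonneg _ _)]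
    have h2 : ((1 + ‖w v‖) ^ N)⁻¹ ≤ A ^ N * ((1 + ‖v‖) ^ N)⁻¹ := by
      rw [← div_eq_mul_inv, le_div_iff₀ (by positivity), inv_mul_le_iff₀ (by positivity), ← mul_pow,
        mul_comm]
      exact pow_le_pow_left₀ (by positivity) (hAv v) N
    calc ‖κ u‖ * tentProd (tentWidth n) (fun i => (w v - u) i)
        ≤ (C * ((1 + ‖u‖) ^ (N + N))⁻¹) * (2 ^ N * ((1 + ‖w v - u‖) ^ N)⁻¹) :=
          mul_le_mul (h u) (tentProd_le_decay N _) (tentProd_nonneg _ _) (by positivity)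
      _ = C * 2 ^ N * (((1 + ‖u‖) ^ N)⁻¹ * (((1 + ‖u‖) * (1 + ‖u - w v‖)) ^ N)⁻¹) := by
          rw [pow_add, mul_inv, mul_pow, mul_inv, norm_sub_rev]; ring
      _ ≤ C * 2 ^ N * (((1 + ‖u‖) ^ N)⁻¹ * ((1 + ‖w v‖) ^ N)⁻¹) := by
          gcongr
          exact one_add_norm_le_mul u (w v)
      _ ≤ C * 2 ^ N * (((1 + ‖u‖) ^ N)⁻¹ * (A ^ N * ((1 + ‖v‖) ^ N)⁻¹)) := by gcongr
      _ = _ := by ring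

open scoped ContDiff in
/-- A function with Fourier support in the ball of radius `δ⁻¹`, translated by `δ y`, is a
superposition of tent convolutions translated by `δ (y + u)`, with a density in `u` that depends
neither on the function nor on `δ` and `y`. -/
theorem exists_translate_eq_integral_tentShift (n : ℕ) :
    ∃ κ : 𝓢(EuclideanSpace ℝ (Fin n), ℂ), ∀ (X : Type u) [NormedAddCommGroup X] [NormedSpace ℂ X]
      [CompleteSpace X] (p : ℝ≥0∞) [Fact (1 ≤ p)], p ≠ ⊤ →
      ∀ (f : Lp X p (volume : Measure (EuclideanSpace ℝ (Fin n)))) (δ : ℝ), 0 < δ →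
        fourierSupport f ⊆ Metric.closedBall 0 δ⁻¹ → ∀ y : EuclideanSpace ℝ (Fin n), ∀ᵐ x,
        Integrable (fun u => κ u • tentShift (tentWidth n) δ (fun i => y i + u i) f x) ∧
        f (x - δ • y) = ∫ u, κ u • tentShift (tentWidth n) δ (fun i => y i + u i) f x := by
  obtain ⟨κ, ψ, hψ, hψc, hψ1, hκ⟩ := exists_tent_superposition n
  refine ⟨κ, fun X _ _ _ p _ hp' f δ hδ hf y => ?_⟩
  have hp : 1 ≤ p := Fact.out
  obtain ⟨ψδ, hψδ, hψδ'⟩ := exists_schwartz_dilation hψ hψc hδ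
  have h1 := ae_eq_schwartz_convolution hp' f (ψ := ψδ) (r := δ⁻¹) (s := 2 * δ⁻¹)
    (by have := inv_pos.2 hδ; linarith) hf fun ξ hξ => by
      rw [hψδ, hψ1 _ ?_, Complex.ofReal_one]
      rw [mem_ball_zero_iff] at hξ ⊢
      rw [norm_smul, Real.norm_of_nonneg hδ.le]
      calc δ * ‖ξ‖ < δ * (2 * δ⁻¹) := by gcongr
        _ = 2 := by field_simp
  have h2 := (measurePreserving_sub_right volume (δ • y)).quasiMeasurePreserving.ae h1
  filter_upwards [h2] with x hx
  have hint := integrable_tent_superposition hp hp' (Lp.memLp f) κ hδ x y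
  have e0 : ∀ u, κ u • tentShift (tentWidth n) δ (fun i => y i + u i) f x
      = (δ ^ n)⁻¹ • ∫ v : EuclideanSpace ℝ (Fin n), (κ u * (tentProd (tentWidth n)
        (fun i => (x i - v i) / δ - (y i + u i)) : ℂ)) • f v := fun u => by
    rw [tentShift, smul_comm, ← integral_smul]
    congr 1
    refine integral_congr_ae (Eventually.of_forall fun v => ?_)
    simp only
    rw [mul_smul, Complex.coe_smul]
  simp only [e0]
  refine ⟨hint.integral_prod_left.smul ((δ ^ n)⁻¹ : ℝ), ?_⟩
  rw [hx, integral_smul, integral_integral_swap hint, ← integral_smul]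
  refine integral_congr_ae (Eventually.of_forall fun v => ?_)
  simp only
  rw [integral_smul_const, hψδ', hκ, smul_assoc]
  congr 2
  refine integral_congr_ae (Eventually.of_forall fun u => ?_)
  simp only
  congr 3
  funext i
  simp only [PiLp.sub_apply, PiLp.smul_apply, smul_eq_mul]
  field_simp
  ring

end Superposition

/-! ### The estimate for finite sums -/

section FiniteEstimate

variable {n : ℕ} {X : Type u} [NormedAddCommGroup X] [NormedSpace ℂ X] {p : ℝ≥0∞}

theorem stronglyMeasurable_tentShift_uncurry (h δ : ℝ) (y : EuclideanSpace ℝ (Fin n))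
    {g : EuclideanSpace ℝ (Fin n) → X} (hg : StronglyMeasurable g) :
    StronglyMeasurable fun z : EuclideanSpace ℝ (Fin n) × EuclideanSpace ℝ (Fin n) =>
      tentShift h δ (fun i => y i + z.1 i) g z.2 := by
  unfold tentShift
  refine StronglyMeasurable.const_smul ?_ _
  refine StronglyMeasurable.integral_prod_right' (f := fun z : (EuclideanSpace ℝ (Fin n) ×
    EuclideanSpace ℝ (Fin n)) × EuclideanSpace ℝ (Fin n) =>
      tentProd h (fun i => (z.1.2 i - z.2 i) / δ - (y i + z.1.1 i)) • g z.2) ?_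
  refine StronglyMeasurable.smul (𝕜 := ℝ) (Continuous.stronglyMeasurable ?_)
    (hg.comp_measurable measurable_snd)
  unfold tentProd tent
  fun_prop

/-- The random translates of functions that are superpositions of tent convolutions. -/
theorem radNorm_translate_le [CompleteSpace X] (hp : 1 < p) (hp' : p ≠ ⊤) (hβ : umdConst p X ≠ ⊤)
    (κ : 𝓢(EuclideanSpace ℝ (Fin n), ℂ)) {y : ℤ → EuclideanSpace ℝ (Fin n)} {Λ : ℝ} (hΛ : 0 ≤ Λ)
    (hy : ∀ j, ‖y j‖ ≤ Real.exp Λ) (K : ℤ) (N : ℕ)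
    {g : ℕ → EuclideanSpace ℝ (Fin n) → X} (hgm : ∀ l, StronglyMeasurable (g l))
    (hg : ∀ l, MemLp (g l) p volume)
    (hrep : ∀ l : ℕ, ∀ᵐ x,
      Integrable (fun u => κ u • tentShift (tentWidth n) (2 ^ (K - (l : ℤ)))
        (fun i => y (K - (l : ℤ)) i + u i) (g l) x) ∧
      g l (x - (2 : ℝ) ^ (K - (l : ℤ)) • y (K - (l : ℤ)))
        = ∫ u, κ u • tentShift (tentWidth n) (2 ^ (K - (l : ℤ)))
          (fun i => y (K - (l : ℤ)) i + u i) (g l) x) :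
    radNorm N p volume (fun (l : ℕ) x => g l (x - (2 : ℝ) ^ (K - (l : ℤ)) • y (K - (l : ℤ))))
      ≤ (∫⁻ u, ‖κ u‖ₑ * ENNReal.ofReal (1 + ‖u‖)) *
        (8 * 4 ^ n * ENNReal.ofReal (1 + Λ) * (1 + umdConst p X) * radNorm N p volume g) := by
  set B : ℝ≥0∞ := 8 * 4 ^ n * ENNReal.ofReal (1 + Λ) * (1 + umdConst p X) * radNorm N p volume g
    with hB
  have hBt : B ≠ ⊤ := by
    have := (radNorm_lt_top (N := N) hg).ne
    finiteness
  set Φ : EuclideanSpace ℝ (Fin n) → (Fin N → Bool) × EuclideanSpace ℝ (Fin n) → X :=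
    fun u z => κ u • ∑ l ∈ Finset.range N, cubeSign N l z.1 •
      tentShift (tentWidth n) (2 ^ (K - (l : ℤ))) (fun i => y (K - (l : ℤ)) i + u i) (g l) z.2
    with hΦ
  have hΦm : StronglyMeasurable (Function.uncurry Φ) := by
    simp only [hΦ, Function.uncurry_def]
    have h0 : StronglyMeasurable fun z : EuclideanSpace ℝ (Fin n) ×
        (Fin N → Bool) × EuclideanSpace ℝ (Fin n) => κ z.1 :=
      (κ.continuous.stronglyMeasurable).comp_measurable measurable_fst
    refine h0.smul (Finset.stronglyMeasurable_fun_sum _ fun l _ => ?_)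
    have h1 : StronglyMeasurable fun z : EuclideanSpace ℝ (Fin n) ×
        (Fin N → Bool) × EuclideanSpace ℝ (Fin n) => cubeSign N l z.2.1 :=
      ((measurable_of_finite (cubeSign N l)).comp
        (measurable_fst.comp measurable_snd)).stronglyMeasurable
    have h2 : Measurable fun z : EuclideanSpace ℝ (Fin n) ×
        (Fin N → Bool) × EuclideanSpace ℝ (Fin n) => (z.1, z.2.2) := by fun_prop
    have h3 := (stronglyMeasurable_tentShift_uncurry (tentWidth n) (2 ^ (K - (l : ℤ)))
      (y (K - (l : ℤ))) (hgm l)).comp_measurable h2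
    exact h1.smul h3
  have hae : (fun z : (Fin N → Bool) × EuclideanSpace ℝ (Fin n) => ∑ l ∈ Finset.range N,
      cubeSign N l z.1 • g l (z.2 - (2 : ℝ) ^ (K - (l : ℤ)) • y (K - (l : ℤ))))
      =ᵐ[Measure.count.prod volume] fun z => ∫ u, Φ u z := by
    have h1 := (Measure.quasiMeasurePreserving_snd (μ := (Measure.count : Measure (Fin N → Bool)))
      (ν := (volume : Measure (EuclideanSpace ℝ (Fin n))))).ae (ae_all_iff.2 hrep)
    filter_upwards [h1] with z hz
    have e : ∀ u, Φ u z = ∑ l ∈ Finset.range N, cubeSign N l z.1 • (κ u •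
        tentShift (tentWidth n) (2 ^ (K - (l : ℤ))) (fun i => y (K - (l : ℤ)) i + u i)
          (g l) z.2) := fun u => by
      simp only [hΦ, Finset.smul_sum]
      exact Finset.sum_congr rfl fun l _ => smul_comm _ _ _
    have hint : ∀ l ∈ Finset.range N, Integrable fun u => cubeSign N l z.1 • (κ u •
        tentShift (tentWidth n) (2 ^ (K - (l : ℤ))) (fun i => y (K - (l : ℤ)) i + u i)
          (g l) z.2) := fun l _ => (hz l).1.smul (cubeSign N l z.1)
    simp only [e]
    rw [integral_finsetSum _ hint]
    refine Finset.sum_congr rfl fun l _ => ?_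
    rw [integral_smul, (hz l).2]
  have hw : Measurable fun u : EuclideanSpace ℝ (Fin n) =>
      ‖κ u‖ₑ * ENNReal.ofReal (1 + ‖u‖) := by
    have := κ.continuous.measurable
    fun_prop
  rw [radNorm, eLpNorm_congr_ae hae, ← lintegral_mul_const _ hw]
  refine eLpNorm_integral_le hp hp' hΦm.aestronglyMeasurable (hw.mul_const B)
    (fun u => by finiteness) fun u => ?_
  have e : Φ u = κ u • fun z : (Fin N → Bool) × EuclideanSpace ℝ (Fin n) =>
      ∑ l ∈ Finset.range N, cubeSign N l z.1 • tentShift (tentWidth n) (2 ^ (K - (l : ℤ)))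
        (fun i => y (K - (l : ℤ)) i + u i) (g l) z.2 := rfl
  rw [e, eLpNorm_const_smul, mul_assoc]
  gcongr
  exact radNorm_tentShift_add_le hp hp' hβ (tentWidth_le n) hΛ hy u K N hgm hg

theorem lintegral_schwartz_mul_one_add_norm_lt_top (κ : 𝓢(EuclideanSpace ℝ (Fin n), ℂ)) :
    ∫⁻ u, ‖κ u‖ₑ * ENNReal.ofReal (1 + ‖u‖) < ⊤ := by
  have h1 : Integrable fun u => ‖κ u‖ + ‖u‖ ^ 1 * ‖κ u‖ :=
    (κ.integrable (μ := volume)).norm.add (κ.integrable_pow_mul volume 1)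
  refine lt_of_eq_of_lt (lintegral_congr fun u => ?_) h1.2
  rw [Real.enorm_of_nonneg (by positivity), ← ofReal_norm, ← ENNReal.ofReal_mul
    (norm_nonneg _)]
  congr 1; ring

theorem sum_eq_sum_range_sub {A : Type*} [AddCommMonoid A] {J : Finset ℤ} {K : ℕ}
    (hJ : ∀ j ∈ J, j.natAbs ≤ K) (F : ℤ → A) :
    ∑ j ∈ J, F j = ∑ l ∈ Finset.range (2 * K + 1),
      if (K : ℤ) - (l : ℤ) ∈ J then F (K - (l : ℤ)) else 0 := by
  rw [← Finset.sum_filter]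
  refine Finset.sum_bij' (fun j _ => (K - j).toNat) (fun l _ => (K : ℤ) - l) ?_ ?_ ?_ ?_ ?_
  · intro j hj
    have := hJ j hj
    have e : (K : ℤ) - ((K - j).toNat : ℤ) = j := by omega
    rw [Finset.mem_filter, Finset.mem_range, e]
    exact ⟨by omega, hj⟩
  · intro l hl
    exact (Finset.mem_filter.1 hl).2
  · intro j hj
    have := hJ j hj
    omega
  · intro l hl
    omega
  · intro j hj
    have := hJ j hj
    congr 1
    omega

/-- The estimate for finite sums, with the first power of the UMD constant and without the norm of
the Hilbert transform. -/
theorem exists_finite_estimate (n : ℕ) :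
    ∃ C : ℝ≥0, ∀ (X : Type u) [NormedAddCommGroup X] [NormedSpace ℂ X] [CompleteSpace X]
      (p : ℝ≥0∞) [Fact (1 ≤ p)], umdConst p X ≠ ⊤ → 1 < p → p ≠ ⊤ →
      ∀ (Ω : Type v) [MeasurableSpace Ω] (P : Measure Ω) [IsProbabilityMeasure P]
        (r : ℤ → Ω → ℝ), IsRademacher P r →
      ∀ (f : ℤ → Lp X p (volume : Measure (EuclideanSpace ℝ (Fin n))))
        (y : ℤ → EuclideanSpace ℝ (Fin n)),
        (∀ j, fourierSupport (f j) ⊆ Metric.closedBall 0 ((2 : ℝ) ^ (-j))) →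
        ∀ (J : Finset ℤ) (Λ : ℝ), 0 ≤ Λ → (∀ j ∈ J, ‖y j‖ ≤ Real.exp Λ) →
          eLpNorm (fun z => ∑ j ∈ J, randomTranslate r (fun j => f j) y j z) p (P.prod volume)
            ≤ C * ENNReal.ofReal (1 + Λ) * (1 + umdConst p X) *
                eLpNorm (fun z => ∑ j ∈ J, r j z.1 • f j z.2) p (P.prod volume) := by
  obtain ⟨κ, hκ⟩ := exists_translate_eq_integral_tentShift.{u} n
  set I : ℝ≥0∞ := ∫⁻ u, ‖κ u‖ₑ * ENNReal.ofReal (1 + ‖u‖) with hI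
  have hIt : I ≠ ⊤ := (lintegral_schwartz_mul_one_add_norm_lt_top κ).ne
  refine ⟨I.toNNReal * (8 * 4 ^ n), ?_⟩
  intro X _ _ _ p _ hβ hp hp' Ω _ P _ r hr f y hf J Λ hΛ hy
  set K : ℕ := J.sup Int.natAbs with hK
  have hJ : ∀ j ∈ J, j.natAbs ≤ K := fun j hj => Finset.le_sup (f := Int.natAbs) hj
  -- the scales are ordered from coarse to fine, and the missing indices are filled up by zeros
  set g : ℕ → EuclideanSpace ℝ (Fin n) → X := fun l =>
    if (K : ℤ) - (l : ℤ) ∈ J then f (K - (l : ℤ)) else 0 with hg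
  set y' : ℤ → EuclideanSpace ℝ (Fin n) := fun j => if j ∈ J then y j else 0 with hy'
  have hy'Λ : ∀ j, ‖y' j‖ ≤ Real.exp Λ := fun j => by
    by_cases hj : j ∈ J
    · simpa [hy', hj] using hy j hj
    · simpa [hy', hj] using (Real.exp_pos Λ).le
  have hgm : ∀ l, StronglyMeasurable (g l) := fun l => by
    by_cases hl : (K : ℤ) - (l : ℤ) ∈ J
    · simpa [hg, hl] using Lp.stronglyMeasurable _
    · simpa [hg, hl] using stronglyMeasurable_zero
  have hgL : ∀ l, MemLp (g l) p volume := fun l => by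
    by_cases hl : (K : ℤ) - (l : ℤ) ∈ J
    · simpa [hg, hl] using Lp.memLp _
    · simp [hg, hl]
  have hrep : ∀ l : ℕ, ∀ᵐ x,
      Integrable (fun u => κ u • tentShift (tentWidth n) (2 ^ ((K : ℤ) - (l : ℤ)))
        (fun i => y' (K - (l : ℤ)) i + u i) (g l) x) ∧
      g l (x - (2 : ℝ) ^ ((K : ℤ) - (l : ℤ)) • y' (K - (l : ℤ)))
        = ∫ u, κ u • tentShift (tentWidth n) (2 ^ ((K : ℤ) - (l : ℤ)))
          (fun i => y' (K - (l : ℤ)) i + u i) (g l) x := by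
    intro l
    by_cases hl : (K : ℤ) - (l : ℤ) ∈ J
    · have e : g l = f (K - (l : ℤ)) := by simp [hg, hl]
      rw [e]
      refine hκ X p hp' (f (K - (l : ℤ))) _ (by positivity) ?_ _
      rw [← zpow_neg]
      exact hf _
    · have e : g l = 0 := by simp [hg, hl]
      rw [e]
      refine Eventually.of_forall fun x => ?_
      simp [tentShift]
  have h1 := radNorm_translate_le hp hp' hβ κ hΛ hy'Λ K (2 * K + 1) hgm hgL hrep
  have he : Function.Injective fun l : ℕ => (K : ℤ) - (l : ℤ) := fun a b hab => by
    simp only at hab; omega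
  have hgT : ∀ l : ℕ, AEStronglyMeasurable
      (fun x => g l (x - (2 : ℝ) ^ ((K : ℤ) - (l : ℤ)) • y' (K - (l : ℤ)))) volume := fun l =>
    ((hgm l).comp_measurable (measurable_sub_const _)).aestronglyMeasurable
  have h2 := eLpNorm_rademacher_sum hr he (2 * K + 1) hgT hp'
  have h3 := eLpNorm_rademacher_sum hr he (2 * K + 1) (fun l => (hgL l).1) hp'
  have e1 : (fun z : Ω × EuclideanSpace ℝ (Fin n) =>
      ∑ j ∈ J, randomTranslate r (fun j => f j) y j z)
      = fun z => ∑ l ∈ Finset.range (2 * K + 1), r (K - (l : ℤ)) z.1 •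
        g l (z.2 - (2 : ℝ) ^ ((K : ℤ) - (l : ℤ)) • y' (K - (l : ℤ))) := by
    funext z
    rw [sum_eq_sum_range_sub hJ]
    refine Finset.sum_congr rfl fun l _ => ?_
    by_cases hl : (K : ℤ) - (l : ℤ) ∈ J <;> simp [hg, hy', hl, randomTranslate]
  have e2 : (fun z : Ω × EuclideanSpace ℝ (Fin n) => ∑ j ∈ J, r j z.1 • f j z.2)
      = fun z => ∑ l ∈ Finset.range (2 * K + 1), r (K - (l : ℤ)) z.1 • g l z.2 := by
    funext z
    rw [sum_eq_sum_range_sub hJ]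
    refine Finset.sum_congr rfl fun l _ => ?_
    by_cases hl : (K : ℤ) - (l : ℤ) ∈ J <;> simp [hg, hl]
  rw [e1, e2, h2, h3]
  calc _ ≤ ((2⁻¹ : ℝ≥0∞) ^ (2 * K + 1)) ^ (1 / p).toReal * (I *
        (8 * 4 ^ n * ENNReal.ofReal (1 + Λ) * (1 + umdConst p X) *
          radNorm (2 * K + 1) p volume g)) := by gcongr
    _ = _ := by
      rw [ENNReal.coe_mul, ENNReal.coe_toNNReal hIt]
      push_cast
      ring

end FiniteEstimate

/-! ### Lower bounds for the constants -/

section LowerBounds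

variable {X : Type u} [NormedAddCommGroup X] [NormedSpace ℂ X] {p : ℝ≥0∞}

theorem ENNReal.one_le_of_le_mul {a b : ℝ≥0∞} (h0 : b ≠ 0) (ht : b ≠ ⊤) (h : b ≤ a * b) :
    1 ≤ a := by
  by_contra! ha
  exact absurd h (not_le.2 (by simpa using ENNReal.mul_lt_mul_left h0 ht ha))

/-- A martingale with a single nonzero difference shows that the UMD constant is at least `1`. -/
theorem one_le_umdConst [Nontrivial X] (hp : p ≠ 0) : 1 ≤ umdConst p X := by
  refine le_sInf fun β hβ => ?_
  obtain ⟨x, hx⟩ := exists_ne (0 : X)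
  have h := hβ Unit ⊤ (Measure.dirac ()) (Filtration.const ℕ ⊤ le_rfl)
    (fun k _ => if k = 0 then x else 0) inferInstance inferInstance
    ⟨fun k => stronglyMeasurable_const, fun k => memLp_const _, fun k A _ _ => by simp⟩
    (fun _ => 1) (fun _ => Or.inl rfl) 1
  simp only [Finset.sum_range_one, if_true, one_smul] at h
  have e : eLpNorm (fun _ : Unit => x) p (Measure.dirac ()) = ‖x‖ₑ := by
    rw [eLpNorm_const x hp (NeZero.ne _)]
    simp
  rw [e] at h
  exact ENNReal.one_le_of_le_mul (enorm_ne_zero.2 hx) enorm_ne_top h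

open scoped ContDiff in
/-- On functions with Fourier support in the half-line `(0, ∞)` the Hilbert transform is the
multiplication by `-i`; hence its norm is at least `1`. -/
theorem one_le_hilbertConst [CompleteSpace X] [Nontrivial X] (hp : p ≠ 0) : 1 ≤ hilbertConst p X := by
  refine le_sInf fun A hA => ?_
  obtain ⟨x, hx⟩ := exists_ne (0 : X)
  let b : ContDiffBump (2 : ℝ) := ⟨1 / 2, 1, by norm_num, by norm_num⟩
  have hc : HasCompactSupport fun ξ => b ξ • x :=
    b.hasCompactSupport.mono fun ξ hξ h => hξ (by simp [h])
  have hs : ContDiff ℝ ∞ fun ξ => b ξ • x := b.contDiff.smul contDiff_const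
  set φ : 𝓢(ℝ, X) := hc.toSchwartzMap hs with hφ
  have hφb : ∀ ξ, φ ξ = b ξ • x := fun ξ => rfl
  have h := hA (𝓕⁻ φ)
  have e1 : (fun ξ : ℝ => (-Complex.I * ((Real.sign ξ : ℝ) : ℂ)) •
      𝓕 ((𝓕⁻ φ : 𝓢(ℝ, X)) : ℝ → X) ξ) = fun ξ => -Complex.I • φ ξ := by
    funext ξ
    rw [← SchwartzMap.fourier_coe, FourierTransform.fourier_fourierInv_eq]
    by_cases hξ : 0 < ξ
    · rw [Real.sign_of_pos hξ, Complex.ofReal_one, mul_one]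
    · have : b ξ = 0 := b.zero_of_le_dist (by
        rw [Real.dist_eq, abs_of_neg (by linarith)]
        have e : b.rOut = 1 := rfl
        rw [e]; linarith)
      rw [hφb, this, zero_smul, smul_zero, smul_zero]
  have e2 : hilbertTransform (𝓕⁻ φ) = -Complex.I • ((𝓕⁻ φ : 𝓢(ℝ, X)) : ℝ → X) := by
    rw [hilbertTransform, e1]
    funext t
    rw [Pi.smul_apply, SchwartzMap.fourierInv_coe, Real.fourierInv_eq, Real.fourierInv_eq,
      ← integral_smul]
    exact integral_congr_ae (Eventually.of_forall fun ξ => smul_comm _ _ _)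
  rw [e2, eLpNorm_const_smul, enorm_neg] at h
  have e3 : ‖Complex.I‖ₑ = 1 := by
    rw [← ofReal_norm, Complex.norm_I, ENNReal.ofReal_one]
  rw [e3, one_mul] at h
  refine ENNReal.one_le_of_le_mul (fun h0 => ?_) ((𝓕⁻ φ).memLp p volume).2.ne h
  rw [eLpNorm_eq_zero_iff (𝓕⁻ φ).continuous.aestronglyMeasurable hp] at h0
  have h1 : ((𝓕⁻ φ : 𝓢(ℝ, X)) : ℝ → X) = 0 :=
    ((𝓕⁻ φ).continuous.ae_eq_iff_eq volume continuous_zero).1 h0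
  have h2 : (𝓕⁻ φ : 𝓢(ℝ, X)) = 0 := DFunLike.coe_injective h1
  have h3 : φ = 0 :=
    calc φ = 𝓕 (𝓕⁻ φ : 𝓢(ℝ, X)) := (FourierTransform.fourier_fourierInv_eq φ).symm
      _ = 𝓕 (0 : 𝓢(ℝ, X)) := by rw [h2]
      _ = 0 := map_zero (FourierTransform.fourierCLM ℂ 𝓢(ℝ, X))
  have h4 : φ 2 = 0 := by rw [h3]; rfl
  rw [hφb, b.one_of_mem_closedBall (Metric.mem_closedBall_self (by norm_num [b])), one_smul] at h4
  exact hx h4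

end LowerBounds

/-! ### Convergent series -/

section Series

variable {X : Type u} [NormedAddCommGroup X] {p : ℝ≥0∞} {S : Type*} [MeasurableSpace S]
  {μ : Measure S}

theorem enorm_sum_toLp {g : ℤ → S → X} (hg : ∀ j, MemLp (g j) p μ) (J : Finset ℤ) :
    ‖∑ j ∈ J, (hg j).toLp‖ₑ = eLpNorm (fun s => ∑ j ∈ J, g j s) p μ := by
  rw [Lp.enorm_def]
  refine eLpNorm_congr_ae ?_
  filter_upwards [Lp.coeFn_finsetSum J fun j => (hg j).toLp,
    ae_all_iff.2 fun j => (hg j).coeFn_toLp] with s h1 h2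
  rw [h1, Finset.sum_apply]
  exact Finset.sum_congr rfl fun j _ => h2 j

theorem enorm_sum_toLp_sub {g : ℤ → S → X} (hg : ∀ j, MemLp (g j) p μ) {G : S → X}
    (hG : MemLp G p μ) (J : Finset ℤ) :
    ‖∑ j ∈ J, (hg j).toLp - hG.toLp‖ₑ = eLpNorm (fun s => (∑ j ∈ J, g j s) - G s) p μ := by
  rw [Lp.enorm_def]
  refine eLpNorm_congr_ae ?_
  filter_upwards [Lp.coeFn_finsetSum J fun j => (hg j).toLp, hG.coeFn_toLp,
    Lp.coeFn_sub (∑ j ∈ J, (hg j).toLp) hG.toLp,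
    ae_all_iff.2 fun j => (hg j).coeFn_toLp] with s h1 h2 h3 h4
  rw [h3, Pi.sub_apply, h1, h2, Finset.sum_apply]
  exact congrArg (· - G s) (Finset.sum_congr rfl fun j _ => h4 j)

/-- The convergence in `HasLpSum` is the unconditional convergence in the Banach space `L^p`. -/
theorem hasLpSum_iff_hasSum [Fact (1 ≤ p)] {g : ℤ → S → X} (hg : ∀ j, MemLp (g j) p μ)
    {G : S → X} (hG : MemLp G p μ) :
    HasLpSum p μ g G ↔ HasSum (fun j => (hg j).toLp) hG.toLp := by
  have h : HasSum (fun j => (hg j).toLp) hG.toLp ↔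
      Tendsto (fun J : Finset ℤ => eLpNorm (fun s => (∑ j ∈ J, g j s) - G s) p μ) atTop (𝓝 0) := by
    simp only [← enorm_sum_toLp_sub hg hG, HasSum, SummationFilter.unconditional_filter]
    rw [tendsto_iff_edist_tendsto_0]
    simp only [edist_eq_enorm_sub]
  rw [h]
  exact ⟨fun H => H.2.2, fun H => ⟨hg, hG, H⟩⟩

/-- A series whose finite partial sums are dominated in norm by those of a convergent series
converges, and the estimate passes to the sums. -/
theorem HasLpSum.exists_of_forall_le [CompleteSpace X] [Fact (1 ≤ p)] {g t : ℤ → S → X}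
    {F : S → X} (hF : HasLpSum p μ g F) (ht : ∀ j, MemLp (t j) p μ) {c : ℝ≥0∞} (hc : c ≠ ⊤)
    (hle : ∀ J : Finset ℤ, eLpNorm (fun s => ∑ j ∈ J, t j s) p μ
      ≤ c * eLpNorm (fun s => ∑ j ∈ J, g j s) p μ) :
    ∃ G, HasLpSum p μ t G ∧ eLpNorm G p μ ≤ c * eLpNorm F p μ := by
  have hg := hF.1
  have hsum := (hasLpSum_iff_hasSum hg hF.2.1).1 hF
  have hle' : ∀ J : Finset ℤ,
      ‖∑ j ∈ J, (ht j).toLp‖ ≤ c.toReal * ‖∑ j ∈ J, (hg j).toLp‖ := fun J => by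
    have h := hle J
    rw [← enorm_sum_toLp ht, ← enorm_sum_toLp hg] at h
    have h1 := ENNReal.toReal_mono (ENNReal.mul_ne_top hc enorm_ne_top) h
    rwa [ENNReal.toReal_mul, toReal_enorm, toReal_enorm] at h1
  have hst : Summable fun j => (ht j).toLp := by
    rw [summable_iff_vanishing_norm]
    intro ε hε
    have hc0 : 0 < c.toReal + 1 := by positivity
    obtain ⟨s, hs⟩ := summable_iff_vanishing_norm.1 hsum.summable (ε / (c.toReal + 1))
      (by positivity)
    refine ⟨s, fun J hJ => ?_⟩
    have h1 := hs J hJ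
    rw [lt_div_iff₀ hc0] at h1
    nlinarith [hle' J, norm_nonneg (∑ j ∈ J, (hg j).toLp)]
  obtain ⟨G, hG⟩ := hst
  have hGL := Lp.memLp G
  have hGe : hGL.toLp = G := Lp.toLp_coeFn G hGL
  refine ⟨G, (hasLpSum_iff_hasSum ht hGL).2 (by rwa [hGe]), ?_⟩
  have h1 : ‖G‖ ≤ c.toReal * ‖hF.2.1.toLp‖ :=
    le_of_tendsto_of_tendsto' hG.norm (hsum.norm.const_mul _) hle'
  rw [← Lp.enorm_toLp hF.2.1, ← Lp.enorm_def, ← ofReal_norm, ← ofReal_norm,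
    ← ENNReal.ofReal_toReal hc, ← ENNReal.ofReal_mul ENNReal.toReal_nonneg]
  exact ENNReal.ofReal_le_ofReal h1

end Series

section RandomTranslate

variable {n : ℕ} {X : Type u} [NormedAddCommGroup X] [NormedSpace ℂ X] {p : ℝ≥0∞}

theorem memLp_randomTranslate {Ω : Type v} [MeasurableSpace Ω] {P : Measure Ω}
    [IsProbabilityMeasure P] {r : ℤ → Ω → ℝ} (hr : IsRademacher P r)
    {f : ℤ → EuclideanSpace ℝ (Fin n) → X} (hf : ∀ j, MemLp (f j) p volume)
    (y : ℤ → EuclideanSpace ℝ (Fin n)) (j : ℤ) :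
    MemLp (randomTranslate r f y j) p (P.prod volume) := by
  have h1 : MemLp (fun x => f j (x - (2 : ℝ) ^ j • y j)) p volume :=
    (hf j).comp_measurePreserving (measurePreserving_sub_right volume _)
  have h2 : MemLp (fun z : Ω × EuclideanSpace ℝ (Fin n) => f j (z.2 - (2 : ℝ) ^ j • y j)) p
      (P.prod volume) := h1.comp_measurePreserving measurePreserving_snd
  have h3 : AEStronglyMeasurable (fun z : Ω × EuclideanSpace ℝ (Fin n) => r j z.1)
      (P.prod volume) := ((hr.measurable j).comp measurable_fst).aestronglyMeasurable
  refine h2.of_le (h3.smul h2.1) ?_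
  filter_upwards [Measure.quasiMeasurePreserving_fst.ae (hr.ae_eq j)] with z hz
  rw [randomTranslate, norm_smul]
  rcases hz with hz | hz <;> simp [hz]

end RandomTranslate

/-! ### The estimate in terms of the two constants -/

section Estimate

variable {X : Type u} [NormedAddCommGroup X] [NormedSpace ℂ X] {p : ℝ≥0∞}

theorem one_add_umdConst_le [CompleteSpace X] [Nontrivial X] (hp : p ≠ 0) (n : ℕ) :
    1 + umdConst p X ≤ 2 * (hilbertConst p X ^ n * umdConst p X ^ 2) := by
  have h1 := one_le_umdConst (X := X) hp
  have h2 := one_le_hilbertConst (X := X) hp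
  calc 1 + umdConst p X ≤ umdConst p X + umdConst p X := by gcongr
    _ = 2 * (1 * umdConst p X) := by ring
    _ ≤ 2 * (hilbertConst p X ^ n * umdConst p X ^ 2) := by
      gcongr
      · exact one_le_pow₀ h2
      · exact le_self_pow₀ h1 two_ne_zero

theorem le_exp_of_ofReal_posLog_le {a : ℝ} (ha : 0 ≤ a) {L : ℝ≥0∞} (hL : L ≠ ⊤)
    (h : ENNReal.ofReal (Real.posLog a) ≤ L) : a ≤ Real.exp L.toReal := by
  rcases ha.eq_or_lt with rfl | ha
  · positivity
  · rw [ENNReal.ofReal_le_iff_le_toReal hL] at h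
    rw [← Real.log_le_iff_le_exp ha]
    exact (le_max_right _ _).trans h

end Estimate

theorem theorem5p1 (n : ℕ) :
    ∃ C : ℝ≥0, ∀ (X : Type u) [NormedAddCommGroup X] [NormedSpace ℂ X] [CompleteSpace X]
      (p : ℝ≥0∞) [Fact (1 ≤ p)],
      IsUMD X → 1 < p → p ≠ ⊤ →
      ∀ (Ω : Type v) [MeasurableSpace Ω] (P : Measure Ω) [IsProbabilityMeasure P]
        (r : ℤ → Ω → ℝ), IsRademacher P r →
      ∀ (f : ℤ → Lp X p (volume : Measure (EuclideanSpace ℝ (Fin n))))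
        (y : ℤ → EuclideanSpace ℝ (Fin n)),
        (∀ j, fourierSupport (f j) ⊆ Metric.closedBall 0 ((2 : ℝ) ^ (-j))) →
        -- the estimate for finite sums
        (∀ J : Finset ℤ,
          eLpNorm (fun z => ∑ j ∈ J, randomTranslate r (fun j => f j) y j z) p (P.prod volume)
            ≤ C * hilbertConst p X ^ n * umdConst p X ^ 2
                * (1 + ⨆ j ∈ J, ENNReal.ofReal (Real.posLog ‖y j‖))
                * eLpNorm (fun z => ∑ j ∈ J, r j z.1 • f j z.2) p (P.prod volume)) ∧
        -- the estimate for convergent series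
        (∀ F : Ω × EuclideanSpace ℝ (Fin n) → X,
          HasLpSum p (P.prod volume) (fun j z => r j z.1 • f j z.2) F →
          C * hilbertConst p X ^ n * umdConst p X ^ 2
              * (1 + ⨆ j, ENNReal.ofReal (Real.posLog ‖y j‖)) ≠ ⊤ →
          ∃ G : Ω × EuclideanSpace ℝ (Fin n) → X,
            HasLpSum p (P.prod volume) (randomTranslate r (fun j => f j) y) G ∧
            eLpNorm G p (P.prod volume)
              ≤ C * hilbertConst p X ^ n * umdConst p X ^ 2
                  * (1 + ⨆ j, ENNReal.ofReal (Real.posLog ‖y j‖))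
                  * eLpNorm F p (P.prod volume)) := by
  obtain ⟨C, hC⟩ := exists_finite_estimate.{u, v} n
  refine ⟨2 * C, ?_⟩
  intro X _ _ _ p _ hX hp hp' Ω _ P _ r hr f y hf
  have hp0 : p ≠ 0 := (zero_lt_one.trans hp).ne'
  have hβ : umdConst p X ≠ ⊤ := (hX p hp hp').ne
  rcases subsingleton_or_nontrivial X with hs | hs
  · have h0 : ∀ g : Ω × EuclideanSpace ℝ (Fin n) → X, g = 0 := fun g => Subsingleton.elim _ _
    refine ⟨fun J => ?_, fun F _ _ => ⟨0, ⟨fun j => ?_, MemLp.zero', ?_⟩, ?_⟩⟩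
    · rw [h0 fun z => ∑ j ∈ J, randomTranslate r (fun j => f j) y j z, eLpNorm_zero]
      exact zero_le
    · rw [h0 (randomTranslate r (fun j => f j) y j)]
      exact MemLp.zero'
    · refine tendsto_const_nhds.congr fun J => ?_
      rw [h0 fun s => (∑ j ∈ J, randomTranslate r (fun j => f j) y j s)
        - (0 : Ω × EuclideanSpace ℝ (Fin n) → X) s, eLpNorm_zero]
    · rw [eLpNorm_zero]
      exact zero_le
  have hfin : ∀ J : Finset ℤ,
      eLpNorm (fun z => ∑ j ∈ J, randomTranslate r (fun j => f j) y j z) p (P.prod volume)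
        ≤ (2 * C : ℝ≥0) * hilbertConst p X ^ n * umdConst p X ^ 2
            * (1 + ⨆ j ∈ J, ENNReal.ofReal (Real.posLog ‖y j‖))
            * eLpNorm (fun z => ∑ j ∈ J, r j z.1 • f j z.2) p (P.prod volume) := by
    intro J
    set L : ℝ≥0∞ := ⨆ j ∈ J, ENNReal.ofReal (Real.posLog ‖y j‖) with hL
    have hLt : L ≠ ⊤ := by
      rw [hL, ← Finset.sup_eq_iSup]
      exact ((Finset.sup_lt_iff ENNReal.zero_lt_top).2 fun j _ => ENNReal.ofReal_lt_top).ne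
    have h1 := hC X p hβ hp hp' Ω P r hr f y hf J L.toReal ENNReal.toReal_nonneg fun j hj =>
      le_exp_of_ofReal_posLog_le (norm_nonneg _) hLt
        (le_iSup₂ (f := fun j (_ : j ∈ J) => ENNReal.ofReal (Real.posLog ‖y j‖)) j hj)
    have h2 : ENNReal.ofReal (1 + L.toReal) = 1 + L := by
      rw [ENNReal.ofReal_add zero_le_one ENNReal.toReal_nonneg, ENNReal.ofReal_one,
        ENNReal.ofReal_toReal hLt]
    refine h1.trans ?_
    rw [h2]
    refine mul_le_mul' ?_ le_rfl
    calc (C : ℝ≥0∞) * (1 + L) * (1 + umdConst p X)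
        ≤ C * (1 + L) * (2 * (hilbertConst p X ^ n * umdConst p X ^ 2)) := by
          gcongr
          exact one_add_umdConst_le hp0 n
      _ = _ := by push_cast; ring
  refine ⟨hfin, fun F hF hc => ?_⟩
  refine hF.exists_of_forall_le (memLp_randomTranslate hr (fun j => Lp.memLp (f j)) y) hc
    fun J => (hfin J).trans ?_
  gcongr
  exact iSup_le fun _ => le_rfl
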